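/- **Notation.** Let $\mathfrak S_n$ be the symmetric group and $\mathfrak B_n$ the group of signed permutations of $[n]$, i.e. bijections $w$ of $\{\pm1,\dots,\pm n\}$ with $w(-i)=-w(i)$; write $w$ as the word $w(1)\cdots w(n)$ and put $w(0)=0$. Let $\mathbb Z\mathfrak S=\bigoplus_{n\ge0}\mathbb Z\mathfrak S_n$ and $\mathbb Z\mathfrak B=\bigoplus_{n\ge0}\mathbb Z\mathfrak B_n$. For a word $a=a_1\cdots a_n$ of integers, $a[i,j]=a_i\cdots a_j$; $a|[i,j]$ is the subword of letters with absolute value in $[i,j]$; $\hat a$ lists the negative letters from right to left with sign removed, then the other letters from left to right. The standardization $\mathrm{st}(a)\in\mathfrak S_n$ numbers the letters in increasing order, ties from left to right. The signed standardization $\mathrm{st}^B(a)\in\mathfrak B_n$ numbers the letters by increasing absolute value, ties broken first from right to left for negative letters and then from left to right for the other ones, and then puts minus signs at the positions of the negative letters of $a$. Identify a finite set with the sum of its elements. For $u\in\mathfrak B_m$, $v\in\mathfrak S_n$ put $$u ⧢^B v=\{w\in\mathfrak B_{m+n}: w|[1,m]=u,\ \mathrm{st}(\hat w|[m+1,m+n])=v\},\qquad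 \Delta^B u=\sum_{i=0}^m \mathrm{st}^B(u[1,i])\otimes\mathrm{st}(u[i+1,m]),$$ $$u\Cup^B v=\{w\in\mathfrak B_{m+n}:\mathrm{st}^B(w[1,m])=u,\ \mathrm{st}(w[m+1,m+n])=v\},\qquad \Cap^B u=\sum_{i=0}^m u|[1,i]\otimes\mathrm{st}(\hat u|[i+1,m]).$$ Let $(\mathbb Z\mathfrak S,⧢,\Delta)$ and $(\mathbb Z\mathfrak S,\Cup,\Cap)$ be the two forms of the Malvenuto–Reutenauer graded Hopf algebra, given by the same formulas for $u\in\mathfrak S_m$ with $\mathfrak B$, $\mathrm{st}^B$, $\hat w$, $\hat u$ replaced by $\mathfrak S$, $\mathrm{st}$, $w$, $u$. For $W=\mathfrak S$ or $\mathfrak B$ let $D(w)=\{i: w(i)>w(i+1)\}$ for $w\in W_n$, with $1\le i\le n-1$ for $\mathfrak S$ and $0\le i\le n-1$ for $\mathfrak B$; let $D_I(W_n)=\sum_{w\in W_n,\,D(w)=I}w$, let $\Sigma(W_n)$ be the span of the $D_I(W_n)$ and $\Sigma(W)=\bigoplus_n\Sigma(W_n)\overset{\imath}{\hookrightarrow}\mathbb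 ZW$. Let $\Sigma^*(W)=\bigoplus_n\Sigma(W_n)^*$ and let $\chi:\mathbb ZW\to\Sigma^*(W)$ be $\chi(w)=\langle w,\imath(\cdot)\rangle$, where $\langle u,v\rangle=\delta_{u,v}$. Put $\chi'(w)=\chi(w^{-1})$ and $\Lambda(W)=\chi'(\Sigma(W))\overset{\imath}{\hookrightarrow}\Sigma^*(W)$, spanned by $\Lambda_I(W_n)=\chi'(D_I(W_n))$. **Theorem.** (i) $(\mathbb Z\mathfrak S,⧢,\Delta)$ is a graded Hopf algebra over $\mathbb Z$, and $(\mathbb Z\mathfrak B,⧢^B,\Delta^B)$ is a graded right module and a graded right comodule over it. (ii) The same holds for $(\mathbb Z\mathfrak S,\Cup,\Cap)$ and $(\mathbb Z\mathfrak B,\Cup^B,\Cap^B)$. (iii) The pairings $\langle u,v\rangle=\delta_{u,v}$ on $\mathbb Z\mathfrak S$ and on $\mathbb Z\mathfrak B$ are perfect in each degree, different degrees are orthogonal, and via them $(\mathbb Z\mathfrak B,⧢^B,\Delta^B)$ over $(\mathbb Z\mathfrak S,⧢,\Delta)$ is dual to $(\mathbb Z\mathfrak B,\Cup^B,\Cap^B)$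 over $(\mathbb Z\mathfrak S,\Cup,\Cap)$: the action (product) on either side is dual to the coaction (coproduct) on the other. (iv) $w\mapsto w^{-1}$ is an isomorphism of graded modules and comodules from $(\mathbb Z\mathfrak B,⧢^B,\Delta^B)$ to $(\mathbb Z\mathfrak B,\Cup^B,\Cap^B)$ along the isomorphism of graded Hopf algebras $w\mapsto w^{-1}$ from $(\mathbb Z\mathfrak S,⧢,\Delta)$ to $(\mathbb Z\mathfrak S,\Cup,\Cap)$. (v) The diamond with upper path $\Sigma(\mathfrak B)\overset{\imath}\hookrightarrow\mathbb Z\mathfrak B\overset{\chi'}\twoheadrightarrow\Sigma^*(\mathfrak B)$ and lower path $\Sigma(\mathfrak B)\overset{\chi'}\twoheadrightarrow\Lambda(\mathfrak B)\overset{\imath}\hookrightarrow\Sigma^*(\mathfrak B)$ commutes, with injections and surjections as indicated. There are unique graded Hopf algebra structures on $\Sigma(\mathfrak S),\Sigma^*(\mathfrak S),\Lambda(\mathfrak S)$ and unique graded right module and comodule structures over these on $\Sigma(\mathfrak B),\Sigma^*(\mathfrak B),\Lambda(\mathfrak B)$, respectively, such that, with $(\mathbb Z\mathfrak S,\Cup,\Cap)$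 and $(\mathbb Z\mathfrak B,\Cup^B,\Cap^B)$ at the top, the four maps of the type A diamond are morphisms of graded Hopf algebras, the four maps of the type B diamond are morphisms of graded modules and comodules along them, and (vi) holds. (vi) Reflecting the diamond across the vertical line through $\mathbb Z\mathfrak B$ and $\Lambda(\mathfrak B)$ gives the dual diagram. That is: the evaluation pairing of $\Sigma$ with $\Sigma^*$ and the pairing $\langle u,v\rangle'=\delta_{u^{-1},v}$ of $\mathbb ZW$ with itself are perfect in each degree with different degrees orthogonal; there are well-defined symmetric nondegenerate bilinear forms on $\Lambda(\mathfrak S)$ and on $\Lambda(\mathfrak B)$ with $\langle\Lambda_I(W_m),\Lambda_J(W_n)\rangle=\#\{w\in W_n:D(w^{-1})=I,\ D(w)=J\}$ if $m=n$ and $0$ if $m\ne n$; via these pairings, in type A products and units are dual to coproducts and counits, and in type B actions are dual to coactions, between $\Sigma$ and $\Sigma^*$, between $\mathbb ZW$ and itself, and between $\Lambda$ and itself; and in type B, $\imath:\Sigma(\mathfrak B)\to\mathbb Z\mathfrak B$ is dual to $\chi':\mathbb Z\mathfrak B\to\Sigma^*(\mathfrak B)$ and $\chi':\Sigma(\mathfrak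 B)\to\Lambda(\mathfrak B)$ is dual to $\imath:\Lambda(\mathfrak B)\to\Sigma^*(\mathfrak B)$. -/

import Mathlib

open scoped TensorProduct

namespace MRTypeB

/-! ## Words -/

/-- The word `â`: the negative letters, read from right to left and with the sign removed, followed
by the other letters, read from left to right. -/
def hat (a : List ℤ) : List ℤ :=
  ((a.filter (fun x => decide (x < 0))).reverse.map (fun x => -x)) ++
    a.filter (fun x => decide (0 ≤ x))

/-- The subword `a|[i,j]` of the letters of `a` whose absolute values lie in `[i,j]`. -/
def restrictTo (a : List ℤ) (i j : ℕ) : List ℤ :=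
  a.filter (fun x => decide ((i : ℤ) ≤ |x| ∧ |x| ≤ (j : ℤ)))

/-- The subword `a[i+1,j] = a_{i+1} ⋯ a_j` of consecutive letters (positions are counted
from `1`). -/
def segment (a : List ℤ) (i j : ℕ) : List ℤ := (a.take j).drop i

/-! ## Permutations and signed permutations -/

/-- The symmetric group on `n` letters; the index `i : Fin n` stands for the letter `i + 1`. -/
abbrev SymGrp (n : ℕ) : Type := Equiv.Perm (Fin n)

/-- `[±n] = {±1, …, ±n}`: the pair `(k, false)` stands for `k + 1` and `(k, true)` for
`-(k + 1)`. -/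
abbrev PM (n : ℕ) : Type := Fin n × Bool

/-- `x ↦ -x` on `[±n]`. -/
def PM.neg {n : ℕ} (x : PM n) : PM n := (x.1, !x.2)

/-- The integer in `{±1, …, ±n}` that an element of `[±n]` stands for. -/
def PM.val {n : ℕ} (x : PM n) : ℤ := if x.2 then -((x.1 : ℤ) + 1) else (x.1 : ℤ) + 1

/-- The hyperoctahedral group: bijections `w` of `[±n]` with `w (-x) = -w x`. -/
def hyperoctahedral (n : ℕ) : Subgroup (Equiv.Perm (PM n)) where
  carrier := {w | ∀ x, w (PM.neg x) = PM.neg (w x)}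
  mul_mem' := by
    intro a b ha hb x
    have ha' : ∀ x, a (PM.neg x) = PM.neg (a x) := ha
    have hb' : ∀ x, b (PM.neg x) = PM.neg (b x) := hb
    simp [Equiv.Perm.mul_apply, ha', hb']
  one_mem' := by intro x; rfl
  inv_mem' := by
    intro a ha x
    have ha' : ∀ x, a (PM.neg x) = PM.neg (a x) := ha
    rw [Equiv.Perm.inv_eq_iff_eq, ha']
    simp

/-- The group of signed permutations of `[n]`. -/
abbrev HypGrp (n : ℕ) : Type := ↥(hyperoctahedral n)

instance (n : ℕ) : DecidablePred (fun w => w ∈ hyperoctahedral n) := fun w =>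
  inferInstanceAs (Decidable (∀ x, w (PM.neg x) = PM.neg (w x)))

instance (n : ℕ) : Fintype (HypGrp n) :=
  inferInstanceAs (Fintype {w : Equiv.Perm (PM n) // w ∈ hyperoctahedral n})

/-- One-line notation `w(1) ⋯ w(n)`. -/
def wordA {n : ℕ} (w : SymGrp n) : List ℤ := List.ofFn (fun i => ((w i : ℕ) : ℤ) + 1)

/-- Window notation `w(1) ⋯ w(n)`. -/
def wordB {n : ℕ} (w : HypGrp n) : List ℤ := List.ofFn (fun i => PM.val (w.1 (i, false)))

/-- The descents `i ∈ {1, …, n-1}`, `w(i) > w(i+1)`, of a permutation. -/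
def desA (n : ℕ) (w : SymGrp n) : Finset ℕ :=
  (Finset.Ico 1 n).filter (fun i => (wordA w).getD i 0 < (wordA w).getD (i - 1) 0)

/-- The descents `i ∈ {0, …, n-1}`, `w(i) > w(i+1)`, of a signed permutation, where
`w(0) = 0`. -/
def desB (n : ℕ) (w : HypGrp n) : Finset ℕ :=
  (Finset.range n).filter (fun i => (wordB w).getD i 0 < (0 :: wordB w).getD i 0)

/-! ## Standardization -/

/-- The permutation in `⊔ S_n` obtained from a word by numbering its letters from smallest to
largest, breaking ties from left to right (`Tuple.sort` is the stable sort). -/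
def stA (a : List ℤ) : Σ n, SymGrp n := ⟨a.length, (Tuple.sort a.get)⁻¹⟩

/-- The signed permutation with `|w(i)| = p(i)` that is negative at `i` exactly when `ε i`. -/
def mkSigned {n : ℕ} (p : Equiv.Perm (Fin n)) (ε : Fin n → Bool) : HypGrp n :=
  ⟨{ toFun := fun x => (p x.1, x.2 ^^ ε x.1)
     invFun := fun x => (p.symm x.1, x.2 ^^ ε (p.symm x.1))
     left_inv := by intro x; ext <;> simp
     right_inv := by intro x; ext <;> simp },
   by intro x; simp [PM.neg]⟩

/-- Letters are compared by absolute value; among equal absolute values the negative letters come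
first, from right to left, followed by the others from left to right. -/
def keyB (a : List ℤ) (i : Fin a.length) : ℤ ×ₗ ℤ :=
  toLex (|a.get i|, if a.get i < 0 then -(((i : ℕ) : ℤ) + 1) else ((i : ℕ) : ℤ))

/-- The signed standardization of a word, as an element of `⊔ B_n`. -/
def stB (a : List ℤ) : Σ n, HypGrp n :=
  ⟨a.length, mkSigned (Tuple.sort (keyB a))⁻¹ (fun i => decide (a.get i < 0))⟩

/-! ## Free modules on `⊔ W_n` -/

/-- The free `ℤ`-module with basis `⊔ W_n`, that is `⨁ ℤ W_n`. -/
abbrev FreeZ (W : ℕ → Type) : Type := (Σ n, W n) →₀ ℤ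

/-- `ℤ𝔖`, with basis all permutations. -/
abbrev ZS : Type := FreeZ SymGrp

/-- `ℤ𝔅`, with basis all signed permutations. -/
abbrev ZB : Type := FreeZ HypGrp

/-- The basis element of an element of `⊔ W_n`. -/
noncomputable def bas {W : ℕ → Type} (w : Σ n, W n) : FreeZ W := Finsupp.single w 1

/-- The bilinear map with prescribed values on basis elements. -/
noncomputable def bilin {α β M : Type} [AddCommGroup M] (f : α → β → M) :
    (α →₀ ℤ) →ₗ[ℤ] (β →₀ ℤ) →ₗ[ℤ] M :=
  Finsupp.linearCombination ℤ (fun a => Finsupp.linearCombination ℤ (f a))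

/-- `ℤ W_n` inside `⨁ ℤ W_n`. -/
noncomputable def freeGrade (W : ℕ → Type) (n : ℕ) : Submodule ℤ (FreeZ W) :=
  Submodule.span ℤ (Set.range (fun w : W n => bas ⟨n, w⟩))

/-- The pairing `⟨u, v⟩ = δ_{u,v}`. -/
noncomputable def delta (W : ℕ → Type) : FreeZ W →ₗ[ℤ] FreeZ W →ₗ[ℤ] ℤ :=
  open Classical in bilin (fun u v => if u = v then 1 else 0)

/-- The linear map `w ↦ w⁻¹`. -/
noncomputable def invMap (W : ℕ → Type) [∀ n, Group (W n)] : FreeZ W ≃ₗ[ℤ] FreeZ W :=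
  Finsupp.domLCongr (Equiv.sigmaCongrRight (fun n => Equiv.inv (W n)))

/-! ## Hopf algebras, modules, comodules: data and axioms -/

/-- Structure maps of the shape of a bialgebra. -/
structure HopfOps (A : Type) [AddCommGroup A] where
  mul : A →ₗ[ℤ] A →ₗ[ℤ] A
  one : A
  comul : A →ₗ[ℤ] A ⊗[ℤ] A
  counit : A →ₗ[ℤ] ℤ

/-- Structure maps of the shape of a right action and a right coaction. -/
structure ActOps (M A : Type) [AddCommGroup M] [AddCommGroup A] where
  act : M →ₗ[ℤ] A →ₗ[ℤ] M
  coact : M →ₗ[ℤ] M ⊗[ℤ] A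

/-- The degree `n` part of the tensor product of two graded modules. -/
def tensorGrade {M A : Type} [AddCommGroup M] [AddCommGroup A]
    (gM : ℕ → Submodule ℤ M) (gA : ℕ → Submodule ℤ A) (n : ℕ) : Submodule ℤ (M ⊗[ℤ] A) :=
  ⨆ (i : ℕ) (j : ℕ) (_ : i + j = n),
    LinearMap.range (TensorProduct.map (gM i).subtype (gA j).subtype)

/-- `A = ⨁ g n` is a graded Hopf algebra over `ℤ` with the structure maps `H`. -/
structure IsGradedHopf {A : Type} [AddCommGroup A] (g : ℕ → Submodule ℤ A) (H : HopfOps A) :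
    Prop where
  decomp : DirectSum.IsInternal g
  one_mem : H.one ∈ g 0
  mul_mem : ∀ m n, ∀ a ∈ g m, ∀ b ∈ g n, H.mul a b ∈ g (m + n)
  comul_mem : ∀ n, ∀ a ∈ g n, H.comul a ∈ tensorGrade g g n
  counit_eq_zero : ∀ n, n ≠ 0 → ∀ a ∈ g n, H.counit a = 0
  one_mul : ∀ a, H.mul H.one a = a
  mul_one : ∀ a, H.mul a H.one = a
  mul_assoc : ∀ a b c, H.mul (H.mul a b) c = H.mul a (H.mul b c)
  counit_left : ∀ a, TensorProduct.lid ℤ A (H.counit.rTensor A (H.comul a)) = a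
  counit_right : ∀ a, TensorProduct.rid ℤ A (H.counit.lTensor A (H.comul a)) = a
  coassoc : ∀ a, TensorProduct.assoc ℤ A A A (H.comul.rTensor A (H.comul a)) =
    H.comul.lTensor A (H.comul a)
  counit_one : H.counit H.one = 1
  counit_mul : ∀ a b, H.counit (H.mul a b) = H.counit a * H.counit b
  comul_one : H.comul H.one = H.one ⊗ₜ[ℤ] H.one
  comul_mul : ∀ a b, H.comul (H.mul a b) =
    TensorProduct.map₂ H.mul H.mul (H.comul a) (H.comul b)
  antipode : ∃ S : A →ₗ[ℤ] A, (∀ n, ∀ a ∈ g n, S a ∈ g n) ∧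
    (∀ a, TensorProduct.lift H.mul (S.rTensor A (H.comul a)) = H.counit a • H.one) ∧
    (∀ a, TensorProduct.lift H.mul (S.lTensor A (H.comul a)) = H.counit a • H.one)

/-- `M = ⨁ gM n` is a graded right module and a graded right comodule, by the maps `R`, over
`A = ⨁ gA n` with the structure maps `H`. No compatibility of action and coaction is required. -/
structure IsGradedModComod {M A : Type} [AddCommGroup M] [AddCommGroup A]
    (gM : ℕ → Submodule ℤ M) (gA : ℕ → Submodule ℤ A) (H : HopfOps A) (R : ActOps M A) :
    Prop where
  decomp : DirectSum.IsInternal gM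
  act_mem : ∀ m n, ∀ x ∈ gM m, ∀ a ∈ gA n, R.act x a ∈ gM (m + n)
  act_one : ∀ x, R.act x H.one = x
  act_act : ∀ x a b, R.act (R.act x a) b = R.act x (H.mul a b)
  coact_mem : ∀ n, ∀ x ∈ gM n, R.coact x ∈ tensorGrade gM gA n
  coact_counit : ∀ x, TensorProduct.rid ℤ M (H.counit.lTensor M (R.coact x)) = x
  coact_coact : ∀ x, TensorProduct.assoc ℤ M A A (R.coact.rTensor A (R.coact x)) =
    H.comul.lTensor M (R.coact x)

/-- `f` is a morphism of graded Hopf algebras. -/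
structure IsHopfHom {A A' : Type} [AddCommGroup A] [AddCommGroup A']
    (g : ℕ → Submodule ℤ A) (g' : ℕ → Submodule ℤ A') (H : HopfOps A) (H' : HopfOps A')
    (f : A →ₗ[ℤ] A') : Prop where
  map_mem : ∀ n, ∀ a ∈ g n, f a ∈ g' n
  map_one : f H.one = H'.one
  map_mul : ∀ a b, f (H.mul a b) = H'.mul (f a) (f b)
  map_counit : ∀ a, H'.counit (f a) = H.counit a
  map_comul : ∀ a, H'.comul (f a) = TensorProduct.map f f (H.comul a)

/-- `φ` is a morphism of graded modules and comodules, along `f : A → A'`. -/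
structure IsModComodHom {M M' A A' : Type} [AddCommGroup M] [AddCommGroup M'] [AddCommGroup A]
    [AddCommGroup A'] (gM : ℕ → Submodule ℤ M) (gM' : ℕ → Submodule ℤ M')
    (R : ActOps M A) (R' : ActOps M' A') (f : A →ₗ[ℤ] A') (φ : M →ₗ[ℤ] M') : Prop where
  map_mem : ∀ n, ∀ x ∈ gM n, φ x ∈ gM' n
  map_act : ∀ x a, φ (R.act x a) = R'.act (φ x) (f a)
  map_coact : ∀ x, R'.coact (φ x) = TensorProduct.map φ f (R.coact x)

/-- The pairing `⟨x ⊗ a, y ⊗ b⟩ = p(x, y) q(a, b)` of tensor products. -/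
noncomputable def pairTensor {M N A B : Type} [AddCommGroup M] [AddCommGroup N] [AddCommGroup A]
    [AddCommGroup B] (p : M →ₗ[ℤ] N →ₗ[ℤ] ℤ) (q : A →ₗ[ℤ] B →ₗ[ℤ] ℤ)
    (s : M ⊗[ℤ] A) (t : N ⊗[ℤ] B) : ℤ :=
  TensorProduct.lid ℤ ℤ (TensorProduct.map₂ p q s t)

/-- The Hopf algebra structures `H` and `H'` are dual to each other via the pairing `q`. -/
structure IsHopfDual {A A' : Type} [AddCommGroup A] [AddCommGroup A']
    (H : HopfOps A) (H' : HopfOps A') (q : A →ₗ[ℤ] A' →ₗ[ℤ] ℤ) : Prop where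
  mul_comul : ∀ a b c, q (H.mul a b) c = pairTensor q q (a ⊗ₜ b) (H'.comul c)
  comul_mul : ∀ a b c, q a (H'.mul b c) = pairTensor q q (H.comul a) (b ⊗ₜ c)
  one_counit : ∀ c, q H.one c = H'.counit c
  counit_one : ∀ a, q a H'.one = H.counit a

/-- Via the pairings `p` and `q`, the action of each of `R` and `R'` is dual to the coaction of the
other. -/
structure IsModComodDual {M M' A A' : Type} [AddCommGroup M] [AddCommGroup M'] [AddCommGroup A]
    [AddCommGroup A'] (R : ActOps M A) (R' : ActOps M' A')
    (p : M →ₗ[ℤ] M' →ₗ[ℤ] ℤ) (q : A →ₗ[ℤ] A' →ₗ[ℤ] ℤ) : Prop where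
  act_coact : ∀ x a y, p (R.act x a) y = pairTensor p q (x ⊗ₜ a) (R'.coact y)
  coact_act : ∀ x y a, p x (R'.act y a) = pairTensor p q (R.coact x) (y ⊗ₜ a)

/-- A perfect pairing of graded modules: parts of different degrees are orthogonal and each degree
is perfectly paired. It identifies each module with the graded dual of the other. -/
structure IsGradedPerfect {M N : Type} [AddCommGroup M] [AddCommGroup N]
    (gM : ℕ → Submodule ℤ M) (gN : ℕ → Submodule ℤ N) (p : M →ₗ[ℤ] N →ₗ[ℤ] ℤ) : Prop where
  orthogonal : ∀ m n, m ≠ n → ∀ x ∈ gM m, ∀ y ∈ gN n, p x y = 0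
  perfect : ∀ n, (p.domRestrict₁₂ (gM n) (gN n)).IsPerfPair

/-- The graded dual `⨁ (M_n)^*` of `M = ⨁ M_n`: the linear forms that vanish in all large
degrees. -/
def gradedDual {M : Type} [AddCommGroup M] (g : ℕ → Submodule ℤ M) :
    Submodule ℤ (Module.Dual ℤ M) where
  carrier := {f | ∃ N, ∀ n, N ≤ n → ∀ x ∈ g n, f x = 0}
  zero_mem' := ⟨0, fun _ _ _ _ => rfl⟩
  add_mem' := by
    rintro f f' ⟨N, h⟩ ⟨N', h'⟩
    refine ⟨max N N', fun n hn x hx => ?_⟩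
    simp [h n (le_trans (le_max_left _ _) hn) x hx, h' n (le_trans (le_max_right _ _) hn) x hx]
  smul_mem' := by
    rintro c f ⟨N, h⟩
    exact ⟨N, fun n hn x hx => by simp [h n hn x hx]⟩

/-- `(M_n)^*` inside the graded dual: the forms that vanish in all degrees other than `n`. -/
def gradedDualGrade {M : Type} [AddCommGroup M] (g : ℕ → Submodule ℤ M) (n : ℕ) :
    Submodule ℤ (gradedDual g) where
  carrier := {f | ∀ m, m ≠ n → ∀ x ∈ g m, f.1 x = 0}
  zero_mem' := fun _ _ _ _ => rfl
  add_mem' := by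
    intro f f' h h' m hm x hx
    simp [h m hm x hx, h' m hm x hx]
  smul_mem' := by
    intro c f h m hm x hx
    simp [h m hm x hx]

/-! ## Descent classes -/

section Descents

variable {W : ℕ → Type} [∀ n, Fintype (W n)] (des : ∀ n, W n → Finset ℕ)

/-- The descent class `D_I(W_n)`, as the sum of its elements. -/
noncomputable def descClass (n : ℕ) (I : Finset ℕ) : FreeZ W :=
  ∑ w : W n with des n w = I, bas ⟨n, w⟩

/-- `Σ(W_n)`, the span of the descent classes of `W_n`. -/
noncomputable def descSpan (n : ℕ) : Submodule ℤ (FreeZ W) :=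
  Submodule.span ℤ (Set.range (descClass des n))

/-- `Σ(W) = ⨁ Σ(W_n)`. The embedding `ι` into `⨁ ℤ W_n` is `(Sig des).subtype`. -/
noncomputable def Sig : Submodule ℤ (FreeZ W) := ⨆ n, descSpan des n

/-- The grading of `Σ(W)`. -/
noncomputable def sigGrade (n : ℕ) : Submodule ℤ (Sig des) :=
  (descSpan des n).comap (Sig des).subtype

/-- `Σ^*(W) = ⨁ Σ(W_n)^*`. -/
noncomputable abbrev SigDual : Submodule ℤ (Module.Dual ℤ (Sig des)) := gradedDual (sigGrade des)

/-- The evaluation pairing of `Σ(W)` with `Σ^*(W)`. -/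
noncomputable def evalPair : Sig des →ₗ[ℤ] SigDual des →ₗ[ℤ] ℤ := (SigDual des).subtype.flip

theorem delta_bas_descSpan (u : Σ n, W n) (n : ℕ) (hn : n ≠ u.1) (x : FreeZ W)
    (hx : x ∈ descSpan des n) : delta W (bas u) x = 0 := by
  induction hx using Submodule.span_induction with
  | mem x h =>
    obtain ⟨I, rfl⟩ := h
    simp only [descClass, map_sum]
    refine Finset.sum_eq_zero fun w _ => ?_
    have : u ≠ ⟨n, w⟩ := fun h => hn (by rw [h])
    simp [delta, bilin, bas, this]
  | zero => simp
  | add x y _ _ h h' => simp [h, h']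
  | smul c x _ h => simp [h]

/-- The dual `χ` of `ι`: `χ(u)` is the linear form `x ↦ ⟨u, ι x⟩` on `Σ(W)`. On `u ∈ W_n` this is
the element `D^*_I(W_n)`, `I = D(u)`, of the dual basis. -/
noncomputable def chi : FreeZ W →ₗ[ℤ] SigDual des :=
  Finsupp.linearCombination ℤ fun u =>
    ⟨(delta W (bas u)).comp (Sig des).subtype, u.1 + 1, fun n hn x hx =>
      delta_bas_descSpan des u n (by omega) x hx⟩

theorem descClass_mem (n : ℕ) (I : Finset ℕ) : descClass des n I ∈ Sig des :=
  (le_iSup (descSpan des) n) (Submodule.subset_span ⟨I, rfl⟩)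

/-- `D_I(W_n)` as an element of `Σ(W)`. -/
noncomputable def descElt (n : ℕ) (I : Finset ℕ) : Sig des :=
  ⟨descClass des n I, descClass_mem des n I⟩

variable [∀ n, Group (W n)]

/-- `χ' = χ ∘ ( )⁻¹`. -/
noncomputable def chi' : FreeZ W →ₗ[ℤ] SigDual des := (chi des).comp (invMap W).toLinearMap

/-- `Λ(W) = χ'(Σ(W))`. The embedding `ι` into `Σ^*(W)` is `(Lam des).subtype`. -/
noncomputable def Lam : Submodule ℤ (SigDual des) := (Sig des).map (chi' des)

/-- The grading of `Λ(W)` by `Λ(W_n) = χ'(Σ(W_n))`. -/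
noncomputable def lamGrade (n : ℕ) : Submodule ℤ (Lam des) :=
  ((descSpan des n).map (chi' des)).comap (Lam des).subtype

/-- The surjection `χ' : Σ(W) → Λ(W)`. -/
noncomputable def chiSig : Sig des →ₗ[ℤ] Lam des := (chi' des).submoduleMap (Sig des)

/-- `Λ_I(W_n) = χ'(D_I(W_n))`. -/
noncomputable def lamElt (n : ℕ) (I : Finset ℕ) : Lam des := chiSig des (descElt des n I)

/-- `b` is the bilinear form on `Λ(W)` with
`⟨Λ_I(W_m), Λ_J(W_n)⟩ = #{w ∈ W_n : D(w⁻¹) = I, D(w) = J}` if `m = n` and `0` otherwise. -/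
def IsLamForm (b : Lam des →ₗ[ℤ] Lam des →ₗ[ℤ] ℤ) : Prop :=
  ∀ m n I J, b (lamElt des m I) (lamElt des n J) =
    if m = n then
      (((Finset.univ.filter fun w : W n => des n w⁻¹ = I ∧ des n w = J).card : ℕ) : ℤ)
    else 0

end Descents

/-! ## Products and coproducts on `ℤ𝔖` -/

/-- The counit of `ℤ𝔖`: the coefficient of the empty permutation. -/
noncomputable def counitS : ZS →ₗ[ℤ] ℤ :=
  Finsupp.linearCombination ℤ (fun u : Σ n, SymGrp n => if u.1 = 0 then (1 : ℤ) else 0)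

/-- The unit of `ℤ𝔖`: the empty permutation. -/
noncomputable def oneS : ZS := bas ⟨0, 1⟩

/-- `(ℤ𝔖, ⧢, Δ)`:
`u ⧢ v = {w : w|[1,m] = u, st(w|[m+1,m+n]) = v}`, `Δ u = ∑ st(u[1,i]) ⊗ st(u[i+1,m])`. -/
noncomputable def shuffleS : HopfOps ZS where
  mul := bilin fun u v => ∑ w : SymGrp (u.1 + v.1) with
    restrictTo (wordA w) 1 u.1 = wordA u.2 ∧
      stA (restrictTo (wordA w) (u.1 + 1) (u.1 + v.1)) = v, bas ⟨u.1 + v.1, w⟩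
  one := oneS
  comul := Finsupp.linearCombination ℤ fun u => ∑ i ∈ Finset.range (u.1 + 1),
    bas (stA (segment (wordA u.2) 0 i)) ⊗ₜ[ℤ] bas (stA (segment (wordA u.2) i u.1))
  counit := counitS

/-- `(ℤ𝔖, ⋓, ⋒)`:
`u ⋓ v = {w : st(w[1,m]) = u, st(w[m+1,m+n]) = v}`, `⋒ u = ∑ u|[1,i] ⊗ st(u|[i+1,m])`; the word
`u|[1,i]` is the one-line notation of a permutation, which is its own standardization. -/
noncomputable def cupS : HopfOps ZS where
  mul := bilin fun u v => ∑ w : SymGrp (u.1 + v.1) with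
    stA (segment (wordA w) 0 u.1) = u ∧
      stA (segment (wordA w) u.1 (u.1 + v.1)) = v, bas ⟨u.1 + v.1, w⟩
  one := oneS
  comul := Finsupp.linearCombination ℤ fun u => ∑ i ∈ Finset.range (u.1 + 1),
    bas (stA (restrictTo (wordA u.2) 1 i)) ⊗ₜ[ℤ] bas (stA (restrictTo (wordA u.2) (i + 1) u.1))
  counit := counitS

/-! ## Actions and coactions of `ℤ𝔖` on `ℤ𝔅` -/

/-- `(ℤ𝔅, ⧢^B, Δ^B)`: `u ⧢^B v = {w : w|[1,m] = u, st(ŵ|[m+1,m+n]) = v}`,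
`Δ^B u = ∑ st^B(u[1,i]) ⊗ st(u[i+1,m])`. -/
noncomputable def shuffleB : ActOps ZB ZS where
  act := bilin fun u v => ∑ w : HypGrp (u.1 + v.1) with
    restrictTo (wordB w) 1 u.1 = wordB u.2 ∧
      stA (restrictTo (hat (wordB w)) (u.1 + 1) (u.1 + v.1)) = v, bas ⟨u.1 + v.1, w⟩
  coact := Finsupp.linearCombination ℤ fun u => ∑ i ∈ Finset.range (u.1 + 1),
    bas (stB (segment (wordB u.2) 0 i)) ⊗ₜ[ℤ] bas (stA (segment (wordB u.2) i u.1))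

/-- `(ℤ𝔅, ⋓^B, ⋒^B)`: `u ⋓^B v = {w : st^B(w[1,m]) = u, st(w[m+1,m+n]) = v}`,
`⋒^B u = ∑ u|[1,i] ⊗ st(û|[i+1,m])`; the word `u|[1,i]` is the window notation of a signed
permutation, which is its own signed standardization. -/
noncomputable def cupB : ActOps ZB ZS where
  act := bilin fun u v => ∑ w : HypGrp (u.1 + v.1) with
    stB (segment (wordB w) 0 u.1) = u ∧
      stA (segment (wordB w) u.1 (u.1 + v.1)) = v, bas ⟨u.1 + v.1, w⟩
  coact := Finsupp.linearCombination ℤ fun u => ∑ i ∈ Finset.range (u.1 + 1),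
    bas (stB (restrictTo (wordB u.2) 1 i)) ⊗ₜ[ℤ]
      bas (stA (restrictTo (hat (wordB u.2)) (i + 1) u.1))

/-- The pairing `⟨u, v⟩ = δ_{u⁻¹, v}`, by which the module `⨁ ℤ W_n` in the middle of the diagram
is identified with its own dual. -/
noncomputable def deltaInv (W : ℕ → Type) [∀ n, Group (W n)] : FreeZ W →ₗ[ℤ] FreeZ W →ₗ[ℤ] ℤ :=
  (delta W).comp (invMap W).toLinearMap

/-- The diamond of structure maps: the part of the data that is not yet fixed, namely the
structure on `Σ(𝔖)`, `Σ^*(𝔖)`, `Λ(𝔖)` and on `Σ(𝔅)`, `Σ^*(𝔅)`, `Λ(𝔅)`. -/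
structure DiamondOps where
  sigS : HopfOps (Sig desA)
  dualS : HopfOps (SigDual desA)
  lamS : HopfOps (Lam desA)
  sigB : ActOps (Sig desB) (Sig desA)
  dualB : ActOps (SigDual desB) (SigDual desA)
  lamB : ActOps (Lam desB) (Lam desA)

end MRTypeB

open MRTypeB

/-! The method is to compute with words instead of permutations. Write st(c) for the basis element
`sA c` of a word c with distinct letters. The coproduct of `shuffleS` sends st(c) to the sum of
st(a) ⊗ st(b) over all cuts c = ab. If the letters of y all exceed those of x, the product of st(x)
and st(y) is the sum of st(c) over the shuffles c of x and y; since st(y) does not change when y is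
shifted, this covers all products. These rules (`isWordHopf`) involve no restandardization.
Coassociativity is then the remark that cutting twice gives three pieces, and compatibility of
product and coproduct holds because a cut of a shuffle is a pair of shuffles of the pieces
(`sum_famA_splits`). Signed words obey the same kind of rules with signed shuffles (`isWordMod`).
The antipode comes for free from connectedness (`IsConn.exists_antipode`).

Associativity is never checked on words. For the pairing δ, the products and actions of `cupS` and
`cupB` are transposes of the coproduct and coaction of `shuffleS` and `shuffleB`, so they are
associative because deconcatenation is coassociative (`IsDual.isAlg`, `IsActDual.isMod`). Inversion
exchanges restriction to an interval of values with restriction to an interval of positions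
(`stA_restrictTo_hat`, `stB_restrictTo`); it is therefore an isomorphism between the two structures,
and whatever is known for one of them holds for the other.

For the descent classes, let h_n be the identity of 𝔖_n, which is the class with empty descent set.
If I lies below m, then D_I(W_m) · h_n = D_I(W_{m+n}) + D_{I ∪ {m}}(W_{m+n}), because only the
descent at the junction is free. By induction on the largest descent, Σ is closed under the coaction
as soon as the coactions of D_∅ and of x · h_n are under control. In type A the bialgebra axiom
provides this. In type B no such axiom is available, but for an increasing word one can cut a signed
shuffle directly, which gives coact(x · h_n) = ∑ x₀ h_j ⊗ h_i x₁ h_k over i + j + k = n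
(`IsWordMod.coact_act_inc`). The factor h_i on the left comes from the letters that became negative
in the right half: read backwards with changed signs, an increasing word is again increasing.

The diamond is then formal. The pairing ⟨u,v⟩' makes ℤW self-dual, and χ' is the transpose of ι
(`evalPair_chi'`). Since Σ is a substructure of ℤW, its annihilator is compatible with all structure
maps, so these descend to Σ^* (`exists_quot_act_of_dual`); Λ is the image of the morphism Σ → Σ^*
and inherits a structure from it (`exists_sub_act_of_comp`). Axioms pass forward along surjections
and back along injections. Over ℤ the modules involved are torsion-free, hence flat, so injections
stay injective in tensor products. The form on Λ is induced by evaluation, and uniqueness holds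
because each entry receives a surjection from, or embeds into, an entry already determined. -/

open scoped TensorProduct

namespace MRTypeB

/-! ## Graded modules -/

section Graded

variable {R : Type} [CommRing R]
variable {M N A B : Type} [AddCommGroup M] [AddCommGroup N] [AddCommGroup A] [AddCommGroup B]
  [Module R M] [Module R N] [Module R A] [Module R B]

/-- The degree `n` part of the tensor product of two graded modules over a ring. -/
def tensorDeg (gM : ℕ → Submodule R M) (gA : ℕ → Submodule R A) (n : ℕ) :
    Submodule R (M ⊗[R] A) :=
  ⨆ (i : ℕ) (j : ℕ) (_ : i + j = n),
    LinearMap.range (TensorProduct.map (gM i).subtype (gA j).subtype)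

theorem tmul_mem_tensorDeg {gM : ℕ → Submodule R M} {gA : ℕ → Submodule R A} {i j n : ℕ}
    (h : i + j = n) {x : M} {a : A} (hx : x ∈ gM i) (ha : a ∈ gA j) :
    x ⊗ₜ[R] a ∈ tensorDeg gM gA n := by
  refine Submodule.mem_iSup_of_mem i (Submodule.mem_iSup_of_mem j (Submodule.mem_iSup_of_mem h ?_))
  exact ⟨(⟨x, hx⟩ : gM i) ⊗ₜ (⟨a, ha⟩ : gA j), by simp⟩

theorem tensorDeg_le {gM : ℕ → Submodule R M} {gA : ℕ → Submodule R A} {n : ℕ}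
    {P : Submodule R (M ⊗[R] A)}
    (h : ∀ i j, i + j = n → ∀ x ∈ gM i, ∀ a ∈ gA j, x ⊗ₜ[R] a ∈ P) :
    tensorDeg gM gA n ≤ P := by
  refine iSup_le fun i => iSup_le fun j => iSup_le fun hij => ?_
  rintro _ ⟨t, rfl⟩
  induction t with
  | zero => simp
  | tmul x a => simpa using h i j hij x x.2 a a.2
  | add s t hs ht => rw [map_add]; exact add_mem hs ht

theorem map_tensorDeg_le {gM : ℕ → Submodule R M} {gA : ℕ → Submodule R A}
    {gN : ℕ → Submodule R N} {gB : ℕ → Submodule R B} {φ : M →ₗ[R] N} {f : A →ₗ[R] B}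
    (hφ : ∀ n, ∀ x ∈ gM n, φ x ∈ gN n) (hf : ∀ n, ∀ a ∈ gA n, f a ∈ gB n) (n : ℕ) :
    (tensorDeg gM gA n).map (TensorProduct.map φ f) ≤ tensorDeg gN gB n := by
  rw [Submodule.map_le_iff_le_comap]
  refine tensorDeg_le fun i j hij x hx a ha => ?_
  simpa using tmul_mem_tensorDeg hij (hφ i x hx) (hf j a ha)

theorem internal_iSup {g : ℕ → Submodule R M} (h : DirectSum.IsInternal g) : ⨆ n, g n = ⊤ :=
  h.submodule_iSup_eq_top

/-- Two linear maps that agree on all homogeneous elements are equal. -/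
theorem internal_ext {g : ℕ → Submodule R M} (h : ⨆ n, g n = ⊤) {F G : M →ₗ[R] N}
    (hFG : ∀ n, ∀ a ∈ g n, F a = G a) : F = G := by
  refine LinearMap.ext fun a => ?_
  have : (⨆ n, g n) ≤ LinearMap.eqLocus F G := iSup_le fun n a ha => hFG n a ha
  exact this (h ▸ Submodule.mem_top)

/-- Linear maps on the homogeneous parts extend to the whole module. -/
theorem exists_of_internal {g : ℕ → Submodule R M} (h : DirectSum.IsInternal g)
    (f : ∀ n, g n →ₗ[R] N) : ∃ F : M →ₗ[R] N, ∀ n (a : g n), F a = f n a := by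
  let e := LinearEquiv.ofBijective (DirectSum.coeLinearMap g) h
  refine ⟨(DirectSum.toModule R ℕ N f).comp e.symm.toLinearMap, fun n a => ?_⟩
  have : e.symm (a : M) = DirectSum.lof R ℕ (fun n => g n) n a := by
    rw [LinearEquiv.symm_apply_eq]
    exact (DirectSum.coeLinearMap_lof g n a).symm
  simp [this]

end Graded

/-! ## Parts of the axioms of a graded Hopf algebra -/

section Parts

variable {R : Type} [CommRing R] {A : Type} [AddCommGroup A] [Module R A]

/-- Structure maps of the shape of a bialgebra over a ring. -/
structure Ops (R A : Type) [CommRing R] [AddCommGroup A] [Module R A] where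
  mul : A →ₗ[R] A →ₗ[R] A
  one : A
  comul : A →ₗ[R] A ⊗[R] A
  counit : A →ₗ[R] R

/-- The Hopf axioms are kept in separate blocks because they are reached by different routes: the
coalgebra and compatibility axioms by computing with words, the algebra axioms by duality, the
antipode from connectedness. -/
structure IsAlg (H : Ops R A) : Prop where
  one_mul : ∀ a, H.mul H.one a = a
  mul_one : ∀ a, H.mul a H.one = a
  mul_assoc : ∀ a b c, H.mul (H.mul a b) c = H.mul a (H.mul b c)

structure IsCoalg (H : Ops R A) : Prop where
  counit_left : ∀ a, TensorProduct.lid R A (H.counit.rTensor A (H.comul a)) = a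
  counit_right : ∀ a, TensorProduct.rid R A (H.counit.lTensor A (H.comul a)) = a
  coassoc : ∀ a, TensorProduct.assoc R A A A (H.comul.rTensor A (H.comul a)) =
    H.comul.lTensor A (H.comul a)

structure IsBi (H : Ops R A) : Prop where
  counit_one : H.counit H.one = 1
  counit_mul : ∀ a b, H.counit (H.mul a b) = H.counit a * H.counit b
  comul_one : H.comul H.one = H.one ⊗ₜ[R] H.one
  comul_mul : ∀ a b, H.comul (H.mul a b) =
    TensorProduct.map₂ H.mul H.mul (H.comul a) (H.comul b)

/-- Homogeneity of the structure maps, and connectedness. -/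
structure IsConn (g : ℕ → Submodule R A) (H : Ops R A) : Prop where
  decomp : DirectSum.IsInternal g
  one_mem : H.one ∈ g 0
  mul_mem : ∀ m n, ∀ a ∈ g m, ∀ b ∈ g n, H.mul a b ∈ g (m + n)
  comul_mem : ∀ n, ∀ a ∈ g n, H.comul a ∈ tensorDeg g g n
  counit_eq_zero : ∀ n, n ≠ 0 → ∀ a ∈ g n, H.counit a = 0
  conn : ∀ a ∈ g 0, a = H.counit a • H.one

/-- The ring with the multiplication of `H`. -/
abbrev IsAlg.ring {H : Ops R A} (h : IsAlg H) : Ring A :=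
  { (inferInstance : AddCommGroup A) with
    mul := fun a b => H.mul a b
    one := H.one
    one_mul := h.one_mul
    mul_one := h.mul_one
    mul_assoc := h.mul_assoc
    zero_mul := fun a => by change H.mul 0 a = 0; simp
    mul_zero := fun a => by change H.mul a 0 = 0; simp
    left_distrib := fun a b c => by change H.mul a (b + c) = H.mul a b + H.mul a c; simp
    right_distrib := fun a b c => by change H.mul (a + b) c = H.mul a c + H.mul b c; simp }

/-- The coalgebra with the comultiplication of `H`. -/
abbrev IsCoalg.coalgebra {H : Ops R A} (h : IsCoalg H) : Coalgebra R A where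
  comul := H.comul
  counit := H.counit
  coassoc := LinearMap.ext h.coassoc
  rTensor_counit_comp_comul := by
    ext a
    apply (TensorProduct.lid R A).injective
    simpa using h.counit_left a
  lTensor_counit_comp_comul := by
    ext a
    apply (TensorProduct.rid R A).injective
    simpa using h.counit_right a

-- In the convolution algebra of endomorphisms put x = 1 - id. By connectedness x vanishes in degree
-- 0, so x ^ k vanishes in all degrees below k, and id = 1 - x is inverted by the geometric series,
-- which is a finite sum on each degree.
open WithConv in
theorem IsConn.exists_antipode {g : ℕ → Submodule R A} {H : Ops R A} (hg : IsConn g H)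
    (ha : IsAlg H) (hc : IsCoalg H) :
    ∃ S : A →ₗ[R] A, (∀ n, ∀ a ∈ g n, S a ∈ g n) ∧
    (∀ a, TensorProduct.lift H.mul (S.rTensor A (H.comul a)) = H.counit a • H.one) ∧
    (∀ a, TensorProduct.lift H.mul (S.lTensor A (H.comul a)) = H.counit a • H.one) := by
  let _ := ha.ring
  let _ : Algebra R A := Algebra.ofModule
    (fun r x y => by change H.mul (r • x) y = r • H.mul x y; simp)
    (fun r x y => by change H.mul x (r • y) = r • H.mul x y; simp)
  let _ := hc.coalgebra
  have hmul : ∀ t : A ⊗[R] A, LinearMap.mul' R A t = TensorProduct.lift H.mul t := by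
    intro t
    induction t with
    | zero => simp
    | tmul x y => simp; rfl
    | add s t hs ht => simp [hs, ht]
  have hconv : ∀ (F G : WithConv (A →ₗ[R] A)) a, (F * G) a =
      TensorProduct.lift H.mul (TensorProduct.map F.ofConv G.ofConv (H.comul a)) := by
    intro F G a
    rw [LinearMap.convMul_apply, hmul]; rfl
  have hone : ∀ a, (1 : WithConv (A →ₗ[R] A)) a = H.counit a • H.one := by
    intro a
    rw [LinearMap.convOne_apply, Algebra.algebraMap_eq_smul_one]; rfl
  let x : WithConv (A →ₗ[R] A) := 1 - toConv LinearMap.id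
  have hx : ∀ a, x a = H.counit a • H.one - a := by
    intro a
    rw [← hone a]; rfl
  have hx0 : ∀ a ∈ g 0, x a = 0 := fun a h => by rw [hx, ← hg.conn a h, sub_self]
  have hxg : ∀ n, ∀ a ∈ g n, x a ∈ g n := by
    intro n a h
    rw [hx]
    refine sub_mem ?_ h
    by_cases hn : n = 0
    · subst hn; exact Submodule.smul_mem _ _ hg.one_mem
    · simp [hg.counit_eq_zero n hn a h]
  have hpow : ∀ k n, ∀ a ∈ g n, (x ^ k) a ∈ g n ∧ (n < k → (x ^ k) a = 0) := by
    intro k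
    induction k with
    | zero =>
      intro n a h
      refine ⟨?_, fun h => absurd h (by omega)⟩
      rw [pow_zero, hone]
      by_cases hn : n = 0
      · subst hn; exact Submodule.smul_mem _ _ hg.one_mem
      · simp [hg.counit_eq_zero n hn a h]
    | succ k ih =>
      intro n a h
      rw [pow_succ, hconv]
      constructor
      · have : tensorDeg g g n ≤ (g n).comap
            (TensorProduct.lift H.mul ∘ₗ TensorProduct.map (x ^ k).ofConv x.ofConv) := by
          refine tensorDeg_le fun i j hij b hb c hc => ?_
          subst hij
          exact hg.mul_mem i j _ (ih i b hb).1 _ (hxg j c hc)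
        exact this (hg.comul_mem n a h)
      · intro hn
        have : tensorDeg g g n ≤ LinearMap.ker
            (TensorProduct.lift H.mul ∘ₗ TensorProduct.map (x ^ k).ofConv x.ofConv) := by
          refine tensorDeg_le fun i j hij b hb c hc => ?_
          rw [LinearMap.mem_ker, LinearMap.comp_apply, TensorProduct.map_tmul,
            TensorProduct.lift.tmul]
          -- A homogeneous tensor of degree n ≤ k either has right factor of degree 0, where `x`
          -- vanishes, or left factor of degree below k, where `x ^ k` vanishes.
          rcases Nat.eq_zero_or_pos j with rfl | hj
          · have : x.ofConv c = 0 := hx0 c hc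
            rw [this, map_zero]
          · have : (x ^ k).ofConv b = 0 := (ih i b hb).2 (by omega)
            rw [this, map_zero, LinearMap.zero_apply]
        exact this (hg.comul_mem n a h)
  let T : ℕ → WithConv (A →ₗ[R] A) := fun n => ∑ k ∈ Finset.range (n + 1), x ^ k
  have hTapp : ∀ n a, (T n).ofConv a = ∑ k ∈ Finset.range (n + 1), (x ^ k) a := by
    intro n a
    simp only [T]
    rw [WithConv.ofConv_sum, LinearMap.sum_apply]
  -- The antipode is the geometric series, truncated on degree n after `x ^ n`; by `hpow` any later
  -- truncation gives the same map there.
  obtain ⟨S, hS⟩ := exists_of_internal hg.decomp (fun n => (T n).ofConv.comp (g n).subtype)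
  have hS' : ∀ n i, i ≤ n → ∀ a ∈ g i, S a = (T n).ofConv a := by
    intro n i hi a h
    have h1 : S a = (T i).ofConv a := hS i ⟨a, h⟩
    rw [h1, hTapp, hTapp]
    refine Finset.sum_subset (fun k hk => ?_) (fun k _ hk => ?_)
    · simp at hk ⊢; omega
    · exact (hpow k i a h).2 (by simpa using hk)
  have hid : toConv LinearMap.id = 1 - x := by simp [x]
  have key : ∀ n, ∀ a ∈ g n, (1 - x ^ (n + 1)) a = H.counit a • H.one := by
    intro n a h
    have : (1 - x ^ (n + 1)) a = (1 : WithConv (A →ₗ[R] A)) a - (x ^ (n + 1)) a := rfl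
    rw [this, (hpow (n + 1) n a h).2 (by omega), sub_zero, hone]
  refine ⟨S, fun n a h => ?_, fun a => ?_, fun a => ?_⟩
  · rw [hS' n n le_rfl a h, hTapp]
    exact sum_mem fun k _ => (hpow k n a h).1
  · have : TensorProduct.lift H.mul ∘ₗ S.rTensor A ∘ₗ H.comul =
        LinearMap.toSpanSingleton R A H.one ∘ₗ H.counit := by
      refine internal_ext (internal_iSup hg.decomp) fun n a h => ?_
      have h1 := key n a h
      -- In degree n the power `x ^ (n + 1)` is zero, so (1 + x + ⋯ + x ^ n)(1 - x) = 1 - x ^ (n +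
      -- 1) acts as the convolution unit.
      rw [← geom_sum_mul_neg, ← hid, hconv] at h1
      simp only [LinearMap.comp_apply, LinearMap.toSpanSingleton_apply]
      rw [← h1]
      congr 1
      have : tensorDeg g g n ≤ LinearMap.eqLocus (S.rTensor A)
          (TensorProduct.map (T n).ofConv LinearMap.id) := by
        refine tensorDeg_le fun i j hij b hb c hc => ?_
        simp [LinearMap.mem_eqLocus, hS' n i (by omega) b hb]
      exact this (hg.comul_mem n a h)
    exact LinearMap.congr_fun this a
  · have : TensorProduct.lift H.mul ∘ₗ S.lTensor A ∘ₗ H.comul =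
        LinearMap.toSpanSingleton R A H.one ∘ₗ H.counit := by
      refine internal_ext (internal_iSup hg.decomp) fun n a h => ?_
      have h1 := key n a h
      rw [← mul_neg_geom_sum, ← hid, hconv] at h1
      simp only [LinearMap.comp_apply, LinearMap.toSpanSingleton_apply]
      rw [← h1]
      congr 1
      have : tensorDeg g g n ≤ LinearMap.eqLocus (S.lTensor A)
          (TensorProduct.map LinearMap.id (T n).ofConv) := by
        refine tensorDeg_le fun i j hij b hb c hc => ?_
        simp [LinearMap.mem_eqLocus, hS' n j (by omega) c hc]
      exact this (hg.comul_mem n a h)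
    exact LinearMap.congr_fun this a

end Parts

/-! ## Actions, coactions, morphisms and pairings over a ring -/

section Transfer

variable {R : Type} [CommRing R]

/-- Structure maps of the shape of a right action and a right coaction over a ring. -/
structure Act (R M A : Type) [CommRing R] [AddCommGroup M] [AddCommGroup A] [Module R M]
    [Module R A] where
  act : M →ₗ[R] A →ₗ[R] M
  coact : M →ₗ[R] M ⊗[R] A

variable {M M' N N' P Q A A' B B' C D : Type}
  [AddCommGroup M] [AddCommGroup M'] [AddCommGroup N] [AddCommGroup N'] [AddCommGroup A]
  [AddCommGroup A'] [AddCommGroup B] [AddCommGroup B'] [AddCommGroup P] [AddCommGroup Q]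
  [AddCommGroup C] [AddCommGroup D]
  [Module R M] [Module R M'] [Module R N] [Module R N'] [Module R A] [Module R A'] [Module R B]
  [Module R B'] [Module R P] [Module R Q] [Module R C] [Module R D]

/-- The regular action and coaction. -/
def Ops.self (H : Ops R A) : Act R A A := ⟨H.mul, H.comul⟩

structure IsMod (H : Ops R A) (T : Act R M A) : Prop where
  act_one : ∀ x, T.act x H.one = x
  act_act : ∀ x a b, T.act (T.act x a) b = T.act x (H.mul a b)

structure IsComod (H : Ops R A) (T : Act R M A) : Prop where
  coact_counit : ∀ x, TensorProduct.rid R M (H.counit.lTensor M (T.coact x)) = x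
  coact_coact : ∀ x, TensorProduct.assoc R M A A (T.coact.rTensor A (T.coact x)) =
    H.comul.lTensor M (T.coact x)

/-- An algebra is a right module over itself in which the unit also acts trivially from the left.
With this and its dual, every statement on modules and comodules serves type A as well as type B. -/
theorem isAlg_iff {H : Ops R A} : IsAlg H ↔ (∀ a, H.mul H.one a = a) ∧ IsMod H H.self :=
  ⟨fun h => ⟨h.one_mul, h.mul_one, h.mul_assoc⟩, fun h => ⟨h.1, h.2.1, h.2.2⟩⟩

theorem isCoalg_iff {H : Ops R A} : IsCoalg H ↔
    (∀ a, TensorProduct.lid R A (H.counit.rTensor A (H.comul a)) = a) ∧ IsComod H H.self :=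
  ⟨fun h => ⟨h.counit_left, h.counit_right, h.coassoc⟩, fun h => ⟨h.1, h.2.1, h.2.2⟩⟩

/-- Homogeneity of an action and a coaction. -/
structure IsModGr (gM : ℕ → Submodule R M) (gA : ℕ → Submodule R A) (T : Act R M A) : Prop where
  decomp : DirectSum.IsInternal gM
  act_mem : ∀ m n, ∀ x ∈ gM m, ∀ a ∈ gA n, T.act x a ∈ gM (m + n)
  coact_mem : ∀ n, ∀ x ∈ gM n, T.coact x ∈ tensorDeg gM gA n

structure IsOpsHom (H : Ops R A) (H' : Ops R A') (f : A →ₗ[R] A') : Prop where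
  map_one : f H.one = H'.one
  map_mul : ∀ a b, f (H.mul a b) = H'.mul (f a) (f b)
  map_counit : ∀ a, H'.counit (f a) = H.counit a
  map_comul : ∀ a, H'.comul (f a) = TensorProduct.map f f (H.comul a)

structure IsActHom (T : Act R M A) (T' : Act R M' A') (f : A →ₗ[R] A') (φ : M →ₗ[R] M') :
    Prop where
  map_act : ∀ x a, φ (T.act x a) = T'.act (φ x) (f a)
  map_coact : ∀ x, T'.coact (φ x) = TensorProduct.map φ f (T.coact x)

/-- The pairing `⟨x ⊗ a, y ⊗ b⟩ = p(x, y) q(a, b)` of tensor products. -/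
noncomputable def pairT (p : M →ₗ[R] N →ₗ[R] R) (q : A →ₗ[R] B →ₗ[R] R)
    (s : M ⊗[R] A) (t : N ⊗[R] B) : R :=
  TensorProduct.lid R R (TensorProduct.map₂ p q s t)

structure IsDual (H : Ops R A) (H' : Ops R A') (q : A →ₗ[R] A' →ₗ[R] R) : Prop where
  mul_comul : ∀ a b c, q (H.mul a b) c = pairT q q (a ⊗ₜ b) (H'.comul c)
  comul_mul : ∀ a b c, q a (H'.mul b c) = pairT q q (H.comul a) (b ⊗ₜ c)
  one_counit : ∀ c, q H.one c = H'.counit c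
  counit_one : ∀ a, q a H'.one = H.counit a

structure IsActDual (T : Act R M A) (T' : Act R M' A')
    (p : M →ₗ[R] M' →ₗ[R] R) (q : A →ₗ[R] A' →ₗ[R] R) : Prop where
  act_coact : ∀ x a y, p (T.act x a) y = pairT p q (x ⊗ₜ a) (T'.coact y)
  coact_act : ∀ x y a, p x (T'.act y a) = pairT p q (T.coact x) (y ⊗ₜ a)

theorem IsOpsHom.self {H : Ops R A} {H' : Ops R A'} {f : A →ₗ[R] A'} (h : IsOpsHom H H' f) :
    IsActHom H.self H'.self f f := ⟨h.map_mul, h.map_comul⟩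

theorem IsDual.self {H : Ops R A} {H' : Ops R A'} {q : A →ₗ[R] A' →ₗ[R] R} (h : IsDual H H' q) :
    IsActDual H.self H'.self q q := ⟨h.mul_comul, h.comul_mul⟩

/-! ### Transfer of axioms along morphisms -/

/-- Both sides of each comodule axiom are natural in morphisms. This lemma and the next three record
that, so that axioms can be pushed forward along surjections and pulled back along injections. -/
theorem IsOpsHom.map_lid {H : Ops R A} {H' : Ops R A'} {f : A →ₗ[R] A'} (h : IsOpsHom H H' f)
    (a : A) : TensorProduct.lid R A' (H'.counit.rTensor A' (H'.comul (f a))) =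
      f (TensorProduct.lid R A (H.counit.rTensor A (H.comul a))) := by
  rw [h.map_comul]
  generalize H.comul a = t
  induction t with
  | zero => simp
  | tmul x y => simp [h.map_counit]
  | add s t hs ht => simp only [map_add, hs, ht]

theorem IsActHom.map_rid {H : Ops R A} {H' : Ops R A'} {f : A →ₗ[R] A'} {T : Act R M A}
    {T' : Act R M' A'} {φ : M →ₗ[R] M'} (hf : IsOpsHom H H' f) (h : IsActHom T T' f φ) (x : M) :
    TensorProduct.rid R M' (H'.counit.lTensor M' (T'.coact (φ x))) =
      φ (TensorProduct.rid R M (H.counit.lTensor M (T.coact x))) := by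
  rw [h.map_coact]
  generalize T.coact x = t
  induction t with
  | zero => simp
  | tmul x y => simp [hf.map_counit]
  | add s t hs ht => simp only [map_add, hs, ht]

theorem IsActHom.map_assoc {f : A →ₗ[R] A'} {T : Act R M A}
    {T' : Act R M' A'} {φ : M →ₗ[R] M'} (h : IsActHom T T' f φ) (x : M) :
    TensorProduct.assoc R M' A' A' (T'.coact.rTensor A' (T'.coact (φ x))) =
      TensorProduct.map φ (TensorProduct.map f f)
        (TensorProduct.assoc R M A A (T.coact.rTensor A (T.coact x))) := by
  rw [h.map_coact]
  generalize T.coact x = t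
  induction t with
  | zero => simp
  | tmul x y =>
    simp only [TensorProduct.map_tmul, LinearMap.rTensor_tmul, h.map_coact]
    generalize T.coact x = s
    induction s with
    | zero => simp
    | tmul x z => simp
    | add s t hs ht => simp only [TensorProduct.add_tmul, map_add, hs, ht]
  | add s t hs ht => simp only [map_add, hs, ht]

theorem IsActHom.map_lTensor {H : Ops R A} {H' : Ops R A'} {f : A →ₗ[R] A'} {T : Act R M A}
    {T' : Act R M' A'} {φ : M →ₗ[R] M'} (hf : IsOpsHom H H' f) (h : IsActHom T T' f φ) (x : M) :
    H'.comul.lTensor M' (T'.coact (φ x)) =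
      TensorProduct.map φ (TensorProduct.map f f) (H.comul.lTensor M (T.coact x)) := by
  rw [h.map_coact]
  generalize T.coact x = t
  induction t with
  | zero => simp
  | tmul x y => simp [hf.map_comul]
  | add s t hs ht => simp only [map_add, hs, ht]

theorem map₂_map_map (F : M →ₗ[R] A →ₗ[R] P) (G : N →ₗ[R] B →ₗ[R] Q)
    (F' : M' →ₗ[R] A' →ₗ[R] C) (G' : N' →ₗ[R] B' →ₗ[R] D)
    (φ : M →ₗ[R] M') (ψ : N →ₗ[R] N') (f : A →ₗ[R] A') (g : B →ₗ[R] B')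
    (u : P →ₗ[R] C) (v : Q →ₗ[R] D)
    (hF : ∀ x a, u (F x a) = F' (φ x) (f a)) (hG : ∀ x a, v (G x a) = G' (ψ x) (g a))
    (s : M ⊗[R] N) (t : A ⊗[R] B) :
    TensorProduct.map u v (TensorProduct.map₂ F G s t) =
      TensorProduct.map₂ F' G' (TensorProduct.map φ ψ s) (TensorProduct.map f g t) := by
  induction s with
  | zero => simp
  | tmul x y =>
    induction t with
    | zero => simp
    | tmul a b => simp [hF, hG]
    | add s t hs ht => simp only [map_add, hs, ht]
  | add s t hs ht => simp only [map_add, LinearMap.add_apply, hs, ht]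

theorem IsMod.of_surjective {H : Ops R A} {H' : Ops R A'} {f : A →ₗ[R] A'} {T : Act R M A}
    {T' : Act R M' A'} {φ : M →ₗ[R] M'} (hf : IsOpsHom H H' f) (h : IsActHom T T' f φ)
    (sf : Function.Surjective f) (sφ : Function.Surjective φ) (hT : IsMod H T) : IsMod H' T' where
  act_one x := by
    obtain ⟨x, rfl⟩ := sφ x
    rw [← hf.map_one, ← h.map_act, hT.act_one]
  act_act x a b := by
    obtain ⟨x, rfl⟩ := sφ x
    obtain ⟨a, rfl⟩ := sf a
    obtain ⟨b, rfl⟩ := sf b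
    rw [← h.map_act, ← h.map_act, hT.act_act, ← hf.map_mul, h.map_act]

theorem IsComod.of_surjective {H : Ops R A} {H' : Ops R A'} {f : A →ₗ[R] A'} {T : Act R M A}
    {T' : Act R M' A'} {φ : M →ₗ[R] M'} (hf : IsOpsHom H H' f) (h : IsActHom T T' f φ)
    (sφ : Function.Surjective φ) (hT : IsComod H T) : IsComod H' T' where
  coact_counit x := by
    obtain ⟨x, rfl⟩ := sφ x
    rw [h.map_rid hf, hT.coact_counit]
  coact_coact x := by
    obtain ⟨x, rfl⟩ := sφ x
    rw [h.map_assoc, h.map_lTensor hf, hT.coact_coact]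

theorem IsMod.of_injective {H : Ops R A} {H' : Ops R A'} {f : A →ₗ[R] A'} {T : Act R M A}
    {T' : Act R M' A'} {φ : M →ₗ[R] M'} (hf : IsOpsHom H H' f) (h : IsActHom T T' f φ)
    (iφ : Function.Injective φ) (hT : IsMod H' T') : IsMod H T where
  act_one x := iφ (by rw [h.map_act, hf.map_one, hT.act_one])
  act_act x a b := iφ (by rw [h.map_act, h.map_act, hT.act_act, h.map_act, hf.map_mul])

/-- Coassociativity is an identity in a threefold tensor product, so the embedding has to stay
injective there; this is what `i3` supplies. -/
theorem IsComod.of_injective {H : Ops R A} {H' : Ops R A'} {f : A →ₗ[R] A'} {T : Act R M A}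
    {T' : Act R M' A'} {φ : M →ₗ[R] M'} (hf : IsOpsHom H H' f) (h : IsActHom T T' f φ)
    (iφ : Function.Injective φ)
    (i3 : Function.Injective (TensorProduct.map φ (TensorProduct.map f f)))
    (hT : IsComod H' T') : IsComod H T where
  coact_counit x := iφ (by rw [← h.map_rid hf, hT.coact_counit])
  coact_coact x := i3 (by rw [← h.map_assoc, ← h.map_lTensor hf, hT.coact_coact])

theorem IsAlg.of_surjective {H : Ops R A} {H' : Ops R A'} {f : A →ₗ[R] A'}
    (hf : IsOpsHom H H' f) (sf : Function.Surjective f) (h : IsAlg H) : IsAlg H' := by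
  refine isAlg_iff.2 ⟨fun a => ?_, .of_surjective hf hf.self sf sf (isAlg_iff.1 h).2⟩
  obtain ⟨a, rfl⟩ := sf a
  rw [← hf.map_one, ← hf.map_mul, h.one_mul]

theorem IsCoalg.of_surjective {H : Ops R A} {H' : Ops R A'} {f : A →ₗ[R] A'}
    (hf : IsOpsHom H H' f) (sf : Function.Surjective f) (h : IsCoalg H) : IsCoalg H' := by
  refine isCoalg_iff.2 ⟨fun a => ?_, .of_surjective hf hf.self sf (isCoalg_iff.1 h).2⟩
  obtain ⟨a, rfl⟩ := sf a
  rw [hf.map_lid, h.counit_left]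

theorem IsBi.of_surjective {H : Ops R A} {H' : Ops R A'} {f : A →ₗ[R] A'}
    (hf : IsOpsHom H H' f) (sf : Function.Surjective f) (h : IsBi H) : IsBi H' where
  counit_one := by rw [← hf.map_one, hf.map_counit, h.counit_one]
  counit_mul a b := by
    obtain ⟨a, rfl⟩ := sf a
    obtain ⟨b, rfl⟩ := sf b
    rw [← hf.map_mul, hf.map_counit, hf.map_counit, hf.map_counit, h.counit_mul]
  comul_one := by rw [← hf.map_one, hf.map_comul, h.comul_one, TensorProduct.map_tmul]
  comul_mul a b := by
    obtain ⟨a, rfl⟩ := sf a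
    obtain ⟨b, rfl⟩ := sf b
    rw [← hf.map_mul, hf.map_comul, hf.map_comul, hf.map_comul, h.comul_mul]
    exact map₂_map_map _ _ _ _ _ _ _ _ _ _ hf.map_mul hf.map_mul _ _

theorem IsAlg.of_injective {H : Ops R A} {H' : Ops R A'} {f : A →ₗ[R] A'}
    (hf : IsOpsHom H H' f) (jf : Function.Injective f) (h : IsAlg H') : IsAlg H :=
  isAlg_iff.2 ⟨fun a => jf (by rw [hf.map_mul, hf.map_one, h.one_mul]),
    .of_injective hf hf.self jf (isAlg_iff.1 h).2⟩

theorem IsCoalg.of_injective {H : Ops R A} {H' : Ops R A'} {f : A →ₗ[R] A'}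
    (hf : IsOpsHom H H' f) (jf : Function.Injective f)
    (i3 : Function.Injective (TensorProduct.map f (TensorProduct.map f f)))
    (h : IsCoalg H') : IsCoalg H :=
  isCoalg_iff.2 ⟨fun a => jf (by rw [← hf.map_lid, h.counit_left]),
    .of_injective hf hf.self jf i3 (isCoalg_iff.1 h).2⟩

theorem IsBi.of_injective {H : Ops R A} {H' : Ops R A'} {f : A →ₗ[R] A'}
    (hf : IsOpsHom H H' f) (i2 : Function.Injective (TensorProduct.map f f))
    (h : IsBi H') : IsBi H where
  counit_one := by rw [← hf.map_counit, hf.map_one, h.counit_one]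
  counit_mul a b := by
    rw [← hf.map_counit, ← hf.map_counit, ← hf.map_counit, hf.map_mul, h.counit_mul]
  comul_one := i2 (by rw [← hf.map_comul, hf.map_one, h.comul_one, TensorProduct.map_tmul,
    hf.map_one])
  comul_mul a b := i2 (by
    rw [← hf.map_comul, hf.map_mul, h.comul_mul, hf.map_comul, hf.map_comul]
    exact (map₂_map_map _ _ _ _ _ _ _ _ _ _ hf.map_mul hf.map_mul _ _).symm)

theorem IsConn.of_surjective {g : ℕ → Submodule R A} {g' : ℕ → Submodule R A'} {H : Ops R A}
    {H' : Ops R A'} {f : A →ₗ[R] A'} (hf : IsOpsHom H H' f) (hg : ∀ n, ∀ a ∈ g n, f a ∈ g' n)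
    (sg : ∀ n, ∀ b ∈ g' n, ∃ a ∈ g n, f a = b) (decomp : DirectSum.IsInternal g')
    (h : IsConn g H) : IsConn g' H' where
  decomp := decomp
  one_mem := by rw [← hf.map_one]; exact hg 0 _ h.one_mem
  mul_mem m n a ha b hb := by
    obtain ⟨a, h_a, rfl⟩ := sg m a ha
    obtain ⟨b, h_b, rfl⟩ := sg n b hb
    rw [← hf.map_mul]
    exact hg _ _ (h.mul_mem m n a h_a b h_b)
  comul_mem n a ha := by
    obtain ⟨a, h_a, rfl⟩ := sg n a ha
    rw [hf.map_comul]
    exact map_tensorDeg_le hg hg n (Submodule.mem_map_of_mem (h.comul_mem n a h_a))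
  counit_eq_zero n hn a ha := by
    obtain ⟨a, h_a, rfl⟩ := sg n a ha
    rw [hf.map_counit, h.counit_eq_zero n hn a h_a]
  conn a ha := by
    obtain ⟨a, h_a, rfl⟩ := sg 0 a ha
    rw [hf.map_counit, ← hf.map_one, ← map_smul, ← h.conn a h_a]

theorem IsModGr.of_surjective {gM : ℕ → Submodule R M} {gM' : ℕ → Submodule R M'}
    {gA : ℕ → Submodule R A} {gA' : ℕ → Submodule R A'} {f : A →ₗ[R] A'} {T : Act R M A}
    {T' : Act R M' A'} {φ : M →ₗ[R] M'} (h : IsActHom T T' f φ)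
    (hg : ∀ n, ∀ a ∈ gA n, f a ∈ gA' n) (sg : ∀ n, ∀ b ∈ gA' n, ∃ a ∈ gA n, f a = b)
    (hgM : ∀ n, ∀ a ∈ gM n, φ a ∈ gM' n) (sgM : ∀ n, ∀ b ∈ gM' n, ∃ a ∈ gM n, φ a = b)
    (decomp : DirectSum.IsInternal gM') (hT : IsModGr gM gA T) : IsModGr gM' gA' T' where
  decomp := decomp
  act_mem m n a ha b hb := by
    obtain ⟨a, h_a, rfl⟩ := sgM m a ha
    obtain ⟨b, h_b, rfl⟩ := sg n b hb
    rw [← h.map_act]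
    exact hgM _ _ (hT.act_mem m n a h_a b h_b)
  coact_mem n a ha := by
    obtain ⟨a, h_a, rfl⟩ := sgM n a ha
    rw [h.map_coact]
    exact map_tensorDeg_le hgM hg n (Submodule.mem_map_of_mem (hT.coact_mem n a h_a))

/-! ### Duality -/

theorem pairT_tmul (p : M →ₗ[R] N →ₗ[R] R) (q : A →ₗ[R] B →ₗ[R] R) (x : M) (a : A) (y : N)
    (b : B) : pairT p q (x ⊗ₜ a) (y ⊗ₜ b) = p x y * q a b := by simp [pairT]

theorem pairT_tmul_right (p : M →ₗ[R] N →ₗ[R] R) (q : A →ₗ[R] B →ₗ[R] R) (s : M ⊗[R] A) (y : N)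
    (b : B) : pairT p q s (y ⊗ₜ b) =
      TensorProduct.lid R R (TensorProduct.map (p.flip y) (q.flip b) s) := by
  induction s with
  | zero => simp [pairT]
  | tmul x a => simp [pairT]
  | add s t hs ht => simp only [pairT, map_add, LinearMap.add_apply] at hs ht ⊢; rw [hs, ht]

/-- Two pairings are compared after pulling them back to common modules. With identities among the
maps this contains the adjunction formulas for tensor products of transposed maps. -/
theorem pairT_map (p : M →ₗ[R] N →ₗ[R] R) (q : A →ₗ[R] B →ₗ[R] R) (p' : M' →ₗ[R] N' →ₗ[R] R)
    (q' : A' →ₗ[R] B' →ₗ[R] R) (φ : P →ₗ[R] M) (φ' : P →ₗ[R] M') (ψ : Q →ₗ[R] N)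
    (ψ' : Q →ₗ[R] N') (f : C →ₗ[R] A) (f' : C →ₗ[R] A') (g : D →ₗ[R] B) (g' : D →ₗ[R] B')
    (hp : ∀ x y, p (φ x) (ψ y) = p' (φ' x) (ψ' y)) (hq : ∀ x y, q (f x) (g y) = q' (f' x) (g' y))
    (s : P ⊗[R] C) (t : Q ⊗[R] D) :
    pairT p q (TensorProduct.map φ f s) (TensorProduct.map ψ g t) =
      pairT p' q' (TensorProduct.map φ' f' s) (TensorProduct.map ψ' g' t) := by
  induction s with
  | zero => simp [pairT]
  | tmul x y =>
    induction t with
    | zero => simp [pairT]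
    | tmul a b => simp [pairT, hp, hq]
    | add s t hs ht => simp only [pairT, map_add] at hs ht ⊢; rw [hs, ht]
  | add s t hs ht => simp only [pairT, map_add, LinearMap.add_apply] at hs ht ⊢; rw [hs, ht]

/-- A pairing of actions and coactions that is induced by another one. -/
theorem IsActDual.transfer {T : Act R M A} {T' : Act R M' A'} {p : M →ₗ[R] M' →ₗ[R] R}
    {q : A →ₗ[R] A' →ₗ[R] R} (h : IsActDual T T' p q)
    {S : Act R P C} {S' : Act R Q D} {U : Act R N B} {U' : Act R N' B'}
    {φ : P →ₗ[R] M} {f : C →ₗ[R] A} {ψ : Q →ₗ[R] M'} {g : D →ₗ[R] A'}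
    {φ' : P →ₗ[R] N} {f' : C →ₗ[R] B} {ψ' : Q →ₗ[R] N'} {g' : D →ₗ[R] B'}
    (h1 : IsActHom S T f φ) (h2 : IsActHom S' T' g ψ)
    (h3 : IsActHom S U f' φ') (h4 : IsActHom S' U' g' ψ')
    (s1 : Function.Surjective φ') (s2 : Function.Surjective f')
    (s3 : Function.Surjective ψ') (s4 : Function.Surjective g')
    {p' : N →ₗ[R] N' →ₗ[R] R} {q' : B →ₗ[R] B' →ₗ[R] R}
    (hp : ∀ x y, p' (φ' x) (ψ' y) = p (φ x) (ψ y))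
    (hq : ∀ x y, q' (f' x) (g' y) = q (f x) (g y)) : IsActDual U U' p' q' where
  act_coact x a y := by
    obtain ⟨x, rfl⟩ := s1 x
    obtain ⟨a, rfl⟩ := s2 a
    obtain ⟨y, rfl⟩ := s3 y
    rw [← h3.map_act, hp, h1.map_act, h.act_coact, h2.map_coact, h4.map_coact,
      ← TensorProduct.map_tmul, ← TensorProduct.map_tmul, pairT_map _ _ _ _ _ _ _ _ _ _ _ _ hp hq]
  coact_act x y a := by
    obtain ⟨x, rfl⟩ := s1 x
    obtain ⟨a, rfl⟩ := s4 a
    obtain ⟨y, rfl⟩ := s3 y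
    rw [← h4.map_act, hp, h2.map_act, h.coact_act, h1.map_coact, h3.map_coact,
      ← TensorProduct.map_tmul, ← TensorProduct.map_tmul, pairT_map _ _ _ _ _ _ _ _ _ _ _ _ hp hq]

theorem IsDual.transfer {T : Ops R A} {T' : Ops R A'} {q : A →ₗ[R] A' →ₗ[R] R} (h : IsDual T T' q)
    {S : Ops R C} {S' : Ops R D} {U : Ops R B} {U' : Ops R B'}
    {f : C →ₗ[R] A} {g : D →ₗ[R] A'} {f' : C →ₗ[R] B} {g' : D →ₗ[R] B'}
    (h1 : IsOpsHom S T f) (h2 : IsOpsHom S' T' g)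
    (h3 : IsOpsHom S U f') (h4 : IsOpsHom S' U' g')
    (s2 : Function.Surjective f') (s4 : Function.Surjective g')
    {q' : B →ₗ[R] B' →ₗ[R] R}
    (hq : ∀ x y, q' (f' x) (g' y) = q (f x) (g y)) : IsDual U U' q' where
  mul_comul := (h.self.transfer h1.self h2.self h3.self h4.self s2 s2 s4 s4 hq hq).act_coact
  comul_mul := (h.self.transfer h1.self h2.self h3.self h4.self s2 s2 s4 s4 hq hq).coact_act
  one_counit c := by
    obtain ⟨c, rfl⟩ := s4 c
    rw [← h3.map_one, hq, h1.map_one, h.one_counit, h2.map_counit, h4.map_counit]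
  counit_one c := by
    obtain ⟨c, rfl⟩ := s2 c
    rw [← h4.map_one, hq, h2.map_one, h.counit_one, h1.map_counit, h3.map_counit]

/-- The module axioms are the transposes of the comodule axioms, and two elements of `M'` that pair
equally with all of `M` coincide. -/
theorem IsActDual.isMod {H : Ops R A} {H' : Ops R A'} {T : Act R M A} {T' : Act R M' A'}
    {p : M →ₗ[R] M' →ₗ[R] R} {q : A →ₗ[R] A' →ₗ[R] R} (h : IsActDual T T' p q)
    (hq : IsDual H H' q) (sep : ∀ y, (∀ x, p x y = 0) → y = 0) (hT : IsComod H T) :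
    IsMod H' T' := by
  have sep' : ∀ y z, (∀ x, p x y = p x z) → y = z := fun y z hyz =>
    sub_eq_zero.1 (sep _ fun x => by rw [map_sub, hyz, sub_self])
  refine ⟨fun y => sep' _ _ fun x => ?_, fun y a b => sep' _ _ fun x => ?_⟩
  · rw [h.coact_act, pairT_tmul_right]
    conv_rhs => rw [← hT.coact_counit x]
    generalize T.coact x = t
    induction t with
    | zero => simp
    | tmul x a => simp [hq.counit_one, mul_comm]
    | add s t hs ht => simp only [map_add, LinearMap.add_apply, hs, ht]
  · rw [h.coact_act, h.coact_act, pairT_tmul_right, pairT_tmul_right]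
    -- `Φ` pairs a threefold tensor with y ⊗ (a ⊗ b). Both sides are its values at the two
    -- bracketings of the iterated coaction of x.
    let Φ : M ⊗[R] (A ⊗[R] A) →ₗ[R] R := (TensorProduct.lid R R).toLinearMap ∘ₗ
      TensorProduct.map (p.flip y)
        ((TensorProduct.lid R R).toLinearMap ∘ₗ TensorProduct.map (q.flip a) (q.flip b))
    trans Φ (TensorProduct.assoc R M A A (T.coact.rTensor A (T.coact x)))
    · generalize T.coact x = t
      induction t with
      | zero => simp
      | tmul x c =>
        simp only [TensorProduct.map_tmul, LinearMap.rTensor_tmul, LinearMap.flip_apply,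
          h.coact_act, pairT_tmul_right]
        generalize T.coact x = s
        induction s with
        | zero => simp
        | tmul x z => simp [Φ, mul_assoc]
        | add s t hs ht =>
          simp only [TensorProduct.add_tmul, map_add] at hs ht ⊢
          rw [← hs, ← ht]
      | add s t hs ht => simp only [map_add, hs, ht]
    · rw [hT.coact_coact]
      generalize T.coact x = t
      induction t with
      | zero => simp
      | tmul x c => simp [Φ, hq.comul_mul, pairT_tmul_right]
      | add s t hs ht => simp only [map_add, hs, ht]

theorem IsDual.isAlg {H : Ops R A} {H' : Ops R A'} {q : A →ₗ[R] A' →ₗ[R] R} (h : IsDual H H' q)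
    (sep : ∀ y, (∀ x, q x y = 0) → y = 0) (hH : IsCoalg H) : IsAlg H' := by
  refine isAlg_iff.2 ⟨fun y => sub_eq_zero.1 (sep _ fun x => ?_),
    h.self.isMod h sep (isCoalg_iff.1 hH).2⟩
  rw [map_sub, sub_eq_zero, h.comul_mul, pairT_tmul_right]
  conv_rhs => rw [← hH.counit_left x]
  generalize H.comul x = t
  induction t with
  | zero => simp
  | tmul x a => simp [h.counit_one]
  | add s t hs ht => simp only [map_add, LinearMap.add_apply, hs, ht]

/-! ### Sub- and quotient structures -/

theorem exists_lift_of_injective {ψ : M →ₗ[R] M'} (hψ : Function.Injective ψ) (F : P →ₗ[R] M')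
    (hF : ∀ x, F x ∈ LinearMap.range ψ) : ∃ G : P →ₗ[R] M, ∀ x, ψ (G x) = F x := by
  refine ⟨(LinearEquiv.ofInjective ψ hψ).symm.toLinearMap ∘ₗ F.codRestrict _ hF, fun x => ?_⟩
  exact congrArg Subtype.val
    ((LinearEquiv.ofInjective ψ hψ).apply_symm_apply (F.codRestrict _ hF x))

theorem exists_factor_of_surjective {φ : M →ₗ[R] M'} (hφ : Function.Surjective φ)
    (F : M →ₗ[R] P) (hF : ∀ x, φ x = 0 → F x = 0) : ∃ G : M' →ₗ[R] P, ∀ x, G (φ x) = F x := by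
  refine ⟨(LinearMap.ker φ).liftQ F (fun x hx => hF x hx) ∘ₗ
    (φ.quotKerEquivOfSurjective hφ).symm.toLinearMap, fun x => ?_⟩
  have : (φ.quotKerEquivOfSurjective hφ).symm (φ x) = Submodule.Quotient.mk x := by
    rw [LinearEquiv.symm_apply_eq]; rfl
  rw [LinearMap.comp_apply, LinearEquiv.coe_coe, this]
  exact Submodule.liftQ_apply _ _ _

theorem exists_sub_act {T' : Act R M' A'} {f : A →ₗ[R] A'} {ψ : M →ₗ[R] M'}
    (hψ : Function.Injective ψ) (hψf : Function.Injective (TensorProduct.map ψ f))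
    (hact : ∀ x a, T'.act (ψ x) (f a) ∈ LinearMap.range ψ)
    (hcoact : ∀ x, T'.coact (ψ x) ∈ LinearMap.range (TensorProduct.map ψ f)) :
    ∃ T : Act R M A, IsActHom T T' f ψ := by
  obtain ⟨G, hG⟩ := exists_lift_of_injective hψ
    (TensorProduct.lift (T'.act.compl₁₂ ψ f)) (fun t => by
      induction t with
      | zero => simp
      | tmul x a => simpa using hact x a
      | add s t hs ht => rw [map_add]; exact add_mem hs ht)
  obtain ⟨K, hK⟩ := exists_lift_of_injective hψf (T'.coact ∘ₗ ψ) hcoact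
  exact ⟨⟨TensorProduct.curry G, K⟩, fun x a => by simp [hG], fun x => (hK x).symm⟩

theorem exists_quot_act {T : Act R M A} {f : A →ₗ[R] A'} {φ : M →ₗ[R] M'}
    (sφ : Function.Surjective φ) (sf : Function.Surjective f)
    (hact : ∀ x a, φ x = 0 → φ (T.act x a) = 0) (hact' : ∀ x a, f a = 0 → φ (T.act x a) = 0)
    (hcoact : ∀ x, φ x = 0 → TensorProduct.map φ f (T.coact x) = 0) :
    ∃ T' : Act R M' A', IsActHom T T' f φ := by
  obtain ⟨G, hG⟩ := exists_factor_of_surjective sφ (T.act.compr₂ φ)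
    (fun x hx => by ext a; simp [hact x a hx])
  obtain ⟨G', hG'⟩ := exists_factor_of_surjective sf G.flip
    (fun a ha => by
      ext y
      obtain ⟨x, rfl⟩ := sφ y
      rw [LinearMap.flip_apply, hG]
      simp [hact' x a ha])
  obtain ⟨K, hK⟩ := exists_factor_of_surjective sφ (TensorProduct.map φ f ∘ₗ T.coact) hcoact
  exact ⟨⟨G'.flip, K⟩, fun x a => by simp [hG', hG], fun x => hK x⟩

end Transfer

/-! ### Tensor products of torsion-free modules over a principal ideal domain -/

section TorsionFree

variable {R : Type} [CommRing R] [IsDomain R] [IsPrincipalIdealRing R]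
variable {M N A B : Type} [AddCommGroup M] [AddCommGroup N] [AddCommGroup A] [AddCommGroup B]
  [Module R M] [Module R N] [Module R A] [Module R B]

/-- Flatness is what keeps the embeddings of Σ and Λ injective after tensoring, so that coproducts
can be restricted and their axioms checked in the larger module. -/
theorem flat_of_isTorsionFree [Module.IsTorsionFree R M] : Module.Flat R M := by
  rw [Module.Flat.flat_iff_torsion_eq_bot_of_isBezout]
  exact Submodule.isTorsionFree_iff_torsion_eq_bot.1 inferInstance

/-- If two pairings are separating on the left, then so is their tensor product. -/
theorem pairT_separating [Module.IsTorsionFree R M] [Module.IsTorsionFree R A]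
    (p : M →ₗ[R] N →ₗ[R] R) (q : A →ₗ[R] B →ₗ[R] R) (hp : ∀ x, (∀ y, p x y = 0) → x = 0)
    (hq : ∀ a, (∀ b, q a b = 0) → a = 0) (t : M ⊗[R] A)
    (ht : ∀ y b, pairT p q t (y ⊗ₜ b) = 0) : t = 0 := by
  -- `t` comes from a tensor product of finitely generated submodules. The left one is torsion-free
  -- over a principal ideal domain, hence free, and `t` has unique coordinates with respect to a
  -- basis `e` of it.
  obtain ⟨M', A', _, _, hM⟩ :=
    TensorProduct.exists_finite_submodule_of_setFinite {t} (Set.finite_singleton t)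
  obtain ⟨s, rfl⟩ := hM (Set.mem_singleton t)
  suffices s = 0 by simp [this]
  let e := Module.Free.chooseBasis R M'
  have := Module.Free.of_basis e
  apply (TensorProduct.equivFinsuppOfBasisLeft (N := A') e).injective
  rw [map_zero]
  have hs := (TensorProduct.equivFinsuppOfBasisLeft (N := A') e).symm_apply_apply s
  generalize TensorProduct.equivFinsuppOfBasisLeft (N := A') e s = c at hs
  rw [TensorProduct.equivFinsuppOfBasisLeft_symm_apply] at hs
  subst hs
  ext i : 2
  apply hq
  intro b
  -- Writing t = ∑ e i ⊗ c i, pairing only the second factor with b gives an element of `M'` on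
  -- which all y vanish. Independence of `e` then kills each q(c i, b).
  have key : ∑ i ∈ c.support, q (c i) b • e i = 0 := by
    apply Subtype.ext
    apply hp
    intro y
    have := ht y b
    rw [pairT_tmul_right] at this
    simpa [Finsupp.sum, TensorProduct.mapIncl, mul_comm] using this
  by_cases hi : i ∈ c.support
  · exact linearIndependent_iff'.1 e.linearIndependent _ _ key i hi
  · simp [Finsupp.notMem_support_iff.1 hi]

end TorsionFree

/-! ## Comparison with the structures over `ℤ` -/

section Bridge

variable {M M' A A' : Type} [AddCommGroup M] [AddCommGroup M'] [AddCommGroup A] [AddCommGroup A']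

def HopfOps.gen (H : HopfOps A) : Ops ℤ A := ⟨H.mul, H.one, H.comul, H.counit⟩

def Ops.toHopf (H : Ops ℤ A) : HopfOps A := ⟨H.mul, H.one, H.comul, H.counit⟩

def ActOps.gen (T : ActOps M A) : Act ℤ M A := ⟨T.act, T.coact⟩

def Act.toActOps (T : Act ℤ M A) : ActOps M A := ⟨T.act, T.coact⟩

theorem isGradedHopf_of {g : ℕ → Submodule ℤ A} {H : HopfOps A} (hg : IsConn g H.gen)
    (ha : IsAlg H.gen) (hc : IsCoalg H.gen) (hb : IsBi H.gen) : IsGradedHopf g H where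
  decomp := hg.decomp
  one_mem := hg.one_mem
  mul_mem := hg.mul_mem
  comul_mem := hg.comul_mem
  counit_eq_zero := hg.counit_eq_zero
  one_mul := ha.one_mul
  mul_one := ha.mul_one
  mul_assoc := ha.mul_assoc
  counit_left := hc.counit_left
  counit_right := hc.counit_right
  coassoc := hc.coassoc
  counit_one := hb.counit_one
  counit_mul := hb.counit_mul
  comul_one := hb.comul_one
  comul_mul := hb.comul_mul
  antipode := hg.exists_antipode ha hc

theorem isGradedModComod_of {gM : ℕ → Submodule ℤ M} {gA : ℕ → Submodule ℤ A} {H : HopfOps A}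
    {T : ActOps M A} (hg : IsModGr gM gA T.gen) (h : IsMod H.gen T.gen)
    (h' : IsComod H.gen T.gen) : IsGradedModComod gM gA H T where
  decomp := hg.decomp
  act_mem := hg.act_mem
  act_one := h.act_one
  act_act := h.act_act
  coact_mem := hg.coact_mem
  coact_counit := h'.coact_counit
  coact_coact := h'.coact_coact

theorem isHopfHom_iff {g : ℕ → Submodule ℤ A} {g' : ℕ → Submodule ℤ A'} {H : HopfOps A}
    {H' : HopfOps A'} {f : A →ₗ[ℤ] A'} :
    IsHopfHom g g' H H' f ↔ (∀ n, ∀ a ∈ g n, f a ∈ g' n) ∧ IsOpsHom H.gen H'.gen f :=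
  ⟨fun h => ⟨h.map_mem, h.map_one, h.map_mul, h.map_counit, h.map_comul⟩,
    fun h => ⟨h.1, h.2.map_one, h.2.map_mul, h.2.map_counit, h.2.map_comul⟩⟩

theorem isModComodHom_iff {gM : ℕ → Submodule ℤ M} {gM' : ℕ → Submodule ℤ M'} {T : ActOps M A}
    {T' : ActOps M' A'} {f : A →ₗ[ℤ] A'} {φ : M →ₗ[ℤ] M'} :
    IsModComodHom gM gM' T T' f φ ↔
      (∀ n, ∀ a ∈ gM n, φ a ∈ gM' n) ∧ IsActHom T.gen T'.gen f φ :=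
  ⟨fun h => ⟨h.map_mem, h.map_act, h.map_coact⟩, fun h => ⟨h.1, h.2.map_act, h.2.map_coact⟩⟩

theorem isHopfDual_iff {H : HopfOps A} {H' : HopfOps A'} {q : A →ₗ[ℤ] A' →ₗ[ℤ] ℤ} :
    IsHopfDual H H' q ↔ IsDual H.gen H'.gen q :=
  ⟨fun h => ⟨h.mul_comul, h.comul_mul, h.one_counit, h.counit_one⟩,
    fun h => ⟨h.mul_comul, h.comul_mul, h.one_counit, h.counit_one⟩⟩

theorem isModComodDual_iff {T : ActOps M A} {T' : ActOps M' A'} {p : M →ₗ[ℤ] M' →ₗ[ℤ] ℤ}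
    {q : A →ₗ[ℤ] A' →ₗ[ℤ] ℤ} : IsModComodDual T T' p q ↔ IsActDual T.gen T'.gen p q :=
  ⟨fun h => ⟨h.act_coact, h.coact_act⟩, fun h => ⟨h.act_coact, h.coact_act⟩⟩

end Bridge

/-! ## Graded submodules and graded duals -/

section GradedDual

variable {M : Type} [AddCommGroup M]

/-- Independence passes to smaller submodules, so the span of homogeneous pieces is graded by these
pieces. This is used for Σ inside ℤW and for Λ inside Σ^*. -/
theorem isInternal_comap_iSup {g h : ℕ → Submodule ℤ M} (hg : DirectSum.IsInternal g)
    (hh : ∀ n, h n ≤ g n) {P : Submodule ℤ M} (hP : P = ⨆ n, h n) :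
    DirectSum.IsInternal fun n => (h n).comap P.subtype := by
  have hle : ∀ n, h n ≤ P := fun n => hP ▸ le_iSup h n
  rw [DirectSum.isInternal_submodule_iff_iSupIndep_and_iSup_eq_top] at hg ⊢
  constructor
  · have h1 : iSupIndep h := hg.1.mono hh
    refine iSupIndep_of_dfinsupp_lsum_injective _ ?_
    have h2 := h1.dfinsupp_lsum_injective
    intro x y hxy
    let e : ∀ n, (h n).comap P.subtype →ₗ[ℤ] h n := fun n =>
      (Submodule.comapSubtypeEquivOfLe (hle n)).toLinearMap
    have key : ∀ x : Π₀ n, (h n).comap P.subtype,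
        DFinsupp.lsum ℕ (fun n => (h n).subtype) (DFinsupp.mapRange.linearMap e x) =
          P.subtype (DFinsupp.lsum ℕ (fun n => ((h n).comap P.subtype).subtype) x) := by
      intro x
      induction x using DFinsupp.induction with
      | h0 => simp
      | ha i b f _ _ ih =>
        rw [map_add, map_add, map_add, map_add, ih]
        simp [e]
    have h3 := h2 ((key x).trans ((congrArg _ hxy).trans (key y).symm))
    ext n
    have := congrArg (fun z => ((z n : h n) : M)) h3
    simpa [e] using this
  · rw [eq_top_iff]
    rintro ⟨x, hx⟩ -
    have : P.map (LinearMap.id) ≤ (⨆ n, (h n).comap P.subtype).map P.subtype := by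
      rw [Submodule.map_id, hP]
      refine iSup_le fun n x hx => ?_
      exact ⟨⟨x, le_iSup h n hx⟩, Submodule.mem_iSup_of_mem n hx, rfl⟩
    rw [Submodule.map_id] at this
    obtain ⟨y, hy, hyx⟩ := this hx
    have : y = ⟨x, hx⟩ := Subtype.ext hyx
    exact this ▸ hy

/-- A form that vanishes in degrees from N on is the sum of its N homogeneous truncations, each
extended by zero to the other degrees. -/
theorem isInternal_gradedDualGrade {g : ℕ → Submodule ℤ M} (hg : DirectSum.IsInternal g) :
    DirectSum.IsInternal (gradedDualGrade g) := by
  rw [DirectSum.isInternal_submodule_iff_iSupIndep_and_iSup_eq_top]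
  have htop := internal_iSup hg
  constructor
  · rw [iSupIndep_def]
    intro n
    rw [Submodule.disjoint_def]
    intro f hf hf'
    have h1 : ∀ x ∈ g n, f.1 x = 0 := by
      intro x hx
      let Q : Submodule ℤ (gradedDual g) :=
        LinearMap.ker ((gradedDual g).subtype.flip x)
      have : (⨆ (m) (_ : m ≠ n), gradedDualGrade g m) ≤ Q :=
        iSup_le fun m => iSup_le fun hm f hf => hf n hm.symm x hx
      exact this hf'
    refine Subtype.ext (internal_ext htop fun m x hx => ?_)
    by_cases hm : m = n
    · subst hm; exact h1 x hx
    · exact hf m hm x hx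
  · rw [eq_top_iff]
    rintro ⟨f, N, hN⟩ -
    have : ∀ n, ∃ F : M →ₗ[ℤ] ℤ, ∀ m (a : g m), F a = if m = n then f a else 0 := by
      intro n
      obtain ⟨F, hF⟩ := exists_of_internal hg
        (fun m => if m = n then f.comp (g m).subtype else 0)
      refine ⟨F, fun m a => ?_⟩
      rw [hF]
      split_ifs <;> rfl
    choose F hF using this
    have hmem : ∀ n, F n ∈ gradedDual g := fun n => ⟨n + 1, fun m hm x hx => by
      rw [hF n m ⟨x, hx⟩, if_neg (by omega)]⟩
    have hsum : (⟨f, N, hN⟩ : gradedDual g) = ∑ n ∈ Finset.range N, ⟨F n, hmem n⟩ := by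
      apply Subtype.ext
      refine internal_ext htop fun m x hx => ?_
      rw [AddSubmonoidClass.coe_finsetSum, LinearMap.sum_apply]
      have : ∀ n, F n x = if m = n then f x else 0 := fun n => hF n m ⟨x, hx⟩
      simp only [this]
      rw [Finset.sum_ite_eq]
      split_ifs with h
      · rfl
      · exact hN m (by simpa using h) x hx
    rw [hsum]
    refine sum_mem fun n _ => Submodule.mem_iSup_of_mem n fun m hm x hx => ?_
    exact (hF n m ⟨x, hx⟩).trans (if_neg hm)

/-- Restriction identifies the degree n part of the graded dual with the full dual of `g n`.
Freeness and finiteness make `g n` reflexive, so that perfectness on one side suffices. -/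
theorem isGradedPerfect_gradedDual {g : ℕ → Submodule ℤ M} (hg : DirectSum.IsInternal g)
    (hfree : ∀ n, Module.Free ℤ (g n)) (hfin : ∀ n, Module.Finite ℤ (g n)) :
    IsGradedPerfect g (gradedDualGrade g) (gradedDual g).subtype.flip where
  orthogonal m n hmn x hx y hy := hy m hmn x hx
  perfect n := by
    have := hfree n
    have := hfin n
    refine LinearMap.IsPerfPair.flip
      (p := (gradedDual g).subtype.domRestrict₁₂ (gradedDualGrade g n) (g n))
      (LinearMap.IsPerfPair.of_bijective _ ⟨?_, ?_⟩)
    · rw [injective_iff_map_eq_zero]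
      intro f hf
      refine Subtype.ext (Subtype.ext (internal_ext (internal_iSup hg) fun m x hx => ?_))
      by_cases hm : m = n
      · subst hm
        exact LinearMap.congr_fun hf ⟨x, hx⟩
      · exact f.2 m hm x hx
    · intro φ
      obtain ⟨F, hF⟩ := exists_of_internal hg
        (fun m => if h : m = n then φ.comp (Submodule.inclusion (by rw [h])) else 0)
      refine ⟨⟨⟨F, n + 1, fun m hm x hx => ?_⟩, fun m hm x hx => ?_⟩, ?_⟩
      · rw [hF m ⟨x, hx⟩, dif_neg (by omega)]; rfl
      · exact (hF m ⟨x, hx⟩).trans (by rw [dif_neg hm]; rfl)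
      · ext x
        exact (hF n x).trans (by rw [dif_pos rfl]; rfl)

end GradedDual

/-! ## Free modules -/

section Free

variable {W : ℕ → Type}

theorem bas_apply [DecidableEq (Σ n, W n)] (u v : Σ n, W n) :
    bas u v = if u = v then 1 else 0 := by simp [bas, Finsupp.single_apply]

theorem freeZ_eq_sum (x : FreeZ W) : x = ∑ u ∈ x.support, x u • bas u := by
  conv_lhs => rw [← Finsupp.sum_single x]
  simp [Finsupp.sum, bas]

/-- Induction on elements of a free module. -/
@[elab_as_elim]
theorem freeZ_induction {P : FreeZ W → Prop} (x : FreeZ W) (h0 : P 0) (hb : ∀ u, P (bas u))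
    (hadd : ∀ x y, P x → P y → P (x + y)) (hneg : ∀ x, P x → P (-x)) : P x := by
  have hz : ∀ (c : ℤ) x, P x → P (c • x) := by
    intro c x hx
    induction c with
    | zero => simpa
    | succ n ih => rw [add_smul, one_smul]; exact hadd _ _ ih hx
    | pred n ih => rw [sub_smul, one_smul, sub_eq_add_neg]; exact hadd _ _ ih (hneg _ hx)
  rw [freeZ_eq_sum x]
  exact Finset.sum_induction _ P hadd h0 fun u _ => hz _ _ (hb u)

theorem mem_freeGrade {n : ℕ} {x : FreeZ W} :
    x ∈ freeGrade W n ↔ ∀ u, u.1 ≠ n → x u = 0 := by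
  classical
  constructor
  · intro h u hu
    let Q : Submodule ℤ (FreeZ W) := LinearMap.ker (Finsupp.lapply (R := ℤ) u)
    have : freeGrade W n ≤ Q := by
      refine Submodule.span_le.2 ?_
      rintro _ ⟨w, rfl⟩
      have : (⟨n, w⟩ : Σ n, W n) ≠ u := fun h => hu (by rw [← h])
      change bas _ u = 0
      rw [bas_apply, if_neg this]
    exact this h
  · intro h
    rw [freeZ_eq_sum x]
    refine sum_mem fun u _ => ?_
    by_cases hu : u.1 = n
    · subst hu
      exact Submodule.smul_mem _ _ (Submodule.subset_span ⟨u.2, rfl⟩)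
    · rw [h u hu, zero_smul]; exact zero_mem _

theorem bas_mem_freeGrade (u : Σ n, W n) : bas u ∈ freeGrade W u.1 :=
  Submodule.subset_span ⟨u.2, rfl⟩

theorem isInternal_freeGrade : DirectSum.IsInternal (freeGrade W) := by
  rw [DirectSum.isInternal_submodule_iff_iSupIndep_and_iSup_eq_top]
  constructor
  · rw [iSupIndep_def]
    intro n
    rw [Submodule.disjoint_def]
    intro x hx hx'
    ext u
    by_cases hu : u.1 = n
    · let Q : Submodule ℤ (FreeZ W) := LinearMap.ker (Finsupp.lapply (R := ℤ) u)
      have : (⨆ (m) (_ : m ≠ n), freeGrade W m) ≤ Q :=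
        iSup_le fun m => iSup_le fun hm x hx => mem_freeGrade.1 hx u (by rw [hu]; exact hm.symm)
      exact this hx'
    · exact mem_freeGrade.1 hx u hu
  · rw [eq_top_iff]
    rintro x -
    rw [freeZ_eq_sum x]
    exact sum_mem fun u _ => Submodule.smul_mem _ _
      (Submodule.mem_iSup_of_mem u.1 (bas_mem_freeGrade u))

theorem bilin_bas {α β N : Type} [AddCommGroup N] (f : α → β → N) (u : α) (v : β) :
    bilin f (Finsupp.single u 1) (Finsupp.single v 1) = f u v := by
  simp [bilin]

theorem delta_bas_left (u : Σ n, W n) (y : FreeZ W) : delta W (bas u) y = y u := by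
  classical
  refine freeZ_induction y ?_ (fun v => ?_) (fun x y hx hy => ?_) (fun x hx => ?_)
  · rw [map_zero]; rfl
  · rw [bas_apply, delta, bas, bas, bilin_bas]
    simp only [eq_comm]
  · rw [map_add, hx, hy]; rfl
  · rw [map_neg, hx]; rfl

theorem delta_symm (x y : FreeZ W) : delta W x y = delta W y x := by
  classical
  refine freeZ_induction x ?_ (fun u => ?_) (fun x z hx hy => ?_) (fun x hx => ?_)
  · simp only [map_zero, LinearMap.zero_apply]
  · refine freeZ_induction y ?_ (fun v => ?_) (fun x z hx hy => ?_) (fun x hx => ?_)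
    · simp only [map_zero, LinearMap.zero_apply]
    · rw [delta_bas_left, delta_bas_left, bas_apply, bas_apply]
      simp only [eq_comm]
    · rw [map_add, map_add, hx, hy]; rfl
    · rw [map_neg, map_neg, hx]; rfl
  · rw [map_add, map_add, LinearMap.add_apply, hx, hy]
  · rw [map_neg, map_neg, LinearMap.neg_apply, hx]

theorem delta_bas_right (x : FreeZ W) (v : Σ n, W n) : delta W x (bas v) = x v := by
  rw [delta_symm, delta_bas_left]

theorem delta_separating (y : FreeZ W) (h : ∀ x, delta W x y = 0) : y = 0 := by
  ext u
  rw [← delta_bas_left, h]; rfl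

/-- The twist by `σ` treats δ and ⟨u,v⟩' together: `σ` is the identity for the first and inversion
for the second. -/
theorem isGradedPerfect_delta_comp [∀ n, Fintype (W n)] (σ : FreeZ W ≃ₗ[ℤ] FreeZ W)
    (hσ : ∀ n x, σ x ∈ freeGrade W n ↔ x ∈ freeGrade W n) :
    IsGradedPerfect (freeGrade W) (freeGrade W) ((delta W).comp σ.toLinearMap) where
  orthogonal m n hmn x hx y hy := by
    have hx : σ x ∈ freeGrade W m := (hσ m x).2 hx
    change delta W (σ x) y = 0
    rw [freeZ_eq_sum y, map_sum]
    refine Finset.sum_eq_zero fun u _ => ?_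
    rw [map_smul, delta_bas_right]
    by_cases hu : u.1 = n
    · rw [mem_freeGrade.1 hx u (by rw [hu]; exact hmn.symm), smul_zero]
    · rw [mem_freeGrade.1 hy u hu, zero_smul]
  perfect n := by
    have : Module.Finite ℤ (freeGrade W n) :=
      Module.Finite.iff_fg.2 (Submodule.fg_span (Set.finite_range _))
    refine LinearMap.IsPerfPair.of_bijective _ ⟨?_, ?_⟩
    · rw [injective_iff_map_eq_zero]
      intro x hx
      apply Subtype.ext
      apply σ.injective
      rw [ZeroMemClass.coe_zero, map_zero]
      ext u
      by_cases hu : u.1 = n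
      · have := LinearMap.congr_fun hx ⟨bas u, hu ▸ bas_mem_freeGrade u⟩
        rw [← delta_bas_right]
        exact this
      · exact mem_freeGrade.1 ((hσ n _).2 x.2) u hu
    · intro φ
      -- The element whose coefficients are the values of `φ` on the basis; it represents `φ` for δ,
      -- and its preimage under `σ` does so for the twisted pairing.
      let y : FreeZ W := ∑ w : W n, φ ⟨bas ⟨n, w⟩, bas_mem_freeGrade ⟨n, w⟩⟩ • bas ⟨n, w⟩
      have hy : y ∈ freeGrade W n := sum_mem fun w _ =>
        Submodule.smul_mem _ _ (bas_mem_freeGrade ⟨n, w⟩)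
      refine ⟨⟨σ.symm y, (hσ n _).1 (by rwa [LinearEquiv.apply_symm_apply])⟩, ?_⟩
      have key : ∀ w : W n, delta W y (bas ⟨n, w⟩) =
          φ ⟨bas ⟨n, w⟩, bas_mem_freeGrade ⟨n, w⟩⟩ := by
        classical
        intro w
        rw [delta_bas_right]
        simp only [y, Finsupp.coe_finsetSum, Finset.sum_apply, Finsupp.smul_apply, bas_apply]
        rw [Finset.sum_eq_single w]
        · simp
        · intro v _ hv
          simp [hv]
        · simp
      ext ⟨x, hx⟩
      change delta W (σ (σ.symm y)) x = φ ⟨x, hx⟩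
      rw [LinearEquiv.apply_symm_apply]
      induction hx using Submodule.span_induction with
      | mem x h => obtain ⟨w, rfl⟩ := h; exact key w
      | zero => rw [map_zero]; exact (map_zero φ).symm
      | add x z hx hz h h' => rw [map_add, h, h', ← map_add]; rfl
      | smul c x hx h => rw [map_smul, h, ← map_smul]; rfl

theorem isGradedPerfect_delta [∀ n, Fintype (W n)] :
    IsGradedPerfect (freeGrade W) (freeGrade W) (delta W) :=
  isGradedPerfect_delta_comp (LinearEquiv.refl ℤ _) (fun _ _ => Iff.rfl)

/-! ### Inversion and the twisted pairing -/

section Inv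

variable [∀ n, Group (W n)]

/-- Inversion on `⊔ W_n`. -/
def invS (u : Σ n, W n) : Σ n, W n := ⟨u.1, u.2⁻¹⟩

@[simp] theorem invS_invS (u : Σ n, W n) : invS (invS u) = u :=
  Sigma.ext rfl (heq_of_eq (inv_inv _))

@[simp] theorem invMap_bas (u : Σ n, W n) : invMap W (bas u) = bas (invS u) := by
  simp [invMap, bas]; rfl

theorem invMap_apply (x : FreeZ W) (u : Σ n, W n) : invMap W x u = x (invS u) := by
  simp [invMap, Finsupp.domLCongr_apply, Finsupp.domCongr_apply]
  rfl

theorem invMap_mem (n : ℕ) (x : FreeZ W) :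
    invMap W x ∈ freeGrade W n ↔ x ∈ freeGrade W n := by
  rw [mem_freeGrade, mem_freeGrade]
  constructor
  · intro h u hu
    have := h (invS u) hu
    rwa [invMap_apply, invS_invS] at this
  · intro h u hu
    rw [invMap_apply]
    exact h _ hu

theorem invMap_symm : (invMap W).symm = invMap W := by
  ext x u
  have : x = invMap W (invMap W x) := by ext v; simp [invMap_apply]
  conv_lhs => rw [this, LinearEquiv.symm_apply_apply]

theorem deltaInv_symm (x y : FreeZ W) : deltaInv W x y = deltaInv W y x := by
  change delta W (invMap W x) y = delta W (invMap W y) x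
  refine freeZ_induction x ?_ (fun u => ?_) (fun x z hx hy => ?_) (fun x hx => ?_)
  · simp only [map_zero, LinearMap.zero_apply]
  · rw [invMap_bas, delta_bas_left, delta_bas_right, invMap_apply]
  · rw [map_add, map_add, LinearMap.add_apply, hx, hy, map_add]
  · rw [map_neg, map_neg, LinearMap.neg_apply, hx, map_neg]

theorem isGradedPerfect_deltaInv [∀ n, Fintype (W n)] :
    IsGradedPerfect (freeGrade W) (freeGrade W) (deltaInv W) :=
  isGradedPerfect_delta_comp (invMap W) invMap_mem

end Inv

end Free

/-! ## Standardization of words with distinct letters -/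

section Rank

/-- The number of elements of `L` that are at most `x`. -/
def rank (L : Finset ℤ) (x : ℤ) : ℤ := ((L.filter (· ≤ x)).card : ℤ)

theorem rank_lt {L : Finset ℤ} {x y : ℤ} (hy : y ∈ L) (h : x < y) : rank L x < rank L y := by
  unfold rank
  norm_cast
  apply Finset.card_lt_card
  rw [Finset.ssubset_iff_of_subset]
  · exact ⟨y, by simp [hy], by simp [h]⟩
  · intro z hz
    simp only [Finset.mem_filter] at hz ⊢
    exact ⟨hz.1, by omega⟩

theorem rank_lt_iff {L : Finset ℤ} {x y : ℤ} (hx : x ∈ L) (hy : y ∈ L) :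
    rank L x < rank L y ↔ x < y := by
  refine ⟨fun h => ?_, rank_lt hy⟩
  by_contra hxy
  rcases eq_or_lt_of_le (not_lt.1 hxy) with rfl | h'
  · exact lt_irrefl _ h
  · exact lt_asymm h (rank_lt hx h')

theorem rank_injOn {L : Finset ℤ} {x y : ℤ} (hx : x ∈ L) (hy : y ∈ L) (h : rank L x = rank L y) :
    x = y := by
  rcases lt_trichotomy x y with h' | h' | h'
  · exact absurd h (rank_lt hy h').ne
  · exact h'
  · exact absurd h (rank_lt hx h').ne'

theorem rank_pos {L : Finset ℤ} {x : ℤ} (hx : x ∈ L) : 0 < rank L x := by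
  unfold rank
  norm_cast
  exact Finset.card_pos.2 ⟨x, by simp [hx]⟩

theorem rank_le (L : Finset ℤ) (x : ℤ) : rank L x ≤ L.card := by
  unfold rank
  exact_mod_cast Finset.card_filter_le _ _

theorem rank_image {L : Finset ℤ} {f : ℤ → ℤ} (hf : StrictMonoOn f L) {x : ℤ} (hx : x ∈ L) :
    rank (L.image f) (f x) = rank L x := by
  unfold rank
  norm_cast
  have : (L.image f).filter (· ≤ f x) = (L.filter (· ≤ x)).image f := by
    ext z
    simp only [Finset.mem_filter, Finset.mem_image]
    constructor
    · rintro ⟨⟨y, hy, rfl⟩, h⟩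
      exact ⟨y, ⟨hy, (hf.le_iff_le hy hx).1 h⟩, rfl⟩
    · rintro ⟨y, ⟨hy, h⟩, rfl⟩
      exact ⟨⟨y, hy, rfl⟩, (hf.le_iff_le hy hx).2 h⟩
  rw [this, Finset.card_image_of_injOn]
  exact hf.injOn.mono fun y hy => Finset.mem_of_mem_filter y hy

theorem rank_Icc {n : ℕ} {x : ℤ} (hx : x ∈ Finset.Icc (1 : ℤ) n) :
    rank (Finset.Icc (1 : ℤ) n) x = x := by
  have h := Finset.mem_Icc.1 hx
  have : (Finset.Icc (1 : ℤ) n).filter (· ≤ x) = Finset.Icc 1 x := by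
    ext z
    simp only [Finset.mem_filter, Finset.mem_Icc]
    omega
  rw [rank, this, Int.card_Icc]
  omega

theorem rank_union_left {X Y : Finset ℤ} {x : ℤ} (hY : ∀ y ∈ Y, x < y) :
    rank (X ∪ Y) x = rank X x := by
  unfold rank
  rw [Finset.filter_union, Finset.filter_eq_empty_iff.2 fun y hy => not_le.2 (hY y hy),
    Finset.union_empty]

theorem exists_rank_eq (L : Finset ℤ) {k : ℤ} (hk : k ∈ Finset.Icc (1 : ℤ) L.card) :
    ∃ x ∈ L, rank L x = k := by
  have h : L.image (rank L) = Finset.Icc (1 : ℤ) L.card := by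
    apply Finset.eq_of_subset_of_card_le
    · intro z hz
      obtain ⟨x, hx, rfl⟩ := Finset.mem_image.1 hz
      exact Finset.mem_Icc.2 ⟨rank_pos hx, rank_le L x⟩
    · rw [Int.card_Icc, Finset.card_image_of_injOn fun x hx y hy h => rank_injOn hx hy h]
      omega
  rw [← h] at hk
  exact Finset.mem_image.1 hk

/-- `Tuple.sort f` lists the positions by increasing value, so its inverse sends a position to the
rank of its value. Ranks count from 1, elements of `Fin n` from 0. -/
theorem sort_inv_val {n : ℕ} {α : Type} [LinearOrder α] (f : Fin n → α)
    (hf : Function.Injective f) (i : Fin n) :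
    (((Tuple.sort f)⁻¹ i : Fin n) : ℕ) + 1 = (Finset.univ.filter fun j => f j ≤ f i).card := by
  obtain ⟨k, rfl⟩ := (Tuple.sort f).surjective i
  have hm : StrictMono (f ∘ Tuple.sort f) :=
    (Tuple.monotone_sort f).strictMono_of_injective (hf.comp (Tuple.sort f).injective)
  have : (Finset.univ.filter fun j => f j ≤ f (Tuple.sort f k)) =
      (Finset.Iic k).map (Tuple.sort f).toEmbedding := by
    ext j
    obtain ⟨l, rfl⟩ := (Tuple.sort f).surjective j
    simpa using hm.le_iff_le
  rw [this, Finset.card_map, Fin.card_Iic]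
  simp

theorem list_map_injOn {α β : Type} {f : α → β} {l l' : List α}
    (h : ∀ x ∈ l, ∀ y ∈ l', f x = f y → x = y) (hl : l.map f = l'.map f) : l = l' := by
  induction l generalizing l' with
  | nil => simpa using hl.symm
  | cons a l ih =>
    cases l' with
    | nil => simp at hl
    | cons b l' =>
      simp only [List.map_cons, List.cons.injEq] at hl
      rw [h a (by simp) b (by simp) hl.1,
        ih (fun x hx y hy => h x (by simp [hx]) y (by simp [hy])) hl.2]

end Rank

/-! ### Standardization of unsigned words -/

section WordA

@[simp] theorem length_wordA {n : ℕ} (w : SymGrp n) : (wordA w).length = n := by simp [wordA]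

theorem wordA_injective {u v : Σ n, SymGrp n} (h : wordA u.2 = wordA v.2) : u = v := by
  obtain ⟨n, u⟩ := u
  obtain ⟨m, v⟩ := v
  have : n = m := by simpa using congrArg List.length h
  subst this
  congr 1
  ext i
  have := congrFun (List.ofFn_injective h) i
  simpa using this

theorem nodup_wordA {n : ℕ} (w : SymGrp n) : (wordA w).Nodup := by
  rw [wordA, List.nodup_ofFn]
  intro i j h
  apply w.injective
  ext
  simpa using h

theorem toFinset_wordA {n : ℕ} (w : SymGrp n) : (wordA w).toFinset = Finset.Icc 1 (n : ℤ) := by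
  apply Finset.eq_of_subset_of_card_le
  · intro x hx
    rw [List.mem_toFinset, wordA, List.mem_ofFn] at hx
    obtain ⟨i, rfl⟩ := hx
    rw [Finset.mem_Icc]
    have := (w i).2
    omega
  · rw [List.toFinset_card_of_nodup (nodup_wordA w)]
    simp

theorem mem_wordA {n : ℕ} {w : SymGrp n} {x : ℤ} : x ∈ wordA w ↔ 1 ≤ x ∧ x ≤ n := by
  rw [← List.mem_toFinset, toFinset_wordA, Finset.mem_Icc]

@[simp] theorem stA_fst (c : List ℤ) : (stA c).1 = c.length := rfl

/-- With distinct letters no ties occur, and standardizing means replacing each letter by its rank.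
This description makes standardization visibly insensitive to increasing relabelings. -/
theorem wordA_stA {c : List ℤ} (hc : c.Nodup) :
    wordA (stA c).2 = c.map (rank c.toFinset) := by
  apply List.ext_getElem
  · rw [length_wordA, List.length_map]; rfl
  intro i h1 h2
  have hi : i < c.length := by simpa using h2
  have := sort_inv_val c.get hc.injective_get ⟨i, hi⟩
  have h3 : (Finset.univ.filter fun j => c.get j ≤ c.get ⟨i, hi⟩).card =
      (c.toFinset.filter (· ≤ c.get ⟨i, hi⟩)).card := by
    rw [← Finset.card_image_of_injective _ hc.injective_get]
    congr 1
    ext z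
    simp only [Finset.mem_image, Finset.mem_filter, List.mem_toFinset, Finset.mem_univ, true_and]
    constructor
    · rintro ⟨j, h, rfl⟩
      exact ⟨List.get_mem _ _, h⟩
    · rintro ⟨hz, h⟩
      obtain ⟨j, rfl⟩ := List.get_of_mem hz
      exact ⟨j, h, rfl⟩
  rw [h3] at this
  rw [List.getElem_map]
  simp only [wordA, List.getElem_ofFn]
  change (((Tuple.sort c.get)⁻¹ ⟨i, hi⟩ : Fin c.length) : ℤ) + 1 = rank _ (c.get ⟨i, hi⟩)
  rw [rank]
  exact_mod_cast this

theorem stA_map {c : List ℤ} {f : ℤ → ℤ} (hc : c.Nodup)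
    (hf : StrictMonoOn f {x | x ∈ c}) : stA (c.map f) = stA c := by
  have hf' : StrictMonoOn f (c.toFinset : Set ℤ) := by simpa using hf
  have hcf : (c.map f).Nodup := by
    rw [List.nodup_map_iff_inj_on hc]
    exact fun x hx y hy h => hf.injOn hx hy h
  apply wordA_injective
  rw [wordA_stA hcf, wordA_stA hc, List.map_map]
  refine List.map_congr_left fun x hx => ?_
  have : (c.map f).toFinset = c.toFinset.image f := by ext; simp
  rw [Function.comp_apply, this, rank_image hf' (by simpa using hx)]

theorem stA_wordA {n : ℕ} (w : SymGrp n) : stA (wordA w) = ⟨n, w⟩ := by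
  apply wordA_injective
  rw [wordA_stA (nodup_wordA w), toFinset_wordA]
  conv_rhs => rw [← List.map_id (wordA w)]
  refine List.map_congr_left fun x hx => rank_Icc ?_
  rwa [← toFinset_wordA w, List.mem_toFinset]

theorem stA_wordA' (u : Σ n, SymGrp n) : stA (wordA u.2) = u := stA_wordA u.2

theorem stA_injOn {c d : List ℤ} (hc : c.Nodup) (hd : d.Nodup) (h : c.toFinset = d.toFinset)
    (hst : stA c = stA d) : c = d := by
  have : c.map (rank c.toFinset) = d.map (rank c.toFinset) := by
    rw [← wordA_stA hc, hst, wordA_stA hd, h]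
  refine list_map_injOn (fun x hx y hy hxy => rank_injOn ?_ ?_ hxy) this
  · simpa using hx
  · rw [h]; simpa using hy

/-- Words with the letters `1, …, n` are one-line notations. -/
theorem exists_wordA {c : List ℤ} {n : ℕ} (hc : c.Nodup) (h : c.toFinset = Finset.Icc 1 (n : ℤ)) :
    ∃ w : SymGrp n, wordA w = c := by
  have hn : c.length = n := by
    rw [← List.toFinset_card_of_nodup hc, h, Int.card_Icc]; omega
  subst hn
  refine ⟨(stA c).2, (wordA_stA hc).trans ?_⟩
  rw [h]
  conv_rhs => rw [← List.map_id c]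
  refine List.map_congr_left fun x hx => rank_Icc ?_
  rwa [← h, List.mem_toFinset]

end WordA

/-! ### Signed standardization of words with distinct absolute values -/

section WordB

/-- The extension of `f` from the nonnegative integers to a function commuting with signs. -/
def oddExt (f : ℤ → ℤ) (x : ℤ) : ℤ := if x < 0 then -f |x| else f |x|

theorem oddExt_of_neg (f : ℤ → ℤ) {x : ℤ} (h : x < 0) : oddExt f x = -f |x| := if_pos h

theorem oddExt_of_nonneg (f : ℤ → ℤ) {x : ℤ} (h : ¬x < 0) : oddExt f x = f |x| := if_neg h

theorem abs_oddExt {f : ℤ → ℤ} {x : ℤ} (h : 0 < f |x|) : |oddExt f x| = f |x| := by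
  unfold oddExt
  split_ifs
  · rw [abs_neg, abs_of_pos h]
  · rw [abs_of_pos h]

theorem oddExt_neg_iff {f : ℤ → ℤ} {x : ℤ} (h : 0 < f |x|) : oddExt f x < 0 ↔ x < 0 := by
  unfold oddExt
  split_ifs <;> constructor <;> intro <;> omega

@[simp] theorem length_wordB {n : ℕ} (w : HypGrp n) : (wordB w).length = n := by simp [wordB]

theorem PM.val_injective {n : ℕ} {x y : PM n} (h : PM.val x = PM.val y) : x = y := by
  obtain ⟨i, a⟩ := x
  obtain ⟨j, b⟩ := y
  cases a <;> cases b <;> simp [PM.val] at h ⊢ <;> omega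

theorem PM.abs_val {n : ℕ} (x : PM n) : |PM.val x| = (x.1 : ℤ) + 1 := by
  unfold PM.val
  split_ifs
  · rw [abs_neg]; exact abs_of_pos (by omega)
  · exact abs_of_pos (by omega)

theorem HypGrp.apply_true {n : ℕ} (w : HypGrp n) (i : Fin n) :
    w.1 (i, true) = PM.neg (w.1 (i, false)) := w.2 (i, false)

theorem HypGrp.ext_of {n : ℕ} {u v : HypGrp n} (h : ∀ i, u.1 (i, false) = v.1 (i, false)) :
    u = v := by
  apply Subtype.ext
  apply Equiv.ext
  rintro ⟨i, b⟩
  cases b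
  · exact h i
  · rw [HypGrp.apply_true, HypGrp.apply_true, h]

theorem wordB_injective {u v : Σ n, HypGrp n} (h : wordB u.2 = wordB v.2) : u = v := by
  obtain ⟨n, u⟩ := u
  obtain ⟨m, v⟩ := v
  have : n = m := by simpa using congrArg List.length h
  subst this
  congr 1
  exact HypGrp.ext_of fun i => PM.val_injective (congrFun (List.ofFn_injective h) i)

theorem HypGrp.fst_injective {n : ℕ} (w : HypGrp n) :
    Function.Injective fun i => (w.1 (i, false)).1 := by
  intro i j h
  rcases Bool.eq_or_eq_not (w.1 (i, false)).2 (w.1 (j, false)).2 with h' | h'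
  · have := w.1.injective (Prod.ext h h')
    simpa using this
  -- Equal absolute values with opposite signs would mean w(i) = w(-j), against injectivity.
  · have : w.1 (i, false) = w.1 (j, true) := by
      rw [HypGrp.apply_true]; exact Prod.ext h h'
    simpa using w.1.injective this

theorem nodup_wordB {n : ℕ} (w : HypGrp n) : ((wordB w).map (|·|)).Nodup := by
  rw [wordB, List.map_ofFn, List.nodup_ofFn]
  intro i j h
  apply w.fst_injective
  simp only [Function.comp_apply, PM.abs_val] at h
  ext
  simpa using h

theorem toFinset_wordB {n : ℕ} (w : HypGrp n) :
    ((wordB w).map (|·|)).toFinset = Finset.Icc 1 (n : ℤ) := by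
  apply Finset.eq_of_subset_of_card_le
  · intro x hx
    rw [List.mem_toFinset, wordB, List.map_ofFn, List.mem_ofFn] at hx
    obtain ⟨i, rfl⟩ := hx
    rw [Finset.mem_Icc, Function.comp_apply, PM.abs_val]
    have := (w.1 (i, false)).1.2
    omega
  · rw [List.toFinset_card_of_nodup (nodup_wordB w)]
    simp

theorem mem_wordB {n : ℕ} {w : HypGrp n} {x : ℤ} (hx : x ∈ wordB w) : 1 ≤ |x| ∧ |x| ≤ n := by
  rw [← Finset.mem_Icc, ← toFinset_wordB w, List.mem_toFinset]
  exact List.mem_map_of_mem hx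

@[simp] theorem stB_fst (c : List ℤ) : (stB c).1 = c.length := rfl

/-- Distinct absolute values make the second component of `keyB` irrelevant. What remains is the
rank of the absolute value, with the sign kept. -/
theorem wordB_stB {c : List ℤ} (hc : (c.map (|·|)).Nodup) :
    wordB (stB c).2 = c.map (oddExt (rank (c.map (|·|)).toFinset)) := by
  have habs : ∀ i j : Fin c.length, |c.get i| = |c.get j| → i = j := by
    intro i j h
    have h1 : (c.map (|·|)).get (i.cast (by simp)) = (c.map (|·|)).get (j.cast (by simp)) := by
      simpa using h
    have := hc.injective_get h1
    simpa [Fin.ext_iff] using this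
  have hinj : Function.Injective (keyB c) := by
    intro i j h
    exact habs i j (congrArg Prod.fst (toLex_inj.1 h))
  apply List.ext_getElem
  · rw [length_wordB, List.length_map]; rfl
  intro i h1 h2
  have hi : i < c.length := by simpa using h2
  have := sort_inv_val (keyB c) hinj ⟨i, hi⟩
  have h3 : (Finset.univ.filter fun j => keyB c j ≤ keyB c ⟨i, hi⟩).card =
      ((c.map (|·|)).toFinset.filter (· ≤ |c.get ⟨i, hi⟩|)).card := by
    rw [← Finset.card_image_of_injOn (f := fun j : Fin c.length => |c.get j|)
      (fun i _ j _ h => habs i j h)]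
    congr 1
    ext z
    simp only [Finset.mem_image, Finset.mem_filter, List.mem_toFinset, Finset.mem_univ, true_and,
      List.mem_map]
    have hle : ∀ j : Fin c.length, keyB c j ≤ keyB c ⟨i, hi⟩ ↔ |c.get j| ≤ |c.get ⟨i, hi⟩| := by
      intro j
      rw [Prod.Lex.le_iff]
      constructor
      · rintro (h | h)
        · exact le_of_lt h
        · exact le_of_eq h.1
      · intro h
        rcases eq_or_lt_of_le h with h' | h'
        · have : j = ⟨i, hi⟩ := habs _ _ h'
          subst this
          right
          exact ⟨rfl, le_rfl⟩
        · left; exact h'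
    constructor
    · rintro ⟨j, h, rfl⟩
      exact ⟨⟨_, List.get_mem _ _, rfl⟩, (hle j).1 h⟩
    · rintro ⟨⟨y, hy, rfl⟩, h⟩
      obtain ⟨j, rfl⟩ := List.get_of_mem hy
      exact ⟨j, (hle j).2 h, rfl⟩
  rw [h3] at this
  rw [List.getElem_map]
  change _ = oddExt _ (c.get ⟨i, hi⟩)
  have h4 : rank (c.map (|·|)).toFinset |c.get ⟨i, hi⟩| =
      (((Tuple.sort (keyB c))⁻¹ ⟨i, hi⟩ : Fin c.length) : ℤ) + 1 := by
    rw [rank]; exact_mod_cast this.symm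
  rw [oddExt, h4]
  simp only [wordB, List.getElem_ofFn]
  change PM.val ((Tuple.sort (keyB c))⁻¹ ⟨i, hi⟩, false ^^ decide (c.get ⟨i, hi⟩ < 0)) = _
  simp [PM.val]

theorem stB_map {c : List ℤ} {f : ℤ → ℤ} (hc : (c.map (|·|)).Nodup)
    (hf : StrictMonoOn f {x | x ∈ c.map (|·|)}) (hpos : ∀ x ∈ c, 0 < f |x|) :
    stB (c.map (oddExt f)) = stB c := by
  have hf' : StrictMonoOn f ((c.map (|·|)).toFinset : Set ℤ) := by
    simpa only [List.coe_toFinset] using hf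
  have habs : (c.map (oddExt f)).map (|·|) = (c.map (|·|)).map f := by
    rw [List.map_map, List.map_map]
    exact List.map_congr_left fun x hx => abs_oddExt (hpos x hx)
  have hcf : ((c.map (oddExt f)).map (|·|)).Nodup := by
    rw [habs, List.nodup_map_iff_inj_on hc]
    exact fun x hx y hy h => hf.injOn hx hy h
  apply wordB_injective
  rw [wordB_stB hcf, wordB_stB hc, List.map_map]
  refine List.map_congr_left fun x hx => ?_
  have : ((c.map (oddExt f)).map (|·|)).toFinset = (c.map (|·|)).toFinset.image f := by
    rw [habs]; ext; simp
  rw [Function.comp_apply, this]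
  have hx' : |x| ∈ (c.map (|·|)).toFinset := by
    rw [List.mem_toFinset]; exact List.mem_map_of_mem hx
  have h1 : rank ((c.map (|·|)).toFinset.image f) |oddExt f x| =
      rank (c.map (|·|)).toFinset |x| := by
    rw [abs_oddExt (hpos x hx), rank_image hf' hx']
  by_cases h : x < 0
  · rw [oddExt_of_neg _ ((oddExt_neg_iff (hpos x hx)).2 h), h1, oddExt_of_neg _ h]
  · rw [oddExt_of_nonneg _ (mt (oddExt_neg_iff (hpos x hx)).1 h), h1, oddExt_of_nonneg _ h]

theorem stB_wordB {n : ℕ} (w : HypGrp n) : stB (wordB w) = ⟨n, w⟩ := by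
  apply wordB_injective
  rw [wordB_stB (nodup_wordB w), toFinset_wordB]
  conv_rhs => rw [← List.map_id (wordB w)]
  refine List.map_congr_left fun x hx => ?_
  rw [oddExt, rank_Icc (Finset.mem_Icc.2 (mem_wordB hx))]
  split_ifs with h
  · rw [abs_of_neg h, neg_neg]; rfl
  · rw [abs_of_nonneg (by omega)]; rfl

theorem stB_wordB' (u : Σ n, HypGrp n) : stB (wordB u.2) = u := stB_wordB u.2

/-- Words whose letters have the absolute values `1, …, n` are window notations. -/
theorem exists_wordB {c : List ℤ} {n : ℕ} (hc : (c.map (|·|)).Nodup)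
    (h : (c.map (|·|)).toFinset = Finset.Icc 1 (n : ℤ)) : ∃ w : HypGrp n, wordB w = c := by
  have hn : c.length = n := by
    rw [← List.length_map (as := c) (|·|), ← List.toFinset_card_of_nodup hc, h, Int.card_Icc]
    omega
  subst hn
  refine ⟨(stB c).2, (wordB_stB hc).trans ?_⟩
  rw [h]
  conv_rhs => rw [← List.map_id c]
  refine List.map_congr_left fun x hx => ?_
  have hx' : |x| ∈ Finset.Icc (1 : ℤ) c.length := by
    rw [← h, List.mem_toFinset]; exact List.mem_map_of_mem hx
  rw [oddExt, rank_Icc hx']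
  split_ifs with h
  · rw [abs_of_neg h, neg_neg]; rfl
  · rw [abs_of_nonneg (by omega)]; rfl

end WordB

/-! ## Decompositions of words -/

section Splits

/-- The decompositions of a word into two factors. -/
def splits (c : List ℤ) : Finset (List ℤ × List ℤ) :=
  (Finset.range (c.length + 1)).image fun i => (c.take i, c.drop i)

@[simp] theorem mem_splits {c : List ℤ} {p : List ℤ × List ℤ} :
    p ∈ splits c ↔ p.1 ++ p.2 = c := by
  simp only [splits, Finset.mem_image, Finset.mem_range]
  constructor
  · rintro ⟨i, _, rfl⟩
    exact List.take_append_drop i c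
  · rintro rfl
    exact ⟨p.1.length, by simp, by simp⟩

theorem sum_splits {N : Type} [AddCommMonoid N] (c : List ℤ) (F : List ℤ × List ℤ → N) :
    ∑ p ∈ splits c, F p = ∑ i ∈ Finset.range (c.length + 1), F (c.take i, c.drop i) := by
  rw [splits, Finset.sum_image]
  intro i hi j hj h
  have := congrArg (fun p : List ℤ × List ℤ => p.1.length) h
  simp only [Finset.coe_range, Set.mem_Iio] at hi hj
  simp only [List.length_take] at this
  omega

/-- The decompositions of a word into three factors. -/
def splits3 (c : List ℤ) : Finset (List ℤ × List ℤ × List ℤ) :=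
  (splits c).biUnion fun p => (splits p.2).image fun q => (p.1, q)

@[simp] theorem mem_splits3 {c : List ℤ} {p : List ℤ × List ℤ × List ℤ} :
    p ∈ splits3 c ↔ p.1 ++ (p.2.1 ++ p.2.2) = c := by
  simp only [splits3, Finset.mem_biUnion, Finset.mem_image, mem_splits]
  constructor
  · rintro ⟨q, hq, r, hr, rfl⟩
    simp only [hr, hq]
  · intro h
    exact ⟨(p.1, p.2.1 ++ p.2.2), h, p.2, rfl, rfl⟩

theorem sum_splits3 {N : Type} [AddCommMonoid N] (c : List ℤ)
    (F : List ℤ × List ℤ × List ℤ → N) :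
    ∑ p ∈ splits3 c, F p = ∑ p ∈ splits c, ∑ q ∈ splits p.2, F (p.1, q) := by
  rw [splits3, Finset.sum_biUnion]
  · refine Finset.sum_congr rfl fun p _ => Finset.sum_image ?_
    intro q _ r _ h
    exact (Prod.ext_iff.1 h).2
  · intro p hp r hr hpr
    rw [Function.onFun, Finset.disjoint_left]
    rintro _ h h'
    obtain ⟨q, hq, rfl⟩ := Finset.mem_image.1 h
    obtain ⟨s, hs, hqs⟩ := Finset.mem_image.1 h'
    rw [Prod.ext_iff] at hqs
    apply hpr
    rw [mem_splits] at hq hs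
    refine Prod.ext hqs.1.symm ?_
    rw [← hq, ← hs, show s = q from hqs.2]

/-- Both sides run over the cuts of the word into three pieces. This is all that coassociativity of
deconcatenation needs. -/
theorem sum_splits_splits {N : Type} [AddCommMonoid N] (c : List ℤ)
    (F : List ℤ → List ℤ → List ℤ → N) :
    ∑ p ∈ splits c, ∑ q ∈ splits p.1, F q.1 q.2 p.2 =
      ∑ p ∈ splits c, ∑ q ∈ splits p.2, F p.1 q.1 q.2 := by
  rw [Finset.sum_sigma', Finset.sum_sigma']
  refine Finset.sum_bij' (fun a _ => ⟨(a.2.1, a.2.2 ++ a.1.2), (a.2.2, a.1.2)⟩)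
    (fun a _ => ⟨(a.1.1 ++ a.2.1, a.2.2), (a.1.1, a.2.1)⟩) ?_ ?_ ?_ ?_ ?_
  · rintro ⟨p, q⟩ h
    simp only [Finset.mem_sigma, mem_splits] at h ⊢
    exact ⟨by rw [← List.append_assoc, h.2, h.1], trivial⟩
  · rintro ⟨p, q⟩ h
    simp only [Finset.mem_sigma, mem_splits] at h ⊢
    exact ⟨by rw [List.append_assoc, h.2, h.1], trivial⟩
  · rintro ⟨⟨p, p'⟩, ⟨q, q'⟩⟩ h
    simp only [Finset.mem_sigma, mem_splits] at h
    obtain ⟨_, rfl⟩ := h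
    rfl
  · rintro ⟨⟨p, p'⟩, ⟨q, q'⟩⟩ h
    simp only [Finset.mem_sigma, mem_splits] at h
    obtain ⟨_, rfl⟩ := h
    rfl
  · rintro ⟨p, q⟩ h
    rfl

end Splits

/-! ## Families of words with prescribed restrictions -/

section Families

theorem hat_eq (a : List ℤ) : hat a =
    ((a.filter fun x => decide (x < 0)).reverse ++ a.filter fun x => decide (0 ≤ x)).map (|·|) := by
  rw [hat, List.map_append]
  congr 1
  · refine List.map_congr_left fun x hx => ?_
    simp only [List.mem_reverse, List.mem_filter, decide_eq_true_eq] at hx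
    exact (abs_of_neg hx.2).symm
  · conv_lhs => rw [← List.map_id (List.filter _ a)]
    refine List.map_congr_left fun x hx => ?_
    simp only [List.mem_filter, decide_eq_true_eq] at hx
    exact (abs_of_nonneg hx.2).symm

theorem hat_perm (a : List ℤ) : (hat a).Perm (a.map (|·|)) := by
  rw [hat_eq]
  refine List.Perm.map _ (((List.reverse_perm _).append_right _).trans ?_)
  have : (fun x : ℤ => decide (0 ≤ x)) = fun x => !decide (x < 0) := by
    ext x
    rcases lt_or_ge x 0 with h | h
    · simp [h]
    · simp [h]
  rw [this]
  exact List.filter_append_perm _ _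

/-- The negative letters of the right factor move to the very front and its other letters to the
end, around `hat a`. This is why cutting a signed shuffle cuts the second argument into three pieces
rather than two. -/
theorem hat_append (a b : List ℤ) : hat (a ++ b) =
    ((b.filter fun x => decide (x < 0)).reverse.map fun x => -x) ++
      (hat a ++ b.filter fun x => decide (0 ≤ x)) := by
  simp [hat]

theorem hat_filter_abs (a : List ℤ) (q : ℤ → Bool) :
    (hat a).filter q = hat (a.filter fun x => q |x|) := by
  rw [hat_eq, hat_eq, List.filter_map, List.filter_append, List.filter_reverse, List.filter_filter,
    List.filter_filter, List.filter_filter, List.filter_filter]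
  simp only [Function.comp_apply, Bool.and_comm]

theorem hat_map_oddExt {f : ℤ → ℤ} {a : List ℤ} (h : ∀ x ∈ a, 0 < f |x|) :
    hat (a.map (oddExt f)) = (hat a).map f := by
  rw [hat_eq, hat_eq, List.filter_map, List.filter_map, ← List.map_reverse, ← List.map_append,
    List.map_map, List.map_map]
  have h1 : a.filter ((fun x => decide (x < 0)) ∘ oddExt f) = a.filter fun x => decide (x < 0) := by
    refine List.filter_congr fun x hx => ?_
    rw [Function.comp_apply, decide_eq_decide, oddExt_neg_iff (h x hx)]
  have h2 : a.filter ((fun x => decide (0 ≤ x)) ∘ oddExt f) = a.filter fun x => decide (0 ≤ x) := by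
    refine List.filter_congr fun x hx => ?_
    rw [Function.comp_apply, decide_eq_decide, ← not_lt, ← not_lt, oddExt_neg_iff (h x hx)]
  rw [h1, h2]
  refine List.map_congr_left fun x hx => ?_
  have hx : x ∈ a := by
    simp only [List.mem_append, List.mem_reverse, List.mem_filter] at hx
    exact hx.elim And.left And.left
  exact abs_oddExt (h x hx)

/-- The words of length `n` with letters in `K`. -/
def wordsIn (K : Finset ℤ) (n : ℕ) : Finset (List ℤ) :=
  (Fintype.piFinset fun _ : Fin n => K).image List.ofFn

theorem mem_wordsIn {K : Finset ℤ} {n : ℕ} {c : List ℤ} :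
    c ∈ wordsIn K n ↔ c.length = n ∧ ∀ x ∈ c, x ∈ K := by
  simp only [wordsIn, Finset.mem_image, Fintype.mem_piFinset]
  constructor
  · rintro ⟨f, hf, rfl⟩
    refine ⟨by simp, fun x hx => ?_⟩
    obtain ⟨i, rfl⟩ := List.mem_ofFn.1 hx
    exact hf i
  · rintro ⟨rfl, h⟩
    exact ⟨c.get, fun i => h _ (List.get_mem _ _), List.ofFn_get c⟩

/-- The letters of `c` that are less than `t`. -/
def lo (t : ℤ) (c : List ℤ) : List ℤ := c.filter fun x => decide (x < t)

/-- The letters of `c` that are at least `t`. -/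
def hi (t : ℤ) (c : List ℤ) : List ℤ := c.filter fun x => decide (t ≤ x)

/-- The letters of `c` with absolute value less than `t`. -/
def loB (t : ℤ) (c : List ℤ) : List ℤ := c.filter fun x => decide (|x| < t)

/-- The letters of `c` with absolute value at least `t`. -/
def hiB (t : ℤ) (c : List ℤ) : List ℤ := c.filter fun x => decide (t ≤ |x|)

theorem perm_lo_hi (t : ℤ) (c : List ℤ) : (lo t c ++ hi t c).Perm c := by
  have : (fun x : ℤ => decide (t ≤ x)) = fun x => !decide (x < t) := by
    ext x
    rcases lt_or_ge x t with h | h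
    · simp [h]
    · simp [h]
  rw [lo, hi, this]
  exact List.filter_append_perm _ _

theorem perm_loB_hiB (t : ℤ) (c : List ℤ) : (loB t c ++ hiB t c).Perm c := by
  have : (fun x : ℤ => decide (t ≤ |x|)) = fun x => !decide (|x| < t) := by
    ext x
    rcases lt_or_ge |x| t with h | h
    · simp [h]
    · simp [h]
  rw [loB, hiB, this]
  exact List.filter_append_perm _ _

/-- The words with given subwords of letters less than `t` and of letters at least `t`. -/
def famA (t : ℤ) (x y : List ℤ) : Finset (List ℤ) :=
  (wordsIn (x ++ y).toFinset (x.length + y.length)).filter fun c => lo t c = x ∧ hi t c = y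

-- The ambient set `wordsIn` only makes the family finite: its conditions on length and alphabet
-- follow from the two restrictions, since together they use up all letters of the word.
@[simp] theorem mem_famA {t : ℤ} {x y c : List ℤ} :
    c ∈ famA t x y ↔ lo t c = x ∧ hi t c = y := by
  rw [famA, Finset.mem_filter, and_iff_right_iff_imp]
  rintro ⟨rfl, rfl⟩
  have := perm_lo_hi t c
  rw [mem_wordsIn, ← List.length_append]
  exact ⟨this.length_eq.symm, fun x hx => List.mem_toFinset.2 (this.mem_iff.2 hx)⟩

/-- The words `c` whose subword of letters of absolute value less than `t` is `x`, and for which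
`y` is the word associated by `hat` with the subword of the other letters. -/
def famB (t : ℤ) (x y : List ℤ) : Finset (List ℤ) :=
  (wordsIn (x ++ (y ++ y.map fun z => -z)).toFinset (x.length + y.length)).filter fun c =>
    loB t c = x ∧ hat (hiB t c) = y

@[simp] theorem mem_famB {t : ℤ} {x y c : List ℤ} :
    c ∈ famB t x y ↔ loB t c = x ∧ hat (hiB t c) = y := by
  rw [famB, Finset.mem_filter, and_iff_right_iff_imp]
  rintro ⟨rfl, rfl⟩
  have h := perm_loB_hiB t c
  have h' := hat_perm (hiB t c)
  rw [mem_wordsIn]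
  constructor
  · rw [h'.length_eq, List.length_map, ← List.length_append, h.length_eq]
  · intro x hx
    rw [← h.mem_iff, List.mem_append] at hx
    rw [List.mem_toFinset, List.mem_append]
    refine hx.imp_right fun hx => ?_
    have h2 := h'.mem_iff.2 (List.mem_map_of_mem hx)
    rw [List.mem_append]
    rcases abs_choice x with h3 | h3
    · left; rwa [h3] at h2
    · right
      rw [h3] at h2
      exact List.mem_map.2 ⟨_, h2, neg_neg x⟩

/-- The words with given subwords of letters in `(-t,t)`, of letters at most `-t`, and of letters
at least `t`. -/
def famC (t : ℤ) (x y z : List ℤ) : Finset (List ℤ) :=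
  (wordsIn (x ++ (y ++ z)).toFinset (x.length + (y.length + z.length))).filter fun c =>
    loB t c = x ∧ (hiB t c).filter (fun a => decide (a < 0)) = y ∧
      (hiB t c).filter (fun a => decide (0 ≤ a)) = z

@[simp] theorem mem_famC {t : ℤ} {x y z c : List ℤ} :
    c ∈ famC t x y z ↔ loB t c = x ∧ (hiB t c).filter (fun a => decide (a < 0)) = y ∧
      (hiB t c).filter (fun a => decide (0 ≤ a)) = z := by
  rw [famC, Finset.mem_filter, and_iff_right_iff_imp]
  rintro ⟨rfl, rfl, rfl⟩
  have h : (loB t c ++ ((hiB t c).filter (fun a => decide (a < 0)) ++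
      (hiB t c).filter (fun a => decide (0 ≤ a)))).Perm c :=
    (List.Perm.append_left _ (perm_lo_hi 0 (hiB t c))).trans (perm_loB_hiB t c)
  rw [mem_wordsIn, ← List.length_append, ← List.length_append]
  exact ⟨h.length_eq.symm, fun x hx => List.mem_toFinset.2 (h.mem_iff.2 hx)⟩

/-- Decomposing the words of a family into two factors, and sorting the pairs of factors by the
value of `π`. -/
theorem sum_fam_splits {N I : Type} [AddCommMonoid N] [DecidableEq I] (C : Finset (List ℤ))
    (S : Finset I) (π : List ℤ × List ℤ → I) (C1 C2 : I → Finset (List ℤ))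
    (hS : ∀ p : List ℤ × List ℤ, p.1 ++ p.2 ∈ C → π p ∈ S)
    (hC : ∀ i ∈ S, ∀ p : List ℤ × List ℤ,
      (p.1 ++ p.2 ∈ C ∧ π p = i) ↔ (p.1 ∈ C1 i ∧ p.2 ∈ C2 i))
    (F : List ℤ × List ℤ → N) :
    ∑ c ∈ C, ∑ p ∈ splits c, F p = ∑ i ∈ S, ∑ a ∈ C1 i, ∑ b ∈ C2 i, F (a, b) := by
  rw [← Finset.sum_biUnion]
  · rw [← Finset.sum_fiberwise_of_maps_to (g := π) (t := S)]
    · refine Finset.sum_congr rfl fun i hi => ?_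
      rw [← Finset.sum_product']
      refine Finset.sum_congr ?_ fun p _ => rfl
      ext p
      rw [Finset.mem_product, ← hC i hi p, Finset.mem_filter, Finset.mem_biUnion]
      simp
    · intro p hp
      obtain ⟨c, hc, hp⟩ := Finset.mem_biUnion.1 hp
      rw [mem_splits] at hp
      exact hS p (hp ▸ hc)
  · intro c _ d _ hcd
    rw [Function.onFun, Finset.disjoint_left]
    intro p hp hp'
    rw [mem_splits] at hp hp'
    exact hcd (hp.symm.trans hp')

/-- Selecting letters by size commutes with concatenation. Hence cutting a shuffle of x and y
amounts to cutting x, cutting y, and shuffling the left pieces and the right pieces separately. -/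
theorem sum_famA_splits {N : Type} [AddCommMonoid N] (t : ℤ) (x y : List ℤ)
    (F : List ℤ × List ℤ → N) :
    ∑ c ∈ famA t x y, ∑ p ∈ splits c, F p =
      ∑ i ∈ splits x ×ˢ splits y, ∑ a ∈ famA t i.1.1 i.2.1, ∑ b ∈ famA t i.1.2 i.2.2,
        F (a, b) := by
  refine sum_fam_splits _ _ (fun p => ((lo t p.1, lo t p.2), (hi t p.1, hi t p.2))) _ _ ?_ ?_ F
  · intro p hp
    simpa [lo, hi] using hp
  · rintro ⟨⟨x1, x2⟩, ⟨y1, y2⟩⟩ hi p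
    simp only [Finset.mem_product, mem_splits] at hi
    obtain ⟨rfl, rfl⟩ := hi
    simp only [mem_famA, Prod.mk.injEq, lo, hi, List.filter_append]
    constructor
    · rintro ⟨_, ⟨h1, h2⟩, h3, h4⟩; exact ⟨⟨h1, h3⟩, h2, h4⟩
    · rintro ⟨⟨h1, h3⟩, h2, h4⟩; exact ⟨⟨by rw [h1, h2], by rw [h3, h4]⟩, ⟨h1, h2⟩, h3, h4⟩

/-- The word `b` read from right to left with all signs changed. -/
def negRev (b : List ℤ) : List ℤ := (b.map fun z => -z).reverse

theorem negRev_eq_iff {a b : List ℤ} : a = negRev b ↔ a.reverse.map (fun z => -z) = b := by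
  constructor
  · rintro rfl; simp [negRev]
  · rintro rfl; simp [negRev]

/-- By `hat_append` the middle piece of y belongs to the left factor, and the outer pieces are the
negative and the other large letters of the right factor. The negative ones are listed backwards by
`hat`, whence `negRev`. The right factor enters only through its unsigned standardization, so its
three kinds of letters are prescribed separately by `famC`. -/
theorem sum_famB_splits {N : Type} [AddCommMonoid N] (t : ℤ) (x y : List ℤ)
    (F : List ℤ × List ℤ → N) :
    ∑ c ∈ famB t x y, ∑ p ∈ splits c, F p =
      ∑ i ∈ splits x ×ˢ splits3 y, ∑ a ∈ famB t i.1.1 i.2.2.1,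
        ∑ b ∈ famC t i.1.2 (negRev i.2.1) i.2.2.2, F (a, b) := by
  refine sum_fam_splits _ _ (fun p => ((loB t p.1, loB t p.2),
    (((hiB t p.2).filter fun x => decide (x < 0)).reverse.map fun x => -x),
      (hat (hiB t p.1), (hiB t p.2).filter fun x => decide (0 ≤ x)))) _ _ ?_ ?_ F
  · intro p hp
    rw [mem_famB, hiB, List.filter_append, hat_append, loB, List.filter_append] at hp
    exact Finset.mem_product.2 ⟨mem_splits.2 hp.1, mem_splits3.2 hp.2⟩
  · rintro ⟨⟨x1, x2⟩, ⟨y1, y2, y3⟩⟩ hi p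
    simp only [Finset.mem_product, mem_splits, mem_splits3] at hi
    obtain ⟨rfl, rfl⟩ := hi
    have e : hat (hiB t (p.1 ++ p.2)) =
      (((hiB t p.2).filter fun x => decide (x < 0)).reverse.map fun x => -x) ++
        (hat (hiB t p.1) ++ (hiB t p.2).filter fun x => decide (0 ≤ x)) := by
      rw [hiB, List.filter_append, hat_append]; rfl
    have e' : loB t (p.1 ++ p.2) = loB t p.1 ++ loB t p.2 := List.filter_append _ _
    simp only [mem_famB, mem_famC, Prod.mk.injEq, e, e', negRev_eq_iff]
    constructor
    · rintro ⟨_, ⟨h1, h2⟩, h3, h4, h5⟩; exact ⟨⟨h1, h4⟩, h2, h3, h5⟩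
    · rintro ⟨⟨h1, h4⟩, h2, h3, h5⟩
      exact ⟨⟨by rw [h1, h2], by rw [h3, h4, h5]⟩, ⟨h1, h2⟩, h3, h4, h5⟩

end Families

/-! ## Products and coproducts of standardizations -/

section Std

/-- The standardization of a word as a basis element. -/
noncomputable def sA (c : List ℤ) : ZS := bas (stA c)

/-- The signed standardization of a word as a basis element. -/
noncomputable def sB (c : List ℤ) : ZB := bas (stB c)

theorem sA_wordA (u : Σ n, SymGrp n) : sA (wordA u.2) = bas u := by rw [sA, stA_wordA']

theorem sB_wordB (u : Σ n, HypGrp n) : sB (wordB u.2) = bas u := by rw [sB, stB_wordB']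

/-- Inverts ranking relative to a prescribed alphabet: the permutations of size `L.card` correspond
to the words that use each letter of `L` exactly once. -/
theorem exists_map_rank (L : Finset ℤ) {d : List ℤ} (hd : d.Nodup)
    (h : d.toFinset = Finset.Icc 1 (L.card : ℤ)) :
    ∃ c : List ℤ, c.Nodup ∧ c.toFinset = L ∧ c.map (rank L) = d := by
  choose! g hgL hg using fun k (hk : k ∈ Finset.Icc (1 : ℤ) L.card) => exists_rank_eq L hk
  have hd' : ∀ k ∈ d, k ∈ Finset.Icc (1 : ℤ) L.card := fun k hk => h ▸ List.mem_toFinset.2 hk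
  have hmap : (d.map g).map (rank L) = d := by
    rw [List.map_map]
    conv_rhs => rw [← List.map_id d]
    exact List.map_congr_left fun k hk => hg k (hd' k hk)
  have hnd : (d.map g).Nodup := List.Nodup.of_map (rank L) (by rwa [hmap])
  refine ⟨d.map g, hnd, ?_, hmap⟩
  apply Finset.eq_of_subset_of_card_le
  · intro z hz
    obtain ⟨k, hk, rfl⟩ := List.mem_map.1 (List.mem_toFinset.1 hz)
    exact hgL k (hd' k hk)
  · rw [List.toFinset_card_of_nodup hnd, List.length_map, ← List.toFinset_card_of_nodup hd, h,
      Int.card_Icc]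
    omega

theorem exists_map_oddExt_rank {L : Finset ℤ} (hL : ∀ z ∈ L, 0 < z) {d : List ℤ}
    (hd : (d.map (|·|)).Nodup) (h : (d.map (|·|)).toFinset = Finset.Icc 1 (L.card : ℤ)) :
    ∃ c : List ℤ, (c.map (|·|)).Nodup ∧ (c.map (|·|)).toFinset = L ∧
      c.map (oddExt (rank L)) = d := by
  choose! g hgL hg using fun k (hk : k ∈ Finset.Icc (1 : ℤ) L.card) => exists_rank_eq L hk
  have hd' : ∀ k ∈ d, |k| ∈ Finset.Icc (1 : ℤ) L.card :=
    fun k hk => h ▸ List.mem_toFinset.2 (List.mem_map_of_mem hk)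
  have habs : (d.map (oddExt g)).map (|·|) = (d.map (|·|)).map g := by
    rw [List.map_map, List.map_map]
    exact List.map_congr_left fun k hk => abs_oddExt (hL _ (hgL _ (hd' k hk)))
  have hmap : (d.map (oddExt g)).map (oddExt (rank L)) = d := by
    rw [List.map_map]
    conv_rhs => rw [← List.map_id d]
    refine List.map_congr_left fun k hk => ?_
    have hpos := hL _ (hgL _ (hd' k hk))
    rw [Function.comp_apply]
    by_cases hk0 : k < 0
    · rw [oddExt_of_neg _ ((oddExt_neg_iff hpos).2 hk0), abs_oddExt hpos, hg _ (hd' k hk),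
        abs_of_neg hk0, neg_neg, id]
    · rw [oddExt_of_nonneg _ (mt (oddExt_neg_iff hpos).1 hk0), abs_oddExt hpos, hg _ (hd' k hk),
        abs_of_nonneg (not_lt.1 hk0), id]
  have hmap' : ((d.map (|·|)).map g).map (rank L) = d.map (|·|) := by
    rw [List.map_map]
    conv_rhs => rw [← List.map_id (d.map (|·|))]
    refine List.map_congr_left fun k hk => hg k ?_
    rw [← h]; exact List.mem_toFinset.2 hk
  have hnd : ((d.map (oddExt g)).map (|·|)).Nodup := by
    rw [habs]; exact List.Nodup.of_map (rank L) (by rwa [hmap'])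
  refine ⟨d.map (oddExt g), hnd, ?_, hmap⟩
  apply Finset.eq_of_subset_of_card_le
  · intro z hz
    rw [habs] at hz
    obtain ⟨k, hk, rfl⟩ := List.mem_map.1 (List.mem_toFinset.1 hz)
    exact hgL k (h ▸ List.mem_toFinset.2 hk)
  · rw [List.toFinset_card_of_nodup hnd, List.length_map, List.length_map,
      ← List.length_map (as := d) (|·|), ← List.toFinset_card_of_nodup hd, h, Int.card_Icc]
    omega

theorem map_rank_eq {c : List ℤ} {L : Finset ℤ} (hc : c.Nodup) (h : c.toFinset = L) :
    (c.map (rank L)).Nodup ∧ (c.map (rank L)).toFinset = Finset.Icc 1 (L.card : ℤ) := by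
  rw [← h, ← wordA_stA hc]
  refine ⟨nodup_wordA _, ?_⟩
  rw [toFinset_wordA, List.toFinset_card_of_nodup hc]
  rfl

theorem map_oddExt_rank_eq {c : List ℤ} {L : Finset ℤ} (hc : (c.map (|·|)).Nodup)
    (h : (c.map (|·|)).toFinset = L) :
    ((c.map (oddExt (rank L))).map (|·|)).Nodup ∧
      ((c.map (oddExt (rank L))).map (|·|)).toFinset = Finset.Icc 1 (L.card : ℤ) := by
  rw [← h, ← wordB_stB hc]
  refine ⟨nodup_wordB _, ?_⟩
  rw [toFinset_wordB, List.toFinset_card_of_nodup hc, List.length_map]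
  rfl

/-- Sums over permutations as sums over words with an arbitrary set of letters. -/
theorem sum_symGrp_eq {N : ℕ} (P : SymGrp N → Prop) [DecidablePred P] (L : Finset ℤ)
    (hL : L.card = N) (C : Finset (List ℤ)) (hC : ∀ c ∈ C, c.Nodup ∧ c.toFinset = L)
    (hP : ∀ w c, c.Nodup → c.toFinset = L → wordA w = c.map (rank L) → (P w ↔ c ∈ C)) :
    ∑ w : SymGrp N with P w, (bas ⟨N, w⟩ : ZS) = ∑ c ∈ C, sA c := by
  subst hL
  have hex : ∀ w : SymGrp L.card, ∃ c : List ℤ, c.Nodup ∧ c.toFinset = L ∧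
      c.map (rank L) = wordA w :=
    fun w => exists_map_rank L (nodup_wordA w) (toFinset_wordA w)
  choose c hc1 hc2 hc3 using hex
  refine Finset.sum_bij (fun w _ => c w) ?_ ?_ ?_ ?_
  · intro w hw
    exact (hP w (c w) (hc1 w) (hc2 w) (hc3 w).symm).1 (Finset.mem_filter.1 hw).2
  · intro w _ v _ hwv
    have : wordA w = wordA v := by rw [← hc3, ← hc3, hwv]
    have := wordA_injective (u := ⟨_, w⟩) (v := ⟨_, v⟩) this
    simpa using this
  · intro b hb
    obtain ⟨h1, h2⟩ := hC b hb
    obtain ⟨w, hw⟩ := exists_wordA (map_rank_eq h1 h2).1 (map_rank_eq h1 h2).2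
    refine ⟨w, Finset.mem_filter.2 ⟨Finset.mem_univ _, (hP w b h1 h2 hw).2 hb⟩, ?_⟩
    refine list_map_injOn (f := rank L) (fun x hx y hy h => rank_injOn ?_ ?_ h) ?_
    · rw [← hc2 w]; exact List.mem_toFinset.2 hx
    · rw [← h2]; exact List.mem_toFinset.2 hy
    · rw [hc3, hw]
  · intro w _
    rw [sA]
    congr 1
    apply wordA_injective
    rw [wordA_stA (hc1 w), hc2, hc3]

/-- Sums over signed permutations as sums over words with an arbitrary set of absolute values. -/
theorem sum_hypGrp_eq {N : ℕ} (P : HypGrp N → Prop) [DecidablePred P] (L : Finset ℤ)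
    (hpos : ∀ z ∈ L, 0 < z)
    (hL : L.card = N) (C : Finset (List ℤ))
    (hC : ∀ c ∈ C, (c.map (|·|)).Nodup ∧ (c.map (|·|)).toFinset = L)
    (hP : ∀ w c, (c.map (|·|)).Nodup → (c.map (|·|)).toFinset = L →
      wordB w = c.map (oddExt (rank L)) → (P w ↔ c ∈ C)) :
    ∑ w : HypGrp N with P w, (bas ⟨N, w⟩ : ZB) = ∑ c ∈ C, sB c := by
  subst hL
  have hex : ∀ w : HypGrp L.card, ∃ c : List ℤ, (c.map (|·|)).Nodup ∧ (c.map (|·|)).toFinset = L ∧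
      c.map (oddExt (rank L)) = wordB w :=
    fun w => exists_map_oddExt_rank hpos (nodup_wordB w) (toFinset_wordB w)
  choose c hc1 hc2 hc3 using hex
  refine Finset.sum_bij (fun w _ => c w) ?_ ?_ ?_ ?_
  · intro w hw
    exact (hP w (c w) (hc1 w) (hc2 w) (hc3 w).symm).1 (Finset.mem_filter.1 hw).2
  · intro w _ v _ hwv
    have : wordB w = wordB v := by rw [← hc3, ← hc3, hwv]
    have := wordB_injective (u := ⟨_, w⟩) (v := ⟨_, v⟩) this
    simpa using this
  · intro b hb
    obtain ⟨h1, h2⟩ := hC b hb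
    obtain ⟨w, hw⟩ := exists_wordB (map_oddExt_rank_eq h1 h2).1 (map_oddExt_rank_eq h1 h2).2
    refine ⟨w, Finset.mem_filter.2 ⟨Finset.mem_univ _, (hP w b h1 h2 hw).2 hb⟩, ?_⟩
    have e : (c w).map (oddExt (rank L)) = b.map (oddExt (rank L)) := by rw [hc3, hw]
    have hx' : ∀ x ∈ c w, |x| ∈ L := fun x hx => by
      rw [← hc2 w]; exact List.mem_toFinset.2 (List.mem_map_of_mem hx)
    have hy' : ∀ x ∈ b, |x| ∈ L := fun x hx => by
      rw [← h2]; exact List.mem_toFinset.2 (List.mem_map_of_mem hx)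
    refine list_map_injOn (f := oddExt (rank L)) (fun x hx y hy h => ?_) e
    have hxp := rank_pos (hx' x hx)
    have hyp := rank_pos (hy' y hy)
    have habs : |x| = |y| := by
      apply rank_injOn (hx' x hx) (hy' y hy)
      rw [← abs_oddExt hxp, h, abs_oddExt hyp]
    have hs : x < 0 ↔ y < 0 := by rw [← oddExt_neg_iff hxp, h, oddExt_neg_iff hyp]
    rcases abs_cases x with ⟨h3, h4⟩ | ⟨h3, h4⟩ <;> rcases abs_cases y with ⟨h5, h6⟩ | ⟨h5, h6⟩ <;>
      omega
  · intro w _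
    rw [sB]
    congr 1
    apply wordB_injective
    rw [wordB_stB (hc1 w), hc2, hc3]

theorem rank_union_right {X Y : Finset ℤ} {t y : ℤ} (hX : ∀ x ∈ X, x < t) (hY : ∀ y ∈ Y, t ≤ y)
    (hy : y ∈ Y) : rank (X ∪ Y) y = X.card + rank Y y := by
  unfold rank
  rw [Finset.filter_union, Finset.filter_true_of_mem (s := X)
    fun x hx => ((hX x hx).trans_le (hY y hy)).le, Finset.card_union_of_disjoint]
  · push_cast; rfl
  · rw [Finset.disjoint_left]
    intro z hz hz'
    have := hX z hz
    have := hY z (Finset.mem_filter.1 hz').1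
    omega

/-- The elements less than `t` are those of rank at most the number of such elements. -/
theorem rank_union_cases {X Y : Finset ℤ} {t z : ℤ} (hX : ∀ x ∈ X, x < t) (hY : ∀ y ∈ Y, t ≤ y)
    (hz : z ∈ X ∪ Y) :
    (1 ≤ rank (X ∪ Y) z ∧ rank (X ∪ Y) z ≤ X.card ↔ z < t) ∧
      (X.card + 1 ≤ rank (X ∪ Y) z ∧ rank (X ∪ Y) z ≤ X.card + Y.card ↔ t ≤ z) := by
  rcases Finset.mem_union.1 hz with h | h
  · have h1 := hX z h
    rw [rank_union_left fun y hy => h1.trans_le (hY y hy)]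
    have := rank_pos h
    have := rank_le X z
    omega
  · have h1 := hY z h
    rw [rank_union_right hX hY h]
    have := rank_pos h
    have := rank_le Y z
    omega

theorem rank_strictMonoOn (L : Finset ℤ) : StrictMonoOn (rank L) L :=
  fun _ _ _ hy h => rank_lt hy h

theorem mem_lo {t : ℤ} {c : List ℤ} {z : ℤ} : z ∈ lo t c ↔ z ∈ c ∧ z < t := by simp [lo]

theorem mem_hi {t : ℤ} {c : List ℤ} {z : ℤ} : z ∈ hi t c ↔ z ∈ c ∧ t ≤ z := by simp [hi]

theorem mem_loB {t : ℤ} {c : List ℤ} {z : ℤ} : z ∈ loB t c ↔ z ∈ c ∧ |z| < t := by simp [loB]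

theorem mem_hiB {t : ℤ} {c : List ℤ} {z : ℤ} : z ∈ hiB t c ↔ z ∈ c ∧ t ≤ |z| := by simp [hiB]

theorem mem_hat {c : List ℤ} {z : ℤ} : z ∈ hat c ↔ ∃ x ∈ c, |x| = z := by
  rw [(hat_perm c).mem_iff, List.mem_map]

theorem toFinset_card_nodup {c : List ℤ} (h : c.Nodup) : c.toFinset.card = c.length :=
  List.toFinset_card_of_nodup h

theorem shuffleS_mul_bas (u v : Σ n, SymGrp n) : shuffleS.mul (bas u) (bas v) =
    ∑ w : SymGrp (u.1 + v.1) with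
    restrictTo (wordA w) 1 u.1 = wordA u.2 ∧
      stA (restrictTo (wordA w) (u.1 + 1) (u.1 + v.1)) = v, bas ⟨u.1 + v.1, w⟩ :=
  bilin_bas _ u v

theorem shuffleB_act_bas (u : Σ n, HypGrp n) (v : Σ n, SymGrp n) :
    shuffleB.act (bas u) (bas v) =
    ∑ w : HypGrp (u.1 + v.1) with
    restrictTo (wordB w) 1 u.1 = wordB u.2 ∧
      stA (restrictTo (hat (wordB w)) (u.1 + 1) (u.1 + v.1)) = v, bas ⟨u.1 + v.1, w⟩ :=
  bilin_bas _ u v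

theorem disjoint_of_lt {X Y : Finset ℤ} {t : ℤ} (hX : ∀ x ∈ X, x < t) (hY : ∀ y ∈ Y, t ≤ y) :
    Disjoint X Y := by
  rw [Finset.disjoint_left]
  intro z hz hz'
  have := hX z hz
  have := hY z hz'
  omega

/-- Relabel the permutations in the product by the union of the letters of x and y. As all letters
of x are smaller, the values in [1,m] and in [m+1,m+n] become the letters below t and those from t
on, and the two standardization conditions become equalities of words. -/
theorem shuffleS_mul_sA {t : ℤ} {x y : List ℤ} (hx : x.Nodup) (hy : y.Nodup)
    (hxt : ∀ z ∈ x, z < t) (hyt : ∀ z ∈ y, t ≤ z) :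
    shuffleS.mul (sA x) (sA y) = ∑ c ∈ famA t x y, sA c := by
  have hX : ∀ z ∈ x.toFinset, z < t := by simpa using hxt
  have hY : ∀ z ∈ y.toFinset, t ≤ z := by simpa using hyt
  rw [sA, sA, shuffleS_mul_bas]
  refine sum_symGrp_eq _ (x.toFinset ∪ y.toFinset) ?_ _ ?_ ?_
  · rw [Finset.card_union_of_disjoint (disjoint_of_lt hX hY), toFinset_card_nodup hx,
      toFinset_card_nodup hy]
    rfl
  · intro c hc
    rw [mem_famA] at hc
    obtain ⟨rfl, rfl⟩ := hc
    have := perm_lo_hi t c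
    rw [← List.toFinset_append, List.toFinset_eq_of_perm _ _ this, ← this.nodup_iff]
    refine ⟨List.nodup_append'.2 ⟨hx, hy, fun z hz hz' => ?_⟩, rfl⟩
    have := hxt z hz
    have := hyt z hz'
    omega
  · intro w c hc hcL hw
    have hcases := fun z (hz : z ∈ c) => rank_union_cases (z := z) hX hY
      (hcL ▸ List.mem_toFinset.2 hz)
    rw [mem_famA, hw, restrictTo, restrictTo, List.filter_map, List.filter_map]
    -- A letter has rank at most the length of x exactly when it is below t; this is
    -- `rank_union_cases`.
    have e1 : c.filter ((fun x_1 => decide (((1 : ℕ) : ℤ) ≤ |x_1| ∧ |x_1| ≤ (stA x).1)) ∘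
        rank (x.toFinset ∪ y.toFinset)) = lo t c := by
      refine List.filter_congr fun z hz => ?_
      rw [Function.comp_apply, decide_eq_decide, ← (hcases z hz).1, toFinset_card_nodup hx,
        abs_of_pos (rank_pos (hcL ▸ List.mem_toFinset.2 hz))]
      simp
    have e2 : c.filter ((fun x_1 => decide ((((stA x).1 + 1 : ℕ) : ℤ) ≤ |x_1| ∧
        |x_1| ≤ (((stA x).1 + (stA y).1 : ℕ) : ℤ))) ∘
        rank (x.toFinset ∪ y.toFinset)) = hi t c := by
      refine List.filter_congr fun z hz => ?_
      rw [Function.comp_apply, decide_eq_decide, ← (hcases z hz).2, toFinset_card_nodup hx,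
        toFinset_card_nodup hy, abs_of_pos (rank_pos (hcL ▸ List.mem_toFinset.2 hz))]
      simp
    rw [e1, e2, wordA_stA hx]
    have e3 : x.map (rank x.toFinset) = x.map (rank (x.toFinset ∪ y.toFinset)) :=
      List.map_congr_left fun z hz =>
        (rank_union_left fun z' hz' => (hxt z hz).trans_le (hY z' hz')).symm
    have hmem : ∀ z ∈ c, z ∈ x.toFinset ∪ y.toFinset := fun z hz => hcL ▸ List.mem_toFinset.2 hz
    have hhi : (hi t c).Nodup := hc.filter _
    rw [e3, stA_map hhi ((rank_strictMonoOn _).mono fun z hz => hmem z (mem_hi.1 hz).1)]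
    refine and_congr ⟨fun h => ?_, fun h => by rw [h]⟩ ⟨fun h => ?_, fun h => by rw [h]⟩
    · refine list_map_injOn (fun z hz z' hz' hzz => rank_injOn (hmem z (mem_lo.1 hz).1) ?_ hzz) h
      exact Finset.mem_union_left _ (List.mem_toFinset.2 hz')
    · refine stA_injOn hhi hy ?_ h
      ext z
      rw [List.mem_toFinset, mem_hi, ← List.mem_toFinset, hcL, Finset.mem_union]
      constructor
      · rintro ⟨h1 | h1, h2⟩
        · have := hX z h1; omega
        · exact h1
      · exact fun h1 => ⟨Or.inr h1, hY z h1⟩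

/-- The argument of `shuffleS_mul_sA` with letters compared by absolute value. It works because
`hat` commutes with sign-preserving relabelings and with selecting letters by absolute value. -/
theorem shuffleB_act_sB {t : ℤ} {x y : List ℤ} (hx : (x.map (|·|)).Nodup) (hy : y.Nodup)
    (hxt : ∀ z ∈ x, |z| < t) (hyt : ∀ z ∈ y, t ≤ z) (hx0 : ∀ z ∈ x, z ≠ 0) (ht : 0 < t) :
    shuffleB.act (sB x) (sA y) = ∑ c ∈ famB t x y, sB c := by
  have hX : ∀ z ∈ (x.map (|·|)).toFinset, z < t := by
    intro z hz
    obtain ⟨z, hz', rfl⟩ := List.mem_map.1 (List.mem_toFinset.1 hz)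
    exact hxt z hz'
  have hY : ∀ z ∈ y.toFinset, t ≤ z := by simpa using hyt
  rw [sA, sB, shuffleB_act_bas]
  refine sum_hypGrp_eq _ ((x.map (|·|)).toFinset ∪ y.toFinset) ?_ ?_ _ ?_ ?_
  · intro z hz
    rcases Finset.mem_union.1 hz with h | h
    · obtain ⟨z, hz', rfl⟩ := List.mem_map.1 (List.mem_toFinset.1 h)
      exact abs_pos.2 (hx0 z hz')
    · exact ht.trans_le (hY z h)
  · rw [Finset.card_union_of_disjoint (disjoint_of_lt hX hY), toFinset_card_nodup hx,
      toFinset_card_nodup hy, List.length_map]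
    rfl
  · intro c hc
    rw [mem_famB] at hc
    obtain ⟨rfl, rfl⟩ := hc
    have : ((loB t c).map (|·|) ++ hat (hiB t c)).Perm (c.map (|·|)) :=
      (List.Perm.append_left _ (hat_perm _)).trans
        (by rw [← List.map_append]; exact (perm_loB_hiB t c).map _)
    rw [← List.toFinset_append, List.toFinset_eq_of_perm _ _ this, ← this.nodup_iff]
    refine ⟨List.nodup_append'.2 ⟨hx, hy, fun z hz hz' => ?_⟩, rfl⟩
    have := hX z (List.mem_toFinset.2 hz)
    have := hyt z hz'
    omega
  · intro w c hc hcL hw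
    have hmem : ∀ z ∈ c, |z| ∈ (x.map (|·|)).toFinset ∪ y.toFinset :=
      fun z hz => hcL ▸ List.mem_toFinset.2 (List.mem_map_of_mem hz)
    have hcases := fun z (hz : z ∈ c) => rank_union_cases hX hY (hmem z hz)
    have hpos := fun z (hz : z ∈ c) => rank_pos (hmem z hz)
    rw [mem_famB, hw, restrictTo, restrictTo, hat_map_oddExt hpos, List.filter_map,
      List.filter_map]
    have e1 : c.filter ((fun x_1 => decide (((1 : ℕ) : ℤ) ≤ |x_1| ∧ |x_1| ≤ (stB x).1)) ∘
        oddExt (rank ((x.map (|·|)).toFinset ∪ y.toFinset))) = loB t c := by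
      refine List.filter_congr fun z hz => ?_
      rw [Function.comp_apply, decide_eq_decide, ← (hcases z hz).1, toFinset_card_nodup hx,
        abs_oddExt (hpos z hz), List.length_map]
      simp
    have e2 : (hat c).filter ((fun x_1 => decide ((((stB x).1 + 1 : ℕ) : ℤ) ≤ |x_1| ∧
        |x_1| ≤ (((stB x).1 + (stA y).1 : ℕ) : ℤ))) ∘
        rank ((x.map (|·|)).toFinset ∪ y.toFinset)) = hat (hiB t c) := by
      rw [hiB, ← hat_filter_abs c fun z => decide (t ≤ z)]
      refine List.filter_congr fun z hz => ?_
      obtain ⟨z, hz', rfl⟩ := mem_hat.1 hz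
      rw [Function.comp_apply, decide_eq_decide, ← (hcases z hz').2, toFinset_card_nodup hx,
        toFinset_card_nodup hy, abs_of_pos (hpos z hz'), List.length_map]
      simp
    rw [e1, e2, wordB_stB hx]
    have e3 : x.map (oddExt (rank (x.map (|·|)).toFinset)) =
        x.map (oddExt (rank ((x.map (|·|)).toFinset ∪ y.toFinset))) := by
      refine List.map_congr_left fun z hz => ?_
      rw [oddExt, oddExt, rank_union_left fun z' hz' => (hxt z hz).trans_le (hY z' hz')]
    have hhi : (hat (hiB t c)).Nodup :=
      (hat_perm _).nodup_iff.2 (hc.sublist ((List.filter_sublist).map _))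
    have hmem' : ∀ z ∈ hat (hiB t c), z ∈ (x.map (|·|)).toFinset ∪ y.toFinset ∧ t ≤ z := by
      intro z hz
      obtain ⟨z, hz', rfl⟩ := mem_hat.1 hz
      rw [mem_hiB] at hz'
      exact ⟨hmem z hz'.1, hz'.2⟩
    rw [e3, stA_map hhi ((rank_strictMonoOn _).mono fun z hz => (hmem' z hz).1)]
    refine and_congr ⟨fun h => ?_, fun h => by rw [h]⟩ ⟨fun h => ?_, fun h => by rw [h]⟩
    · refine list_map_injOn (fun z hz z' hz' hzz => ?_) h
      have h1 := hmem z (mem_loB.1 hz).1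
      have h2 : |z'| ∈ (x.map (|·|)).toFinset ∪ y.toFinset :=
        Finset.mem_union_left _ (List.mem_toFinset.2 (List.mem_map_of_mem hz'))
      have habs : |z| = |z'| := by
        apply rank_injOn h1 h2
        rw [← abs_oddExt (rank_pos h1), hzz, abs_oddExt (rank_pos h2)]
      have hs : z < 0 ↔ z' < 0 := by
        rw [← oddExt_neg_iff (rank_pos h1), hzz, oddExt_neg_iff (rank_pos h2)]
      rcases abs_cases z with ⟨h3, h4⟩ | ⟨h3, h4⟩ <;>
        rcases abs_cases z' with ⟨h5, h6⟩ | ⟨h5, h6⟩ <;> omega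
    · refine stA_injOn hhi hy ?_ h
      ext z
      rw [List.mem_toFinset]
      constructor
      · intro hz
        obtain ⟨h1, h2⟩ := hmem' z hz
        rcases Finset.mem_union.1 h1 with h1 | h1
        · have := hX z h1; omega
        · exact h1
      · intro hz
        have : z ∈ (c.map (|·|)).toFinset := hcL ▸ Finset.mem_union_right _ hz
        obtain ⟨a, ha, rfl⟩ := List.mem_map.1 (List.mem_toFinset.1 this)
        exact mem_hat.2 ⟨a, mem_hiB.2 ⟨ha, hY _ hz⟩, rfl⟩

end Std

/-! ## Inversion -/

section Inversion

/-- The extension of `w⁻¹` to an odd function on the integers. -/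
def invFun {n : ℕ} (w : HypGrp n) : ℤ → ℤ :=
  oddExt fun k => (wordB w⁻¹).getD (k.toNat - 1) 0

theorem getD_wordB {n : ℕ} (w : HypGrp n) (i : Fin n) :
    (wordB w).getD i 0 = PM.val (w.1 (i, false)) := by
  rw [List.getD_eq_getElem _ _ (by simp)]
  simp [wordB]

theorem invFun_apply {n : ℕ} (w : HypGrp n) (i : Fin n) :
    invFun w (PM.val (w.1 (i, false))) = (i : ℤ) + 1 := by
  rcases h : w.1 (i, false) with ⟨k, ε⟩
  have hk : w⁻¹.1 (k, false) = (i, ε) := by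
    have h0 : ∀ b, w⁻¹.1 (w.1 (i, b)) = (i, b) := fun b => w.1.symm_apply_apply _
    cases ε
    · rw [← h, h0]
    · have := h0 true
      rw [HypGrp.apply_true, h] at this
      simpa [PM.neg] using this
  have habs := PM.abs_val (k, ε)
  have hget : (wordB w⁻¹).getD ((|PM.val (k, ε)|).toNat - 1) 0 = PM.val (i, ε) := by
    have : (|PM.val (k, ε)|).toNat - 1 = (k : ℕ) := by rw [habs]; simp
    rw [this, getD_wordB, hk]
  rw [invFun]
  cases ε
  · rw [oddExt_of_nonneg _ (by simp [PM.val]; omega), hget]; simp [PM.val]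
  · rw [oddExt_of_neg _ (by simp [PM.val]; omega), hget]; simp [PM.val]

theorem oddExt_neg (f : ℤ → ℤ) {x : ℤ} (hx : x ≠ 0) : oddExt f (-x) = -oddExt f x := by
  rcases lt_or_gt_of_ne hx with h | h
  · rw [oddExt_of_neg _ h, oddExt_of_nonneg _ (by omega), abs_neg, neg_neg]
  · rw [oddExt_of_nonneg _ (by omega : ¬x < 0), oddExt_of_neg _ (by omega), abs_neg]

theorem invFun_pos {n : ℕ} (w : HypGrp n) {x : ℤ} (hx : x ∈ wordB w) : 0 < invFun w x := by
  obtain ⟨i, rfl⟩ := List.mem_ofFn.1 hx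
  rw [invFun_apply]
  omega

theorem invFun_pairwise {n : ℕ} (w : HypGrp n) :
    (wordB w).Pairwise fun x y => invFun w x < invFun w y := by
  rw [wordB, List.pairwise_ofFn]
  intro i j hij
  rw [invFun_apply, invFun_apply]
  have : (i : ℕ) < j := hij
  omega

/-- For each k in [1,n] exactly one of k and -k is a letter of the window, and it is the one at
which w⁻¹ is positive. -/
theorem mem_wordB_iff {n : ℕ} (w : HypGrp n) {x : ℤ} :
    x ∈ wordB w ↔ (1 ≤ |x| ∧ |x| ≤ n) ∧ 0 < invFun w x := by
  refine ⟨fun h => ⟨mem_wordB h, invFun_pos w h⟩, fun ⟨h, hpos⟩ => ?_⟩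
  have : |x| ∈ ((wordB w).map (|·|)).toFinset := by
    rw [toFinset_wordB, Finset.mem_Icc]; exact h
  obtain ⟨z, hz, hzx⟩ := List.mem_map.1 (List.mem_toFinset.1 this)
  rcases abs_eq_abs.1 hzx with rfl | rfl
  · exact hz
  · have h1 := invFun_pos w hz
    rw [invFun, oddExt_neg _ (by rintro rfl; simp at h)] at h1
    rw [invFun] at hpos
    omega

/-- The reason for the definition of `hat`: it lists 1, …, n by increasing value of w⁻¹. If -k
stands at position p, then w⁻¹(k) = -p, so the negative letters have to come first and from right to
left. -/
theorem hat_pairwise {n : ℕ} (w : HypGrp n) :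
    (hat (wordB w)).Pairwise fun x y => invFun w x < invFun w y := by
  have hneg : ∀ x ∈ wordB w, invFun w (-x) = -invFun w x := fun x hx =>
    oddExt_neg _ (by rintro rfl; have := mem_wordB hx; simp at this)
  rw [hat, List.pairwise_append]
  refine ⟨?_, (invFun_pairwise w).filter _, ?_⟩
  · rw [List.pairwise_map, List.pairwise_reverse]
    refine ((invFun_pairwise w).filter _).imp_of_mem fun {a b} ha hb h => ?_
    rw [hneg a (List.mem_filter.1 ha).1, hneg b (List.mem_filter.1 hb).1]
    omega
  · intro a ha b hb
    obtain ⟨x, hx, rfl⟩ := List.mem_map.1 ha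
    have hx := (List.mem_filter.1 (List.mem_reverse.1 hx)).1
    have h1 := invFun_pos w hx
    have h2 := invFun_pos w (List.mem_filter.1 hb).1
    rw [hneg x hx]
    omega

theorem length_segment {c : List ℤ} {i j : ℕ} (hj : j ≤ c.length) :
    (segment c i j).length = j - i := by
  simp [segment, hj]

theorem nodup_wordB' {n : ℕ} (w : HypGrp n) : (wordB w).Nodup := List.Nodup.of_map _ (nodup_wordB w)

/-- The letters i+1, …, j appear in `hat` sorted by their values under w⁻¹, and these values form a
segment of the word of w⁻¹. Sorting and ranking the same values are inverse operations. -/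
theorem stA_restrictTo_hat {n : ℕ} (w : HypGrp n) {i j : ℕ} (hij : i ≤ j) (hj : j ≤ n) :
    stA (restrictTo (hat (wordB w)) (i + 1) j) = invS (stA (segment (wordB w⁻¹) i j)) := by
  set h := restrictTo (hat (wordB w)) (i + 1) j with hh
  set seg := segment (wordB w⁻¹) i j with hseg
  have hlen : seg.length = j - i := length_segment (by simpa using hj)
  have hsn : seg.Nodup := (nodup_wordB' w⁻¹).sublist
    ((List.drop_sublist _ _).trans (List.take_sublist _ _))
  let p : SymGrp seg.length := (stA seg).2
  have hp : ∀ a : Fin seg.length, ((p a : ℕ) : ℤ) + 1 = rank seg.toFinset (seg.get a) := by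
    intro a
    have h1 : wordA p = seg.map (rank seg.toFinset) := wordA_stA hsn
    have h2 := congrArg (fun l => l.getD a 0) h1
    simpa [wordA] using h2
  have hU : ∀ a : Fin seg.length, invFun w ((a : ℤ) + 1 + i) = seg.get a := by
    intro a
    have ha := a.2
    rw [invFun, oddExt_of_nonneg _ (by omega), abs_of_pos (by omega)]
    have : ((a : ℤ) + 1 + i).toNat - 1 = i + a := by omega
    rw [this, List.getD_eq_getElem _ _ (by simp; omega)]
    simp [hseg, segment]
  -- Both words consist of the letters i+1, …, j, and both are strictly sorted by `invFun w`; such a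
  -- word is unique.
  have key : h = (wordA p⁻¹).map (fun x : ℤ => x + (i : ℤ)) := by
    refine List.Perm.eq_of_pairwise (le := fun x y => invFun w x < invFun w y) ?_ ?_ ?_ ?_
    · intro a b _ _ h1 h2
      exact absurd h1 (lt_asymm h2)
    · exact (hat_pairwise w).filter _
    · rw [List.pairwise_map, wordA, List.pairwise_ofFn]
      intro a b hab
      rw [hU, hU, ← rank_lt_iff (L := seg.toFinset) (by simp) (by simp), ← hp, ← hp]
      simpa using hab
    · apply List.perm_of_nodup_nodup_toFinset_eq
      · exact ((hat_perm _).nodup_iff.2 (nodup_wordB w)).filter _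
      · exact (nodup_wordA _).map (add_left_injective _)
      · ext x
        simp only [hh, restrictTo, List.mem_toFinset, List.mem_filter, mem_hat, List.mem_map,
          decide_eq_true_eq, mem_wordA, hlen]
        constructor
        · rintro ⟨⟨z, _, rfl⟩, hz⟩
          rw [abs_abs] at hz
          exact ⟨|z| - i, by omega, by omega⟩
        · rintro ⟨z, hz, rfl⟩
          have : z + i ∈ ((wordB w).map (|·|)).toFinset := by
            rw [toFinset_wordB, Finset.mem_Icc]; omega
          refine ⟨by simpa using this, ?_⟩
          rw [abs_of_pos (by omega)]
          omega
  rw [key, stA_map (nodup_wordA _) (fun a _ b _ hab => by simpa using hab), stA_wordA]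
  rfl

theorem oddExt_rank_strictMonoOn (L : Finset ℤ) :
    StrictMonoOn (oddExt (rank L)) {y | |y| ∈ L} := by
  intro a ha b hb hab
  have ha : |a| ∈ L := ha
  have hb : |b| ∈ L := hb
  have ha' := rank_pos ha
  have hb' := rank_pos hb
  by_cases h1 : a < 0 <;> by_cases h2 : b < 0
  · rw [oddExt_of_neg _ h1, oddExt_of_neg _ h2]
    have := rank_lt ha (x := |b|) (by rw [abs_of_neg h1, abs_of_neg h2]; omega)
    omega
  · rw [oddExt_of_neg _ h1, oddExt_of_nonneg _ h2]; omega
  · omega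
  · rw [oddExt_of_nonneg _ h1, oddExt_of_nonneg _ h2]
    exact rank_lt hb (by rw [abs_of_nonneg (not_lt.1 h1), abs_of_nonneg (not_lt.1 h2)]; omega)

/-- The same sorting argument with signs. On the letters of absolute value at most i, the inverse of
the signed standardization has the same signs as w⁻¹ and orders these letters in the same way. -/
theorem restrictTo_eq_wordB {n : ℕ} (w : HypGrp n) {i : ℕ} (hi : i ≤ n) :
    restrictTo (wordB w) 1 i = wordB (invS (stB (segment (wordB w⁻¹) 0 i))).2 := by
  set seg := segment (wordB w⁻¹) 0 i with hseg
  have hlen : seg.length = i := by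
    have := length_segment (c := wordB w⁻¹) (i := 0) (j := i) (by simpa using hi)
    simpa using this
  have hsn : (seg.map (|·|)).Nodup := (nodup_wordB w⁻¹).sublist
    (((List.drop_sublist _ _).trans (List.take_sublist _ _)).map _)
  let q : HypGrp seg.length := (stB seg).2
  change _ = wordB q⁻¹
  have hq : wordB q = seg.map (oddExt (rank (seg.map (|·|)).toFinset)) := wordB_stB hsn
  have hU : ∀ x : ℤ, 1 ≤ |x| → |x| ≤ i →
      ∃ y, |y| ∈ (seg.map (|·|)).toFinset ∧ invFun w |x| = y ∧
        invFun q⁻¹ |x| = oddExt (rank (seg.map (|·|)).toFinset) y := by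
    intro x h1 h2
    have hb : (|x|).toNat - 1 < seg.length := by omega
    refine ⟨seg[(|x|).toNat - 1], ?_, ?_, ?_⟩
    · rw [List.mem_toFinset]
      exact List.mem_map_of_mem (List.getElem_mem hb)
    · rw [invFun, oddExt_of_nonneg _ (by omega), abs_abs,
        List.getD_eq_getElem _ _ (by simp; omega)]
      simp [hseg, segment]
    · rw [invFun, oddExt_of_nonneg _ (by omega), abs_abs, inv_inv, hq,
        List.getD_eq_getElem _ _ (by simpa using hb)]
      simp
  have hmono := oddExt_rank_strictMonoOn (seg.map (|·|)).toFinset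
  -- Extension of `hU` to negative arguments: all functions involved are odd away from 0, and
  -- neither x nor its image y is 0.
  have hU' : ∀ x : ℤ, 1 ≤ |x| → |x| ≤ i →
      ∃ y, |y| ∈ (seg.map (|·|)).toFinset ∧ invFun w x = y ∧
        invFun q⁻¹ x = oddExt (rank (seg.map (|·|)).toFinset) y := by
    intro x h1 h2
    obtain ⟨y, hy, h3, h4⟩ := hU x h1 h2
    have hy0 : y ≠ 0 := by
      rintro rfl
      obtain ⟨z, hz, hz0⟩ := List.mem_map.1 (List.mem_toFinset.1 hy)
      have := mem_wordB (((List.drop_sublist _ _).trans (List.take_sublist _ _)).subset hz)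
      simp at hz0
      subst hz0
      simp at this
    have hx0 : x ≠ 0 := by rintro rfl; simp at h1
    rcases abs_choice x with h | h
    · rw [h] at h3 h4; exact ⟨y, hy, h3, h4⟩
    · rw [h, invFun, oddExt_neg _ hx0] at h3 h4
      refine ⟨-y, by rwa [abs_neg], by rw [invFun]; omega, ?_⟩
      rw [oddExt_neg _ hy0, ← h4, neg_neg, invFun]
  have hpos : ∀ x : ℤ, 1 ≤ |x| → |x| ≤ i → (0 < invFun w x ↔ 0 < invFun q⁻¹ x) := by
    intro x h1 h2
    obtain ⟨y, hy, h3, h4⟩ := hU' x h1 h2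
    have hy1 := rank_pos hy
    have hy0 : y ≠ 0 := by
      rintro rfl
      obtain ⟨z, hz, hz0⟩ := List.mem_map.1 (List.mem_toFinset.1 hy)
      have := mem_wordB (((List.drop_sublist _ _).trans (List.take_sublist _ _)).subset hz)
      simp at hz0
      subst hz0
      simp at this
    rw [h3, h4]
    by_cases hy2 : y < 0
    · rw [oddExt_of_neg _ hy2]; omega
    · rw [oddExt_of_nonneg _ hy2]; omega
  have hin : ∀ x, x ∈ restrictTo (wordB w) 1 i ↔ (1 ≤ |x| ∧ |x| ≤ i) ∧ 0 < invFun w x := by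
    intro x
    rw [restrictTo, List.mem_filter, mem_wordB_iff, decide_eq_true_eq]
    constructor
    · rintro ⟨⟨_, h⟩, h'⟩; exact ⟨by simpa using h', h⟩
    · rintro ⟨h, h'⟩; exact ⟨⟨by omega, h'⟩, by simpa using h⟩
  have hin' : ∀ x, x ∈ wordB q⁻¹ ↔ (1 ≤ |x| ∧ |x| ≤ i) ∧ 0 < invFun w x := by
    intro x
    rw [mem_wordB_iff]
    have hl : (seg.length : ℤ) = i := by exact_mod_cast hlen
    simp only [hl]
    exact and_congr_right fun h => (hpos x h.1 h.2).symm
  -- Both words contain exactly the x with 1 ≤ |x| ≤ i and w⁻¹(x) > 0, in increasing order of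
  -- w⁻¹(x).
  refine List.Perm.eq_of_pairwise (le := fun x y => invFun w x < invFun w y) ?_ ?_ ?_ ?_
  · intro a b _ _ h1 h2
    exact absurd h1 (lt_asymm h2)
  · exact (invFun_pairwise w).filter _
  · refine (invFun_pairwise q⁻¹).imp_of_mem fun {a b} ha hb hab => ?_
    obtain ⟨y, hy, h1, h2⟩ := hU' a ((hin' a).1 ha).1.1 ((hin' a).1 ha).1.2
    obtain ⟨z, hz, h3, h4⟩ := hU' b ((hin' b).1 hb).1.1 ((hin' b).1 hb).1.2
    rw [h1, h3]
    rw [h2, h4] at hab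
    exact (hmono.lt_iff_lt hy hz).1 hab
  · apply List.perm_of_nodup_nodup_toFinset_eq
    · exact (nodup_wordB' w).filter _
    · exact nodup_wordB' _
    · ext x
      rw [List.mem_toFinset, List.mem_toFinset, hin, hin']

theorem stB_restrictTo {n : ℕ} (w : HypGrp n) {i : ℕ} (hi : i ≤ n) :
    stB (restrictTo (wordB w) 1 i) = invS (stB (segment (wordB w⁻¹) 0 i)) := by
  rw [restrictTo_eq_wordB w hi, stB_wordB']

/-- The action is defined by an equality of words, whereas inversion and duality compare
standardizations; for initial intervals of values the two conditions agree. -/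
theorem restrictTo_wordB_eq_iff {n : ℕ} (w : HypGrp n) (u : Σ n, HypGrp n) (hi : u.1 ≤ n) :
    restrictTo (wordB w) 1 u.1 = wordB u.2 ↔ stB (restrictTo (wordB w) 1 u.1) = u := by
  constructor
  · intro h; rw [h, stB_wordB']
  · intro h
    rw [restrictTo_eq_wordB w hi, ← stB_restrictTo w hi, h]

/-- A permutation as a signed permutation without signs. -/
def posB {n : ℕ} (w : SymGrp n) : HypGrp n := mkSigned w fun _ => false

theorem wordB_posB {n : ℕ} (w : SymGrp n) : wordB (posB w) = wordA w := by
  rw [wordB, wordA]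
  congr 1

theorem posB_inv {n : ℕ} (w : SymGrp n) : (posB w)⁻¹ = posB w⁻¹ := by
  apply HypGrp.ext_of
  intro i
  rfl

theorem hat_wordA {n : ℕ} (w : SymGrp n) : hat (wordA w) = wordA w := by
  rw [hat, List.filter_eq_nil_iff.2, List.filter_eq_self.2]
  · simp
  · intro x hx; rw [mem_wordA] at hx; simp; omega
  · intro x hx; rw [mem_wordA] at hx; simp; omega

/-- The type B statement for a signed permutation without signs, where `hat` changes nothing. -/
theorem stA_restrictTo {n : ℕ} (w : SymGrp n) {i j : ℕ} (hij : i ≤ j) (hj : j ≤ n) :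
    stA (restrictTo (wordA w) (i + 1) j) = invS (stA (segment (wordA w⁻¹) i j)) := by
  have := stA_restrictTo_hat (posB w) hij hj
  rwa [posB_inv, wordB_posB, wordB_posB, hat_wordA] at this

theorem restrictTo_wordA_eq_iff {n : ℕ} (w : SymGrp n) (u : Σ n, SymGrp n) (hi : u.1 ≤ n) :
    restrictTo (wordA w) 1 u.1 = wordA u.2 ↔ stA (restrictTo (wordA w) 1 u.1) = u := by
  constructor
  · intro h; rw [h, stA_wordA']
  · intro h
    have h1 : (restrictTo (wordA w) 1 u.1).Nodup := (nodup_wordA w).filter _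
    have h2 : (restrictTo (wordA w) 1 u.1).toFinset = Finset.Icc 1 (u.1 : ℤ) := by
      ext x
      simp only [restrictTo, List.mem_toFinset, List.mem_filter, mem_wordA, decide_eq_true_eq,
        Finset.mem_Icc]
      constructor
      · rintro ⟨h3, h4⟩
        rw [abs_of_pos (by omega)] at h4
        omega
      · intro h3
        rw [abs_of_pos (by omega)]
        omega
    refine stA_injOn h1 (nodup_wordA _) ?_ (h.trans (stA_wordA' u).symm)
    rw [h2, toFinset_wordA]

end Inversion

/-! ## Structures given by words -/

section Words

theorem exists_bound (x : List ℤ) : ∃ t : ℤ, 0 < t ∧ ∀ z ∈ x, |z| < t := by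
  induction x with
  | nil => exact ⟨1, by simp, by simp⟩
  | cons a x ih =>
    obtain ⟨t, ht, h⟩ := ih
    refine ⟨max t (|a| + 1), lt_max_of_lt_left ht, fun z hz => ?_⟩
    rcases List.mem_cons.1 hz with rfl | hz
    · exact lt_max_of_lt_right (lt_add_one _)
    · exact lt_max_of_lt_left (h z hz)

theorem nodup_of_mem_famA {t : ℤ} {x y c : List ℤ} (hx : x.Nodup) (hy : y.Nodup)
    (h : c ∈ famA t x y) : c.Nodup := by
  rw [mem_famA] at h
  obtain ⟨rfl, rfl⟩ := h
  rw [← (perm_lo_hi t c).nodup_iff, List.nodup_append']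
  refine ⟨hx, hy, fun z hz hz' => ?_⟩
  rw [mem_lo] at hz
  rw [mem_hi] at hz'
  omega

theorem abs_nodup_of_mem_famB {t : ℤ} {x y c : List ℤ} (hx : (x.map (|·|)).Nodup) (hy : y.Nodup)
    (h : c ∈ famB t x y) : (c.map (|·|)).Nodup := by
  rw [mem_famB] at h
  obtain ⟨rfl, rfl⟩ := h
  rw [← ((perm_loB_hiB t c).map _).nodup_iff, List.map_append, List.nodup_append']
  refine ⟨hx, (hat_perm _).nodup_iff.1 hy, fun z hz hz' => ?_⟩
  obtain ⟨a, ha, rfl⟩ := List.mem_map.1 hz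
  obtain ⟨b, hb, hab⟩ := List.mem_map.1 hz'
  have h1 := (mem_loB.1 ha).2
  have h2 := (mem_hiB.1 hb).2
  have hab : |b| = |a| := hab
  omega

/-- The threefold shuffle is built in two steps. The bound `1 - t` separates the letters at most -t
from those of absolute value below t, and `t` separates both from the letters at least t. -/
theorem mem_famC_iff {t : ℤ} (ht : 0 < t) {x y z c : List ℤ} :
    c ∈ famC t x y z ↔ ∃ d ∈ famA (1 - t) y x, c ∈ famA t d z := by
  have h1 : lo (1 - t) (lo t c) = (hiB t c).filter fun a => decide (a < 0) := by
    rw [lo, lo, hiB, List.filter_filter, List.filter_filter]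
    refine List.filter_congr fun a _ => ?_
    rw [← Bool.decide_and, ← Bool.decide_and, decide_eq_decide]
    rcases abs_cases a with h | h <;> omega
  have h2 : hi (1 - t) (lo t c) = loB t c := by
    rw [hi, lo, loB, List.filter_filter]
    refine List.filter_congr fun a _ => ?_
    rw [← Bool.decide_and, decide_eq_decide]
    rcases abs_cases a with h | h <;> omega
  have h3 : hi t c = (hiB t c).filter fun a => decide (0 ≤ a) := by
    rw [hi, hiB, List.filter_filter]
    refine List.filter_congr fun a _ => ?_
    rw [← Bool.decide_and, decide_eq_decide]
    rcases abs_cases a with h | h <;> omega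
  simp only [mem_famC, mem_famA, ← h1, ← h2, ← h3]
  constructor
  · rintro ⟨h4, h5, h6⟩
    exact ⟨_, ⟨h5, h4⟩, rfl, h6⟩
  · rintro ⟨_, ⟨h4, h5⟩, rfl, h6⟩
    exact ⟨h5, h4, h6⟩

theorem sum_famC {N : Type} [AddCommMonoid N] {t : ℤ} (ht : 0 < t) (x y z : List ℤ)
    (F : List ℤ → N) :
    ∑ c ∈ famC t x y z, F c = ∑ d ∈ famA (1 - t) y x, ∑ c ∈ famA t d z, F c := by
  rw [← Finset.sum_biUnion]
  · refine Finset.sum_congr ?_ fun _ _ => rfl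
    ext c
    rw [mem_famC_iff ht, Finset.mem_biUnion]
  · intro d _ e _ hde
    rw [Function.onFun, Finset.disjoint_left]
    intro c hc hc'
    rw [mem_famA] at hc hc'
    exact hde (hc.1.symm.trans hc'.1)

variable {R : Type} [CommRing R] {M A : Type} [AddCommGroup M] [AddCommGroup A] [Module R M]
  [Module R A]

/-- The structure maps `H` are given on the elements `s c`, which span, by deconcatenation and
shuffling of words; `h n` is the value of `s` on increasing words of length `n`. -/
structure IsWordHopf (H : Ops R A) (s : List ℤ → A) (h : ℕ → A) : Prop where
  comul : ∀ c : List ℤ, c.Nodup → H.comul (s c) = ∑ p ∈ splits c, s p.1 ⊗ₜ[R] s p.2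
  mul : ∀ (t : ℤ) (x y : List ℤ), x.Nodup → y.Nodup → (∀ z ∈ x, z < t) → (∀ z ∈ y, t ≤ z) →
    H.mul (s x) (s y) = ∑ c ∈ famA t x y, s c
  counit : ∀ c, H.counit (s c) = if c = [] then 1 else 0
  one : H.one = s []
  map : ∀ (c : List ℤ) (k : ℤ), c.Nodup → s (c.map fun z => z + k) = s c
  inc : ∀ c : List ℤ, c.Pairwise (· < ·) → s c = h c.length
  span : ∀ a, a ∈ Submodule.span R (s '' {c | c.Nodup})

/-- The structure maps `T` are given on the elements `s c`, which span, by deconcatenation and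
signed shuffling of words. -/
structure IsWordMod (T : Act R M A) (s : List ℤ → A) (sM : List ℤ → M) : Prop where
  coact : ∀ c : List ℤ, (c.map (|·|)).Nodup → T.coact (sM c) = ∑ p ∈ splits c, sM p.1 ⊗ₜ[R] s p.2
  act : ∀ (t : ℤ) (x y : List ℤ), (x.map (|·|)).Nodup → y.Nodup → (∀ z ∈ x, |z| < t) →
    (∀ z ∈ y, t ≤ z) → (∀ z ∈ x, z ≠ 0) → 0 < t → T.act (sM x) (s y) = ∑ c ∈ famB t x y, sM c
  span : ∀ a, a ∈ Submodule.span R (sM '' {c | (c.map (|·|)).Nodup ∧ ∀ z ∈ c, z ≠ 0})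

variable {H : Ops R A} {s : List ℤ → A} {h : ℕ → A} {T : Act R M A} {sM : List ℤ → M}

theorem ext_span {N : Type} [AddCommGroup N] [Module R N] {K : Type} {Q : K → Prop} {s : K → M}
    (hs : ∀ a, a ∈ Submodule.span R (s '' {c | Q c})) {F G : M →ₗ[R] N}
    (hFG : ∀ c, Q c → F (s c) = G (s c)) (a : M) : F a = G a := by
  have : Submodule.span R (s '' {c | Q c}) ≤ LinearMap.eqLocus F G := by
    rw [Submodule.span_le]
    rintro _ ⟨c, hc, rfl⟩
    exact hFG c hc
  exact this (hs a)

theorem nodup_splits {c : List ℤ} (hc : c.Nodup) {p : List ℤ × List ℤ} (hp : p ∈ splits c) :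
    p.1.Nodup ∧ p.2.Nodup := by
  rw [mem_splits] at hp
  rw [← hp, List.nodup_append'] at hc
  exact ⟨hc.1, hc.2.1⟩

theorem abs_nodup_splits {c : List ℤ} (hc : (c.map (|·|)).Nodup) {p : List ℤ × List ℤ}
    (hp : p ∈ splits c) : (p.1.map (|·|)).Nodup ∧ (p.2.map (|·|)).Nodup := by
  rw [mem_splits] at hp
  rw [← hp, List.map_append, List.nodup_append'] at hc
  exact ⟨hc.1, hc.2.1⟩

theorem sum_splits_right_nil {N : Type} [AddCommMonoid N] (c : List ℤ)
    (F : List ℤ × List ℤ → N) (hF : ∀ p, p.2 ≠ [] → F p = 0) :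
    ∑ p ∈ splits c, F p = F (c, []) := by
  refine Finset.sum_eq_single_of_mem _ (by simp) fun p hp hne => hF p fun h0 => hne ?_
  rw [mem_splits, h0, List.append_nil] at hp
  exact Prod.ext hp h0

theorem sum_splits_left_nil {N : Type} [AddCommMonoid N] (c : List ℤ)
    (F : List ℤ × List ℤ → N) (hF : ∀ p, p.1 ≠ [] → F p = 0) :
    ∑ p ∈ splits c, F p = F ([], c) := by
  refine Finset.sum_eq_single_of_mem _ (by simp) fun p hp hne => hF p fun h0 => hne ?_
  rw [mem_splits, h0, List.nil_append] at hp
  exact Prod.ext h0 hp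

theorem IsWordMod.isComod (hT : IsWordMod T s sM) (hH : IsWordHopf H s h) : IsComod H T where
  coact_counit := by
    refine ext_span hT.span (F := (TensorProduct.rid R M).toLinearMap ∘ₗ
      H.counit.lTensor M ∘ₗ T.coact) (G := LinearMap.id) fun c hc => ?_
    simp only [LinearMap.comp_apply, hT.coact c hc.1, map_sum, LinearMap.lTensor_tmul, hH.counit]
    rw [sum_splits_right_nil]
    · simp
    · rintro ⟨p, q⟩ hq
      have hq : q ≠ [] := hq
      simp [hq]
  coact_coact := by
    refine ext_span hT.span (F := (TensorProduct.assoc R M A A).toLinearMap ∘ₗ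
      T.coact.rTensor A ∘ₗ T.coact) (G := H.comul.lTensor M ∘ₗ T.coact) fun c hc => ?_
    simp only [LinearMap.comp_apply, hT.coact c hc.1, map_sum, LinearMap.lTensor_tmul,
      LinearMap.rTensor_tmul]
    have e1 : ∀ p ∈ splits c, (TensorProduct.assoc R M A A).toLinearMap
        (T.coact (sM p.1) ⊗ₜ[R] s p.2) =
        ∑ q ∈ splits p.1, sM q.1 ⊗ₜ[R] (s q.2 ⊗ₜ[R] s p.2) := by
      intro p hp
      rw [hT.coact p.1 (abs_nodup_splits hc.1 hp).1, TensorProduct.sum_tmul, map_sum]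
      rfl
    have e2 : ∀ p ∈ splits c, sM p.1 ⊗ₜ[R] H.comul (s p.2) =
        ∑ q ∈ splits p.2, sM p.1 ⊗ₜ[R] (s q.1 ⊗ₜ[R] s q.2) := by
      intro p hp
      rw [hH.comul p.2 (abs_nodup_splits hc.1 hp).2.of_map, TensorProduct.tmul_sum]
    rw [Finset.sum_congr rfl e1, Finset.sum_congr rfl e2]
    exact sum_splits_splits c fun x y z => sM x ⊗ₜ[R] (s y ⊗ₜ[R] s z)

theorem IsWordHopf.isCoalg (hH : IsWordHopf H s h) : IsCoalg H where
  counit_left := by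
    refine ext_span hH.span (F := (TensorProduct.lid R A).toLinearMap ∘ₗ
      H.counit.rTensor A ∘ₗ H.comul) (G := LinearMap.id) fun c hc => ?_
    simp only [LinearMap.comp_apply, hH.comul c hc, map_sum, LinearMap.rTensor_tmul, hH.counit]
    rw [sum_splits_left_nil]
    · simp
    · rintro ⟨p, q⟩ hq
      have hq : p ≠ [] := hq
      simp [hq]
  counit_right := by
    refine ext_span hH.span (F := (TensorProduct.rid R A).toLinearMap ∘ₗ
      H.counit.lTensor A ∘ₗ H.comul) (G := LinearMap.id) fun c hc => ?_
    simp only [LinearMap.comp_apply, hH.comul c hc, map_sum, LinearMap.lTensor_tmul, hH.counit]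
    rw [sum_splits_right_nil]
    · simp
    · rintro ⟨p, q⟩ hq
      have hq : q ≠ [] := hq
      simp [hq]
  coassoc := by
    refine ext_span hH.span (F := (TensorProduct.assoc R A A A).toLinearMap ∘ₗ
      H.comul.rTensor A ∘ₗ H.comul) (G := H.comul.lTensor A ∘ₗ H.comul) fun c hc => ?_
    simp only [LinearMap.comp_apply, hH.comul c hc, map_sum, LinearMap.lTensor_tmul,
      LinearMap.rTensor_tmul]
    have e1 : ∀ p ∈ splits c, (TensorProduct.assoc R A A A).toLinearMap
        (H.comul (s p.1) ⊗ₜ[R] s p.2) =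
        ∑ q ∈ splits p.1, s q.1 ⊗ₜ[R] (s q.2 ⊗ₜ[R] s p.2) := by
      intro p hp
      rw [hH.comul p.1 (nodup_splits hc hp).1, TensorProduct.sum_tmul, map_sum]
      rfl
    have e2 : ∀ p ∈ splits c, s p.1 ⊗ₜ[R] H.comul (s p.2) =
        ∑ q ∈ splits p.2, s p.1 ⊗ₜ[R] (s q.1 ⊗ₜ[R] s q.2) := by
      intro p hp
      rw [hH.comul p.2 (nodup_splits hc hp).2, TensorProduct.tmul_sum]
    rw [Finset.sum_congr rfl e1, Finset.sum_congr rfl e2]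
    exact sum_splits_splits c fun x y z => s x ⊗ₜ[R] (s y ⊗ₜ[R] s z)

/-- The shuffle rule requires the letters of y to lie above those of x. A shift achieves this and
does not affect the standardization. -/
theorem exists_shift (t : ℤ) (y : List ℤ) : ∃ k : ℤ, ∀ z ∈ y.map (fun z => z + k), t ≤ z := by
  obtain ⟨b, _, hb⟩ := exists_bound y
  refine ⟨t + b, fun z hz => ?_⟩
  obtain ⟨a, ha, rfl⟩ := List.mem_map.1 hz
  have := hb a ha
  have := neg_abs_le a
  omega

theorem IsWordHopf.comul_mul_word (hH : IsWordHopf H s h) {t : ℤ} {x y : List ℤ} (hx : x.Nodup)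
    (hy : y.Nodup) (hxt : ∀ z ∈ x, z < t) (hyt : ∀ z ∈ y, t ≤ z) :
    H.comul (H.mul (s x) (s y)) =
      TensorProduct.map₂ H.mul H.mul (H.comul (s x)) (H.comul (s y)) := by
  rw [hH.mul t x y hx hy hxt hyt, map_sum, hH.comul x hx, hH.comul y hy,
    Finset.sum_congr rfl fun c hc => hH.comul c (nodup_of_mem_famA hx hy hc), sum_famA_splits,
    Finset.sum_product_right, map_sum]
  refine Finset.sum_congr rfl fun q hq => ?_
  rw [map_sum, LinearMap.sum_apply]
  refine Finset.sum_congr rfl fun p hp => ?_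
  have hp' := nodup_splits hx hp
  have hq' := nodup_splits hy hq
  rw [mem_splits] at hp hq
  rw [TensorProduct.map₂_apply_tmul, TensorProduct.map_tmul,
    hH.mul t p.1 q.1 hp'.1 hq'.1 (fun z hz => hxt z (by rw [← hp]; simp [hz]))
      (fun z hz => hyt z (by rw [← hq]; simp [hz])),
    hH.mul t p.2 q.2 hp'.2 hq'.2 (fun z hz => hxt z (by rw [← hp]; simp [hz]))
      (fun z hz => hyt z (by rw [← hq]; simp [hz])), TensorProduct.sum_tmul]
  simp only [TensorProduct.tmul_sum]

/-- The empty word is a shuffle of x and y only when both are empty. -/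
theorem IsWordHopf.mul_nil_iff (hH : IsWordHopf H s h) {t : ℤ} {x y : List ℤ} (hx : x.Nodup)
    (hy : y.Nodup) (hxt : ∀ z ∈ x, z < t) (hyt : ∀ z ∈ y, t ≤ z) :
    H.counit (H.mul (s x) (s y)) = H.counit (s x) * H.counit (s y) := by
  rw [hH.mul t x y hx hy hxt hyt, map_sum]
  simp only [hH.counit]
  rw [Finset.sum_ite_eq' (famA t x y) []]
  simp only [mem_famA, lo, hi, List.filter_nil, mul_ite, mul_one, mul_zero]
  by_cases h1 : x = [] <;> by_cases h2 : y = [] <;> simp [h1, h2, eq_comm]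

theorem IsWordHopf.isBi (hH : IsWordHopf H s h) : IsBi H where
  counit_one := by rw [hH.one, hH.counit, if_pos rfl]
  counit_mul a b := by
    have key : ∀ x y : List ℤ, x.Nodup → y.Nodup →
        H.counit (H.mul (s x) (s y)) = H.counit (s x) * H.counit (s y) := by
      intro x y hx hy
      obtain ⟨t, _, ht⟩ := exists_bound x
      obtain ⟨k, hk⟩ := exists_shift t y
      rw [← hH.map y k hy]
      exact hH.mul_nil_iff hx (hy.map (add_left_injective _))
        (fun z hz => (le_abs_self z).trans_lt (ht z hz)) hk
    refine ext_span hH.span (F := H.counit ∘ₗ H.mul a) (G := H.counit a • H.counit)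
      (fun y hy => ?_) b
    exact ext_span hH.span (F := H.counit ∘ₗ H.mul.flip (s y))
      (G := LinearMap.toSpanSingleton R R (H.counit (s y)) ∘ₗ H.counit)
      (fun x hx => key x y hx hy) a
  comul_one := by
    rw [hH.one, hH.comul _ List.nodup_nil, sum_splits]
    simp
  comul_mul a b := by
    have key : ∀ x y : List ℤ, x.Nodup → y.Nodup → H.comul (H.mul (s x) (s y)) =
        TensorProduct.map₂ H.mul H.mul (H.comul (s x)) (H.comul (s y)) := by
      intro x y hx hy
      obtain ⟨t, _, ht⟩ := exists_bound x
      obtain ⟨k, hk⟩ := exists_shift t y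
      rw [← hH.map y k hy]
      exact hH.comul_mul_word hx (hy.map (add_left_injective _))
        (fun z hz => (le_abs_self z).trans_lt (ht z hz)) hk
    refine ext_span hH.span (F := H.comul ∘ₗ H.mul a)
      (G := TensorProduct.map₂ H.mul H.mul (H.comul a) ∘ₗ H.comul) (fun y hy => ?_) b
    exact ext_span hH.span (F := H.comul ∘ₗ H.mul.flip (s y))
      (G := (TensorProduct.map₂ H.mul H.mul).flip (H.comul (s y)) ∘ₗ H.comul)
      (fun x hx => key x y hx hy) a

/-- In the order of the alphabet the letters of y come first, then those of x, then those of z; so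
the sum is an iterated product in this order, with y on the left. -/
theorem IsWordHopf.sum_famC (hH : IsWordHopf H s h) {t : ℤ} (ht : 0 < t) {x y z : List ℤ}
    (hx : x.Nodup) (hy : y.Nodup) (hz : z.Nodup) (hxt : ∀ a ∈ x, |a| < t) (hyt : ∀ a ∈ y, a ≤ -t)
    (hzt : ∀ a ∈ z, t ≤ a) :
    ∑ c ∈ famC t x y z, s c = H.mul (H.mul (s y) (s x)) (s z) := by
  rw [MRTypeB.sum_famC ht, hH.mul (1 - t) y x hy hx, map_sum, LinearMap.sum_apply]
  · refine Finset.sum_congr rfl fun d hd => ?_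
    rw [hH.mul t d z (nodup_of_mem_famA hy hx hd) hz _ hzt]
    intro a ha
    rw [← (perm_lo_hi (1 - t) d).mem_iff, List.mem_append] at ha
    rw [mem_famA] at hd
    rcases ha with ha | ha
    · have := hyt a (hd.1 ▸ ha); omega
    · exact (le_abs_self a).trans_lt (hxt a (hd.2 ▸ ha))
  · intro a ha; have := hyt a ha; omega
  · intro a ha
    have := hxt a ha
    have := neg_abs_le a
    omega

/-- The coaction of a product with an increasing word. -/
theorem IsWordMod.coact_act_inc (hT : IsWordMod T s sM) (hH : IsWordHopf H s h) (m : M) (n : ℕ) :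
    T.coact (T.act m (h n)) = ∑ i ∈ Finset.range (n + 1), ∑ j ∈ Finset.range (n - i + 1),
      TensorProduct.map (T.act.flip (h j)) (H.mul.flip (h (n - i - j)) ∘ₗ H.mul (h i))
        (T.coact m) := by
  refine (ext_span hT.span (F := T.coact ∘ₗ T.act.flip (h n)) (G := ∑ i ∈ Finset.range (n + 1),
    ∑ j ∈ Finset.range (n - i + 1), TensorProduct.map (T.act.flip (h j))
      (H.mul.flip (h (n - i - j)) ∘ₗ H.mul (h i)) ∘ₗ T.coact) ?_ m).trans ?_
  · rintro x ⟨hx, hx0⟩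
    obtain ⟨t, ht, hxt⟩ := exists_bound x
    -- An increasing word of length n above the letters of x, so that `s y = h n` and the signed
    -- shuffle rule applies.
    let y : List ℤ := (List.range n).map fun k : ℕ => t + (k : ℤ)
    have hyp : y.Pairwise (· < ·) := by
      rw [List.pairwise_map]
      exact List.pairwise_lt_range.imp fun h => by omega
    have hyn : y.length = n := by simp [y]
    have hyt : ∀ z ∈ y, t ≤ z := by
      intro z hz
      obtain ⟨k, _, rfl⟩ := List.mem_map.1 hz
      omega
    have hy : y.Nodup := hyp.imp fun h => h.ne
    have hhy : h n = s y := by rw [hH.inc y hyp, hyn]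
    rw [LinearMap.comp_apply, LinearMap.flip_apply, hhy, hT.act t x y hx hy hxt hyt hx0 ht, map_sum,
      Finset.sum_congr rfl fun c hc => hT.coact c (abs_nodup_of_mem_famB hx hy hc),
      sum_famB_splits, Finset.sum_product_right, sum_splits3, sum_splits, hyn, LinearMap.sum_apply]
    refine Finset.sum_congr rfl fun i hi => ?_
    rw [sum_splits, List.length_drop, hyn, LinearMap.sum_apply]
    refine Finset.sum_congr rfl fun j hj => ?_
    rw [LinearMap.comp_apply, hT.coact x hx, map_sum]
    refine Finset.sum_congr rfl fun p hp => ?_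
    have hp' := abs_nodup_splits hx hp
    rw [mem_splits] at hp
    rw [Finset.mem_range] at hi hj
    -- Changing signs and reversing preserves the property of being increasing, so the negative
    -- piece is again one of the elements h. The argument depends on `y` being increasing exactly
    -- here and in the next two identities.
    have hi' : h i = s (negRev (y.take i)) := by
      rw [hH.inc, negRev]
      · simp [hyn]; congr 1; omega
      · rw [negRev, List.pairwise_reverse, List.pairwise_map]
        exact (hyp.sublist (List.take_sublist _ _)).imp fun h => by omega
    have hj' : h j = s ((y.drop i).take j) := by
      rw [hH.inc]
      · simp [hyn]; congr 1; omega
      · exact hyp.sublist ((List.take_sublist _ _).trans (List.drop_sublist _ _))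
    have hk' : h (n - i - j) = s ((y.drop i).drop j) := by
      rw [hH.inc]
      · simp [hyn, Nat.sub_sub]
      · exact hyp.sublist ((List.drop_sublist _ _).trans (List.drop_sublist _ _))
    rw [TensorProduct.map_tmul, LinearMap.comp_apply, LinearMap.flip_apply, LinearMap.flip_apply,
      hi', hj', hk',
      ← hH.sum_famC ht hp'.2.of_map _ (hy.sublist ((List.drop_sublist _ _).trans
        (List.drop_sublist _ _))) (fun a ha => hxt a (by rw [← hp]; simp [ha])) _
        (fun a ha => hyt a (((List.drop_sublist _ _).trans (List.drop_sublist _ _)).subset ha)),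
      hT.act t _ _ hp'.1 (hy.sublist ((List.take_sublist _ _).trans (List.drop_sublist _ _)))
        (fun a ha => hxt a (by rw [← hp]; simp [ha]))
        (fun a ha => hyt a (((List.take_sublist _ _).trans (List.drop_sublist _ _)).subset ha))
        (fun a ha => hx0 a (by rw [← hp]; simp [ha])) ht, TensorProduct.sum_tmul]
    · simp only [TensorProduct.tmul_sum]
    · rw [negRev, List.nodup_reverse]
      exact (hy.sublist (List.take_sublist _ _)).map neg_injective
    · intro a ha
      rw [negRev, List.mem_reverse, List.mem_map] at ha
      obtain ⟨b, hb, rfl⟩ := ha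
      have := hyt b ((List.take_sublist _ _).subset hb)
      omega
  · simp only [LinearMap.sum_apply, LinearMap.comp_apply]

end Words

/-! ## Checking identities on spanning sets -/

section Basis

variable {R : Type} [CommRing R]
variable {M M' A A' N : Type} [AddCommGroup M] [AddCommGroup M'] [AddCommGroup A]
  [AddCommGroup A'] [AddCommGroup N] [Module R M] [Module R M'] [Module R A] [Module R A']
  [Module R N]
variable {I J I' J' : Type} {b : I → M} {a : J → A} {b' : I' → M'} {a' : J' → A'}

theorem ext_range (hs : ∀ x, x ∈ Submodule.span R (Set.range b)) {F G : M →ₗ[R] N}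
    (hFG : ∀ i, F (b i) = G (b i)) (x : M) : F x = G x := by
  have : Submodule.span R (Set.range b) ≤ LinearMap.eqLocus F G := by
    rw [Submodule.span_le]
    rintro _ ⟨c, rfl⟩
    exact hFG c
  exact this (hs x)

theorem IsActHom.of_basis {T : Act R M A} {T' : Act R M' A'} {f : A →ₗ[R] A'} {φ : M →ₗ[R] M'}
    (hb : ∀ x, x ∈ Submodule.span R (Set.range b)) (ha : ∀ x, x ∈ Submodule.span R (Set.range a))
    (hact : ∀ i j, φ (T.act (b i) (a j)) = T'.act (φ (b i)) (f (a j)))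
    (hcoact : ∀ i, T'.coact (φ (b i)) = TensorProduct.map φ f (T.coact (b i))) :
    IsActHom T T' f φ where
  map_act x y := by
    refine ext_range ha (F := φ ∘ₗ T.act x) (G := T'.act (φ x) ∘ₗ f) (fun j => ?_) y
    exact ext_range hb (F := φ ∘ₗ T.act.flip (a j)) (G := T'.act.flip (f (a j)) ∘ₗ φ)
      (fun i => hact i j) x
  map_coact x := ext_range hb (F := T'.coact ∘ₗ φ) (G := TensorProduct.map φ f ∘ₗ T.coact) hcoact x

theorem IsActDual.of_basis {T : Act R M A} {T' : Act R M' A'} {p : M →ₗ[R] M' →ₗ[R] R}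
    {q : A →ₗ[R] A' →ₗ[R] R}
    (hb : ∀ x, x ∈ Submodule.span R (Set.range b)) (ha : ∀ x, x ∈ Submodule.span R (Set.range a))
    (hb' : ∀ x, x ∈ Submodule.span R (Set.range b'))
    (ha' : ∀ x, x ∈ Submodule.span R (Set.range a'))
    (h1 : ∀ i j k, p (T.act (b i) (a j)) (b' k) = pairT p q (b i ⊗ₜ a j) (T'.coact (b' k)))
    (h2 : ∀ k i j, p (b k) (T'.act (b' i) (a' j)) = pairT p q (T.coact (b k)) (b' i ⊗ₜ a' j)) :
    IsActDual T T' p q where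
  act_coact x y z := by
    refine ext_range hb' (F := p (T.act x y)) (G := (TensorProduct.lid R R).toLinearMap ∘ₗ
      TensorProduct.map₂ p q (x ⊗ₜ y) ∘ₗ T'.coact) (fun k => ?_) z
    refine ext_range ha (F := p.flip (b' k) ∘ₗ T.act x) (G := (TensorProduct.lid R R).toLinearMap ∘ₗ
      (TensorProduct.map₂ p q).flip (T'.coact (b' k)) ∘ₗ TensorProduct.mk R M A x) (fun j => ?_) y
    exact ext_range hb (F := p.flip (b' k) ∘ₗ T.act.flip (a j))
      (G := (TensorProduct.lid R R).toLinearMap ∘ₗ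
      (TensorProduct.map₂ p q).flip (T'.coact (b' k)) ∘ₗ (TensorProduct.mk R M A).flip (a j))
      (fun i => h1 i j k) x
  coact_act z x y := by
    refine ext_range hb (F := p.flip (T'.act x y)) (G := (TensorProduct.lid R R).toLinearMap ∘ₗ
      (TensorProduct.map₂ p q).flip (x ⊗ₜ y) ∘ₗ T.coact) (fun k => ?_) z
    refine ext_range ha' (F := p (b k) ∘ₗ T'.act x) (G := (TensorProduct.lid R R).toLinearMap ∘ₗ
      TensorProduct.map₂ p q (T.coact (b k)) ∘ₗ TensorProduct.mk R M' A' x) (fun j => ?_) y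
    exact ext_range hb' (F := p (b k) ∘ₗ T'.act.flip (a' j))
      (G := (TensorProduct.lid R R).toLinearMap ∘ₗ
      TensorProduct.map₂ p q (T.coact (b k)) ∘ₗ (TensorProduct.mk R M' A').flip (a' j))
      (fun i => h2 k i j) x

theorem IsOpsHom.symm {H : Ops R A} {H' : Ops R A'} {e : A ≃ₗ[R] A'}
    (h : IsOpsHom H H' e.toLinearMap) : IsOpsHom H' H e.symm.toLinearMap where
  map_one := by
    rw [← h.map_one]; simp
  map_mul x y := by
    have := h.map_mul (e.symm x) (e.symm y)
    simp only [LinearEquiv.coe_coe, LinearEquiv.apply_symm_apply] at this ⊢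
    rw [← this, LinearEquiv.symm_apply_apply]
  map_counit x := by
    have := h.map_counit (e.symm x)
    simpa using this.symm
  map_comul x := by
    have := h.map_comul (e.symm x)
    simp only [LinearEquiv.coe_coe, LinearEquiv.apply_symm_apply] at this ⊢
    rw [this, ← LinearMap.comp_apply, ← TensorProduct.map_comp]
    simp

theorem IsActHom.symm {T : Act R M A} {T' : Act R M' A'} {e : A ≃ₗ[R] A'} {ε : M ≃ₗ[R] M'}
    (h : IsActHom T T' e.toLinearMap ε.toLinearMap) :
    IsActHom T' T e.symm.toLinearMap ε.symm.toLinearMap where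
  map_act x y := by
    have := h.map_act (ε.symm x) (e.symm y)
    simp only [LinearEquiv.coe_coe, LinearEquiv.apply_symm_apply] at this ⊢
    rw [← this, LinearEquiv.symm_apply_apply]
  map_coact x := by
    have := h.map_coact (ε.symm x)
    simp only [LinearEquiv.coe_coe, LinearEquiv.apply_symm_apply] at this ⊢
    rw [this, ← LinearMap.comp_apply, ← TensorProduct.map_comp]
    simp

theorem map_mem_of_span {S : Set M} {P : Submodule R N} {F : M →ₗ[R] N}
    (h : ∀ x ∈ S, F x ∈ P) {x : M} (hx : x ∈ Submodule.span R S) : F x ∈ P :=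
  (Submodule.span_le (p := P.comap F)).2 (fun y hy => h y hy) hx

theorem map₂_mem_of_span {S : Set M} {S' : Set A} {P : Submodule R N} {F : M →ₗ[R] A →ₗ[R] N}
    (h : ∀ x ∈ S, ∀ y ∈ S', F x y ∈ P) {x : M} {y : A} (hx : x ∈ Submodule.span R S)
    (hy : y ∈ Submodule.span R S') : F x y ∈ P :=
  map_mem_of_span (F := F.flip y) (fun x hx => map_mem_of_span (h x hx) hy) hx

end Basis

/-! ### Coefficients of sums of basis elements -/

section FreeZ

variable {W V : ℕ → Type}

theorem bas_span {_ : Module ℤ (FreeZ W)} (x : FreeZ W) :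
    x ∈ Submodule.span ℤ (Set.range (bas : (Σ n, W n) → FreeZ W)) := by
  refine freeZ_induction x (zero_mem _) (fun u => Submodule.subset_span ⟨u, rfl⟩)
    (fun x y hx hy => add_mem hx hy) (fun x hx => neg_mem hx)

theorem sum_bas_apply [∀ n, Fintype (W n)] (N : ℕ) (Q : (Σ n, W n) → Prop) [DecidablePred Q]
    (z : Σ n, W n) :
    (∑ w : W N with Q ⟨N, w⟩, (bas ⟨N, w⟩ : FreeZ W)) z = if z.1 = N ∧ Q z then 1 else 0 := by
  classical
  rw [Finsupp.finsetSum_apply]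
  simp only [bas_apply]
  obtain ⟨n, z⟩ := z
  by_cases hn : n = N
  · subst hn
    simp only [Sigma.mk.injEq, heq_eq_eq, true_and]
    rw [Finset.sum_ite_eq']
    simp
  · rw [if_neg fun h => hn h.1]
    refine Finset.sum_eq_zero fun w _ => if_neg fun h => hn ?_
    exact (Sigma.mk.inj_iff.1 h).1.symm

/-- By degree, only the summand with index `u.1` can contain `u` in its first factor; so the sum
over all cuts collapses to one condition. -/
theorem sum_pair_bas {N : ℕ} (A : ℕ → Σ n, W n) (B : ℕ → Σ n, V n) (hA : ∀ i ≤ N, (A i).1 = i)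
    (hB : ∀ i ≤ N, (B i).1 = N - i) (u : Σ n, W n) (v : Σ n, V n)
    [Decidable (N = u.1 + v.1 ∧ A u.1 = u ∧ B u.1 = v)] :
    ∑ i ∈ Finset.range (N + 1), (bas (A i) : FreeZ W) u * (bas (B i) : FreeZ V) v =
      if N = u.1 + v.1 ∧ A u.1 = u ∧ B u.1 = v then 1 else 0 := by
  classical
  simp only [bas_apply]
  by_cases hu : u.1 ≤ N
  · rw [Finset.sum_eq_single_of_mem u.1 (Finset.mem_range.2 (by omega))]
    · by_cases h1 : A u.1 = u <;> by_cases h2 : B u.1 = v <;> simp [h1, h2]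
      have := hB u.1 hu
      rw [h2] at this
      omega
    · intro i hi hne
      rw [if_neg, zero_mul]
      rintro rfl
      exact hne (hA i (by simpa [Nat.lt_succ_iff] using hi)).symm
  · rw [if_neg (by omega)]
    refine Finset.sum_eq_zero fun i hi => ?_
    rw [if_neg, zero_mul]
    rintro rfl
    have := hA i (by simpa [Nat.lt_succ_iff] using hi)
    have : i ≤ N := by simpa [Nat.lt_succ_iff] using hi
    omega

end FreeZ

/-! ## The structure maps on words -/

section WordMaps

theorem stA_take {c : List ℤ} (hc : c.Nodup) (i : ℕ) :
    stA (segment (wordA (stA c).2) 0 i) = stA (c.take i) := by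
  rw [wordA_stA hc, segment, ← List.map_take, List.drop_zero]
  exact stA_map (hc.sublist (List.take_sublist _ _)) ((rank_strictMonoOn _).mono fun x hx =>
    by exact_mod_cast List.mem_toFinset.2 ((List.take_sublist _ _).subset hx))

theorem stA_drop {c : List ℤ} (hc : c.Nodup) (i : ℕ) :
    stA (segment (wordA (stA c).2) i (stA c).1) = stA (c.drop i) := by
  have : (c.map (rank c.toFinset)).take (stA c).1 = c.map (rank c.toFinset) :=
    List.take_of_length_le (by simp)
  rw [wordA_stA hc, segment, this, ← List.map_drop]
  exact stA_map (hc.sublist (List.drop_sublist _ _)) ((rank_strictMonoOn _).mono fun x hx =>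
    by exact_mod_cast List.mem_toFinset.2 ((List.drop_sublist _ _).subset hx))

theorem stB_take {c : List ℤ} (hc : (c.map (|·|)).Nodup) (i : ℕ) :
    stB (segment (wordB (stB c).2) 0 i) = stB (c.take i) := by
  rw [wordB_stB hc, segment, ← List.map_take, List.drop_zero]
  have hsub := (List.take_sublist i c).map (|·|)
  exact stB_map (hc.sublist hsub) ((rank_strictMonoOn _).mono fun x hx =>
    by exact_mod_cast List.mem_toFinset.2 (hsub.subset hx)) fun x hx => rank_pos
      (List.mem_toFinset.2 (hsub.subset (List.mem_map_of_mem hx)))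

theorem stA_drop_stB {c : List ℤ} (hc : (c.map (|·|)).Nodup) (i : ℕ) :
    stA (segment (wordB (stB c).2) i (stB c).1) = stA (c.drop i) := by
  have : (c.map (oddExt (rank (c.map (|·|)).toFinset))).take (stB c).1 =
    c.map (oddExt (rank (c.map (|·|)).toFinset)) := List.take_of_length_le (by simp)
  rw [wordB_stB hc, segment, this, ← List.map_drop]
  exact stA_map (hc.of_map.sublist (List.drop_sublist _ _))
    ((oddExt_rank_strictMonoOn _).mono fun x hx => List.mem_toFinset.2
      (List.mem_map_of_mem ((List.drop_sublist _ _).subset hx)))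

theorem linearCombination_bas {W : ℕ → Type} {N : Type} [AddCommGroup N] (f : (Σ n, W n) → N)
    (u : Σ n, W n) : Finsupp.linearCombination ℤ f (bas u) = f u :=
  (Finsupp.linearCombination_single ..).trans (one_smul _ _)

theorem shuffleS_comul_bas (u : Σ n, SymGrp n) : shuffleS.gen.comul (bas u) =
    ∑ i ∈ Finset.range (u.1 + 1),
      bas (stA (segment (wordA u.2) 0 i)) ⊗ₜ[ℤ] bas (stA (segment (wordA u.2) i u.1)) :=
  linearCombination_bas _ u

theorem shuffleB_coact_bas (u : Σ n, HypGrp n) : shuffleB.gen.coact (bas u) =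
    ∑ i ∈ Finset.range (u.1 + 1),
      bas (stB (segment (wordB u.2) 0 i)) ⊗ₜ[ℤ] bas (stA (segment (wordB u.2) i u.1)) :=
  linearCombination_bas _ u

theorem cupS_comul_bas (u : Σ n, SymGrp n) : cupS.gen.comul (bas u) =
    ∑ i ∈ Finset.range (u.1 + 1),
      bas (stA (restrictTo (wordA u.2) 1 i)) ⊗ₜ[ℤ]
        bas (stA (restrictTo (wordA u.2) (i + 1) u.1)) :=
  linearCombination_bas _ u

theorem cupB_coact_bas (u : Σ n, HypGrp n) : cupB.gen.coact (bas u) =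
    ∑ i ∈ Finset.range (u.1 + 1),
      bas (stB (restrictTo (wordB u.2) 1 i)) ⊗ₜ[ℤ]
        bas (stA (restrictTo (hat (wordB u.2)) (i + 1) u.1)) :=
  linearCombination_bas _ u

theorem cupS_mul_bas (u v : Σ n, SymGrp n) : cupS.gen.mul (bas u) (bas v) =
    ∑ w : SymGrp (u.1 + v.1) with
    stA (segment (wordA w) 0 u.1) = u ∧
      stA (segment (wordA w) u.1 (u.1 + v.1)) = v, bas ⟨u.1 + v.1, w⟩ :=
  bilin_bas _ u v

theorem cupB_act_bas (u : Σ n, HypGrp n) (v : Σ n, SymGrp n) : cupB.gen.act (bas u) (bas v) =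
    ∑ w : HypGrp (u.1 + v.1) with
    stB (segment (wordB w) 0 u.1) = u ∧
      stA (segment (wordB w) u.1 (u.1 + v.1)) = v, bas ⟨u.1 + v.1, w⟩ :=
  bilin_bas _ u v

theorem counitS_bas (u : Σ n, SymGrp n) : counitS (bas u) = if u.1 = 0 then 1 else 0 :=
  linearCombination_bas _ u

theorem shuffleS_mul_bas' (u v : Σ n, SymGrp n) : shuffleS.gen.mul (bas u) (bas v) =
    ∑ w : SymGrp (u.1 + v.1) with
    stA (restrictTo (wordA w) 1 u.1) = u ∧
      stA (restrictTo (wordA w) (u.1 + 1) (u.1 + v.1)) = v, bas ⟨u.1 + v.1, w⟩ := by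
  refine (shuffleS_mul_bas u v).trans (Finset.sum_congr ?_ fun _ _ => rfl)
  ext w
  rw [Finset.mem_filter, Finset.mem_filter, restrictTo_wordA_eq_iff w u (by omega)]

theorem shuffleB_act_bas' (u : Σ n, HypGrp n) (v : Σ n, SymGrp n) :
    shuffleB.gen.act (bas u) (bas v) =
    ∑ w : HypGrp (u.1 + v.1) with
    stB (restrictTo (wordB w) 1 u.1) = u ∧
      stA (restrictTo (hat (wordB w)) (u.1 + 1) (u.1 + v.1)) = v, bas ⟨u.1 + v.1, w⟩ := by
  refine (shuffleB_act_bas u v).trans (Finset.sum_congr ?_ fun _ _ => rfl)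
  ext w
  rw [Finset.mem_filter, Finset.mem_filter, restrictTo_wordB_eq_iff w u (by omega)]

theorem stA_of_pairwise {c : List ℤ} (hc : c.Pairwise (· < ·)) : stA c = ⟨c.length, 1⟩ := by
  have : Monotone c.get := by
    intro i j hij
    rcases hij.lt_or_eq with h | rfl
    · exact (List.pairwise_iff_get.1 hc i j h).le
    · exact le_rfl
  rw [stA, Tuple.sort_eq_refl_iff_monotone.2 this]
  rfl

theorem sA_of_pairwise {c : List ℤ} (hc : c.Pairwise (· < ·)) : sA c = bas ⟨c.length, 1⟩ := by
  rw [sA, stA_of_pairwise hc]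

theorem isWordHopf : IsWordHopf shuffleS.gen sA fun n => bas ⟨n, 1⟩ where
  comul c hc := by
    rw [sA, shuffleS_comul_bas, sum_splits]
    refine Finset.sum_congr rfl fun i _ => ?_
    rw [stA_take hc, stA_drop hc]
    rfl
  mul _ _ _ hx hy hxt hyt := shuffleS_mul_sA hx hy hxt hyt
  counit c := by
    refine (counitS_bas (stA c)).trans ?_
    simp
  one := (sA_of_pairwise .nil).symm
  map c k hc := by
    rw [sA, sA, stA_map hc]
    exact fun a _ b _ hab => by simpa using hab
  inc _ hc := sA_of_pairwise hc
  span a := by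
    refine Submodule.span_mono ?_ (bas_span (W := SymGrp) a)
    rintro _ ⟨u, rfl⟩
    exact ⟨wordA u.2, nodup_wordA u.2, sA_wordA u⟩

theorem isWordMod : IsWordMod shuffleB.gen sA sB where
  coact c hc := by
    rw [sB, shuffleB_coact_bas, sum_splits]
    refine Finset.sum_congr rfl fun i _ => ?_
    rw [stB_take hc, stA_drop_stB hc]
    rfl
  act _ _ _ hx hy hxt hyt hx0 ht := shuffleB_act_sB hx hy hxt hyt hx0 ht
  span a := by
    refine Submodule.span_mono ?_ (bas_span (W := HypGrp) a)
    rintro _ ⟨u, rfl⟩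
    refine ⟨wordB u.2, ⟨nodup_wordB u.2, fun z hz => ?_⟩, sB_wordB u⟩
    rintro rfl
    have := mem_wordB hz
    simp at this

end WordMaps

/-! ## Inversion and duality -/

section Inv

theorem invS_eq_iff {W : ℕ → Type} [∀ n, Group (W n)] {u v : Σ n, W n} :
    invS u = v ↔ u = invS v :=
  ⟨fun h => by rw [← h, invS_invS], fun h => by rw [h, invS_invS]⟩

theorem invMap_sum {W : ℕ → Type} [∀ n, Group (W n)] [∀ n, Fintype (W n)] {N : ℕ}
    (P Q : W N → Prop) [DecidablePred P] [DecidablePred Q] (h : ∀ w, P w ↔ Q w⁻¹) :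
    (invMap W) (∑ w : W N with P w, bas ⟨N, w⟩) = ∑ w : W N with Q w, bas ⟨N, w⟩ := by
  rw [map_sum]
  refine Finset.sum_equiv (Equiv.inv (W N)) (fun w => ?_) (fun w _ => invMap_bas _)
  simp [h]

theorem invMap_isActHom_self : IsActHom shuffleS.gen.self cupS.gen.self
    (invMap SymGrp).toLinearMap (invMap SymGrp).toLinearMap := by
  refine IsActHom.of_basis bas_span bas_span (fun u v => ?_) fun u => ?_
  · change invMap SymGrp (shuffleS.gen.mul (bas u) (bas v)) =
      cupS.gen.mul (invMap SymGrp (bas u)) (invMap SymGrp (bas v))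
    rw [invMap_bas, invMap_bas, cupS_mul_bas, shuffleS_mul_bas']
    refine invMap_sum _ _ fun w => ?_
    have h1 := stA_restrictTo w (Nat.zero_le u.1) (Nat.le_add_right u.1 v.1)
    have h2 := stA_restrictTo w (Nat.le_add_right u.1 v.1) le_rfl
    rw [zero_add] at h1
    rw [h1, h2, invS_eq_iff, invS_eq_iff]
    rfl
  · change cupS.gen.comul (invMap SymGrp (bas u)) = TensorProduct.map _ _ (shuffleS.gen.comul (bas u))
    rw [invMap_bas, cupS_comul_bas, shuffleS_comul_bas, map_sum]
    refine Finset.sum_congr rfl fun i hi => ?_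
    have hi : i ≤ u.1 := by simpa [Nat.lt_succ_iff] using hi
    have h1 := stA_restrictTo u.2⁻¹ (Nat.zero_le i) hi
    have h2 := stA_restrictTo u.2⁻¹ hi le_rfl
    rw [zero_add, inv_inv] at h1
    rw [inv_inv] at h2
    rw [TensorProduct.map_tmul]
    change bas _ ⊗ₜ[ℤ] bas _ = (invMap SymGrp (bas _)) ⊗ₜ[ℤ] (invMap SymGrp (bas _))
    rw [invMap_bas, invMap_bas, ← h1, ← h2]
    rfl

theorem invMap_isOpsHom : IsOpsHom shuffleS.gen cupS.gen (invMap SymGrp).toLinearMap where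
  map_one := (invMap_bas _).trans (congrArg bas (Sigma.ext rfl (heq_of_eq inv_one)))
  map_mul := invMap_isActHom_self.map_act
  map_counit := ext_range bas_span (F := counitS ∘ₗ (invMap SymGrp).toLinearMap) (G := counitS)
    fun u => by
      rw [LinearMap.comp_apply, LinearEquiv.coe_coe, invMap_bas, counitS_bas, counitS_bas]
      rfl
  map_comul := invMap_isActHom_self.map_coact

theorem invMap_isActHom : IsActHom shuffleB.gen cupB.gen
    (invMap SymGrp).toLinearMap (invMap HypGrp).toLinearMap := by
  refine IsActHom.of_basis bas_span bas_span (fun u v => ?_) fun u => ?_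
  · change invMap HypGrp (shuffleB.gen.act (bas u) (bas v)) =
      cupB.gen.act (invMap HypGrp (bas u)) (invMap SymGrp (bas v))
    rw [invMap_bas, invMap_bas, cupB_act_bas, shuffleB_act_bas']
    refine invMap_sum _ _ fun w => ?_
    have h1 := stB_restrictTo w (Nat.le_add_right u.1 v.1)
    have h2 := stA_restrictTo_hat w (Nat.le_add_right u.1 v.1) le_rfl
    rw [h1, h2, invS_eq_iff, invS_eq_iff]
    rfl
  · change cupB.gen.coact (invMap HypGrp (bas u)) =
      TensorProduct.map _ _ (shuffleB.gen.coact (bas u))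
    rw [invMap_bas, cupB_coact_bas, shuffleB_coact_bas, map_sum]
    refine Finset.sum_congr rfl fun i hi => ?_
    have hi : i ≤ u.1 := by simpa [Nat.lt_succ_iff] using hi
    have h1 := stB_restrictTo u.2⁻¹ hi
    have h2 := stA_restrictTo_hat u.2⁻¹ hi le_rfl
    rw [inv_inv] at h1 h2
    rw [TensorProduct.map_tmul]
    change bas _ ⊗ₜ[ℤ] bas _ = (invMap HypGrp (bas _)) ⊗ₜ[ℤ] (invMap SymGrp (bas _))
    rw [invMap_bas, invMap_bas, ← h1, ← h2]
    rfl

theorem delta_pair_bas {W V : ℕ → Type} {N : ℕ} (A : ℕ → Σ n, W n) (B : ℕ → Σ n, V n)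
    (hA : ∀ i ≤ N, (A i).1 = i) (hB : ∀ i ≤ N, (B i).1 = N - i) (u : Σ n, W n) (v : Σ n, V n)
    [Decidable (N = u.1 + v.1 ∧ A u.1 = u ∧ B u.1 = v)] :
    pairT (delta W) (delta V) (bas u ⊗ₜ[ℤ] bas v)
      (∑ i ∈ Finset.range (N + 1), bas (A i) ⊗ₜ[ℤ] bas (B i)) =
      if N = u.1 + v.1 ∧ A u.1 = u ∧ B u.1 = v then 1 else 0 := by
  rw [← sum_pair_bas A B hA hB u v, pairT, map_sum, map_sum]
  refine Finset.sum_congr rfl fun i _ => ?_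
  refine (pairT_tmul (delta W) (delta V) _ _ _ _).trans ?_
  rw [delta_bas_left, delta_bas_left]

theorem delta_pair_bas' {W V : ℕ → Type} {N : ℕ} (A : ℕ → Σ n, W n) (B : ℕ → Σ n, V n)
    (hA : ∀ i ≤ N, (A i).1 = i) (hB : ∀ i ≤ N, (B i).1 = N - i) (u : Σ n, W n) (v : Σ n, V n)
    [Decidable (N = u.1 + v.1 ∧ A u.1 = u ∧ B u.1 = v)] :
    pairT (delta W) (delta V) (∑ i ∈ Finset.range (N + 1), bas (A i) ⊗ₜ[ℤ] bas (B i))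
      (bas u ⊗ₜ[ℤ] bas v) = if N = u.1 + v.1 ∧ A u.1 = u ∧ B u.1 = v then 1 else 0 := by
  rw [← sum_pair_bas A B hA hB u v, pairT, map_sum, LinearMap.sum_apply, map_sum]
  refine Finset.sum_congr rfl fun i _ => ?_
  refine (pairT_tmul (delta W) (delta V) _ _ _ _).trans ?_
  rw [delta_bas_right, delta_bas_right]

theorem fst_stA_segment {n : ℕ} (c : List ℤ) (hc : c.length = n) {i j : ℕ} (hj : j ≤ n) :
    (stA (segment c i j)).1 = j - i := length_segment (hc ▸ hj)

theorem fst_stB_segment {n : ℕ} (c : List ℤ) (hc : c.length = n) {j : ℕ} (hj : j ≤ n) :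
    (stB (segment c 0 j)).1 = j := length_segment (hc ▸ hj)

/-- On basis elements each side is 0 or 1: the product contains z exactly when z has the prescribed
restrictions, and these are the two factors of the only term in the other coproduct that can pair
with u ⊗ v. -/
theorem delta_isActDual_self :
    IsActDual shuffleS.gen.self cupS.gen.self (delta SymGrp) (delta SymGrp) := by
  refine IsActDual.of_basis bas_span bas_span bas_span bas_span (fun u v z => ?_) fun z u v => ?_
  · change delta SymGrp (shuffleS.gen.mul (bas u) (bas v)) (bas z) =
      pairT _ _ _ (cupS.gen.comul (bas z))
    rw [shuffleS_mul_bas', cupS_comul_bas, delta_pair_bas, delta_bas_right,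
      sum_bas_apply (W := SymGrp) (u.1 + v.1) (fun z => stA (restrictTo (wordA z.2) 1 u.1) = u ∧
        stA (restrictTo (wordA z.2) (u.1 + 1) (u.1 + v.1)) = v)]
    · refine if_congr (and_congr_right fun h => ?_) rfl rfl
      rw [← h]
    · intro i hi
      have h1 := stA_restrictTo z.2 (Nat.zero_le i) hi
      rw [zero_add] at h1
      rw [h1]
      exact fst_stA_segment _ (length_wordA _) hi
    · intro i hi
      rw [stA_restrictTo z.2 hi le_rfl]
      exact fst_stA_segment _ (length_wordA _) le_rfl
  · change delta SymGrp (bas z) (cupS.gen.mul (bas u) (bas v)) =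
      pairT _ _ (shuffleS.gen.comul (bas z)) _
    rw [cupS_mul_bas, shuffleS_comul_bas, delta_pair_bas', delta_bas_left,
      sum_bas_apply (W := SymGrp) (u.1 + v.1) (fun z => stA (segment (wordA z.2) 0 u.1) = u ∧
        stA (segment (wordA z.2) u.1 (u.1 + v.1)) = v)]
    · refine if_congr (and_congr_right fun h => ?_) rfl rfl
      rw [← h]
    · exact fun i hi => fst_stA_segment _ (length_wordA _) hi
    · exact fun i hi => fst_stA_segment _ (length_wordA _) le_rfl

theorem eq_empty_iff (u : Σ n, SymGrp n) : u = ⟨0, 1⟩ ↔ u.1 = 0 := by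
  constructor
  · rintro rfl; rfl
  · obtain ⟨n, u⟩ := u
    intro h
    have h : n = 0 := h
    subst h
    exact Sigma.ext rfl (heq_of_eq (Subsingleton.elim _ _))

theorem delta_one (c : ZS) : delta SymGrp oneS c = counitS c := by
  classical
  refine ext_range bas_span (F := delta SymGrp oneS) (G := counitS) (fun u => ?_) c
  rw [oneS, delta_bas_left, counitS_bas, bas_apply]
  exact if_congr (eq_empty_iff u) rfl rfl

theorem delta_isDual : IsDual shuffleS.gen cupS.gen (delta SymGrp) where
  mul_comul := delta_isActDual_self.act_coact
  comul_mul := delta_isActDual_self.coact_act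
  one_counit := delta_one
  counit_one a := (delta_symm _ _).trans (delta_one a)

theorem delta_isActDual :
    IsActDual shuffleB.gen cupB.gen (delta HypGrp) (delta SymGrp) := by
  refine IsActDual.of_basis bas_span bas_span bas_span bas_span (fun u v z => ?_) fun z u v => ?_
  · rw [shuffleB_act_bas', cupB_coact_bas, delta_pair_bas, delta_bas_right,
      sum_bas_apply (W := HypGrp) (u.1 + v.1) (fun z => stB (restrictTo (wordB z.2) 1 u.1) = u ∧
        stA (restrictTo (hat (wordB z.2)) (u.1 + 1) (u.1 + v.1)) = v)]
    · refine if_congr (and_congr_right fun h => ?_) rfl rfl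
      rw [← h]
    · intro i hi
      rw [stB_restrictTo z.2 hi]
      exact fst_stB_segment _ (length_wordB _) hi
    · intro i hi
      rw [stA_restrictTo_hat z.2 hi le_rfl]
      exact fst_stA_segment _ (length_wordB _) le_rfl
  · rw [cupB_act_bas, shuffleB_coact_bas, delta_pair_bas', delta_bas_left,
      sum_bas_apply (W := HypGrp) (u.1 + v.1) (fun z => stB (segment (wordB z.2) 0 u.1) = u ∧
        stA (segment (wordB z.2) u.1 (u.1 + v.1)) = v)]
    · refine if_congr (and_congr_right fun h => ?_) rfl rfl
      rw [← h]
    · exact fun i hi => fst_stB_segment _ (length_wordB _) hi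
    · exact fun i hi => fst_stA_segment _ (length_wordB _) le_rfl

end Inv

/-! ## The Hopf algebras `ℤ𝔖` and their modules and comodules `ℤ𝔅` -/

section Main

theorem freeGrade_mul_mem {W V U : ℕ → Type} {F : FreeZ W →ₗ[ℤ] FreeZ V →ₗ[ℤ] FreeZ U}
    (hF : ∀ u v, F (bas u) (bas v) ∈ freeGrade U (u.1 + v.1)) (m n : ℕ) :
    ∀ x ∈ freeGrade W m, ∀ a ∈ freeGrade V n, F x a ∈ freeGrade U (m + n) := by
  refine fun x hx a ha => map₂_mem_of_span ?_ hx ha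
  rintro _ ⟨u, rfl⟩ _ ⟨v, rfl⟩
  exact hF ⟨m, u⟩ ⟨n, v⟩

theorem sum_bas_mem_freeGrade {W : ℕ → Type} [∀ n, Fintype (W n)] {N : ℕ} (P : W N → Prop)
    [DecidablePred P] : ∑ w : W N with P w, bas ⟨N, w⟩ ∈ freeGrade W N :=
  sum_mem fun w _ => bas_mem_freeGrade ⟨N, w⟩

theorem comul_mem_of_splits {W V : ℕ → Type} {N : ℕ} (A : ℕ → Σ n, W n) (B : ℕ → Σ n, V n)
    (hA : ∀ i ≤ N, (A i).1 = i) (hB : ∀ i ≤ N, (B i).1 = N - i) :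
    ∑ i ∈ Finset.range (N + 1), bas (A i) ⊗ₜ[ℤ] bas (B i) ∈
      tensorDeg (freeGrade W) (freeGrade V) N := by
  refine sum_mem fun i hi => ?_
  have hi : i ≤ N := by simpa [Nat.lt_succ_iff] using hi
  exact tmul_mem_tensorDeg (by rw [hA i hi, hB i hi]; omega) (bas_mem_freeGrade _)
    (bas_mem_freeGrade _)

theorem eq_counit_smul_of_mem_span {R A : Type} [CommRing R] [AddCommGroup A] [Module R A]
    {H : Ops R A} {S : Set A} (h : ∀ a ∈ S, a = H.counit a • H.one) {a : A}
    (ha : a ∈ Submodule.span R S) : a = H.counit a • H.one :=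
  LinearMap.eqOn_span' (f := LinearMap.id) (g := LinearMap.toSpanSingleton R A H.one ∘ₗ H.counit)
    (fun a ha => h a ha) ha

theorem shuffleS_isConn : IsConn (freeGrade SymGrp) shuffleS.gen where
  decomp := isInternal_freeGrade
  one_mem := bas_mem_freeGrade ⟨0, 1⟩
  mul_mem := by
    refine freeGrade_mul_mem fun u v => ?_
    exact (shuffleS_mul_bas u v) ▸ sum_bas_mem_freeGrade _
  comul_mem n a ha := by
    refine map_mem_of_span ?_ ha
    rintro _ ⟨u, rfl⟩
    exact (shuffleS_comul_bas ⟨n, u⟩) ▸ comul_mem_of_splits _ _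
      (fun i hi => fst_stA_segment _ (length_wordA _) hi)
      (fun i hi => fst_stA_segment _ (length_wordA _) le_rfl)
  counit_eq_zero n hn a ha := by
    have : ∀ x ∈ Set.range fun w : SymGrp n => bas ⟨n, w⟩, counitS x ∈ (⊥ : Submodule ℤ ℤ) := by
      rintro _ ⟨u, rfl⟩
      rw [counitS_bas, if_neg hn]
      exact zero_mem _
    exact (Submodule.mem_bot ℤ).1 (map_mem_of_span this ha)
  conn a ha := by
    refine eq_counit_smul_of_mem_span (S := Set.range fun w : SymGrp 0 => bas ⟨0, w⟩) ?_ ha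
    rintro _ ⟨u, rfl⟩
    change bas _ = counitS (bas _) • oneS
    rw [counitS_bas, if_pos rfl, one_smul, (eq_empty_iff ⟨0, u⟩).2 rfl, oneS]

theorem shuffleB_isModGr : IsModGr (freeGrade HypGrp) (freeGrade SymGrp) shuffleB.gen where
  decomp := isInternal_freeGrade
  act_mem := by
    refine freeGrade_mul_mem fun u v => ?_
    exact (shuffleB_act_bas u v) ▸ sum_bas_mem_freeGrade _
  coact_mem n a ha := by
    refine map_mem_of_span ?_ ha
    rintro _ ⟨u, rfl⟩
    exact (shuffleB_coact_bas ⟨n, u⟩) ▸ comul_mem_of_splits _ _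
      (fun i hi => fst_stB_segment _ (length_wordB _) hi)
      (fun i hi => fst_stA_segment _ (length_wordB _) le_rfl)

theorem invMap_surj {W : ℕ → Type} [∀ n, Group (W n)] :
    Function.Surjective (invMap W).toLinearMap := (invMap W).surjective

theorem invMap_isOpsHom' : IsOpsHom cupS.gen shuffleS.gen (invMap SymGrp).toLinearMap := by
  have := invMap_isOpsHom.symm
  rwa [invMap_symm] at this

theorem invMap_isActHom' : IsActHom cupB.gen shuffleB.gen (invMap SymGrp).toLinearMap
    (invMap HypGrp).toLinearMap := by
  have := invMap_isActHom.symm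
  rwa [invMap_symm, invMap_symm] at this

theorem invMap_graded {W : ℕ → Type} [∀ n, Group (W n)] (n : ℕ) :
    ∀ a ∈ freeGrade W n, (invMap W).toLinearMap a ∈ freeGrade W n :=
  fun a ha => (invMap_mem n a).2 ha

theorem invMap_graded_surj {W : ℕ → Type} [∀ n, Group (W n)] (n : ℕ) :
    ∀ b ∈ freeGrade W n, ∃ a ∈ freeGrade W n, (invMap W).toLinearMap a = b := by
  intro b hb
  refine ⟨(invMap W).symm b, ?_, (invMap W).apply_symm_apply b⟩
  rw [invMap_symm]
  exact invMap_graded n b hb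

/-- Obtained by transposing coassociativity of deconcatenation. -/
theorem cupS_isAlg : IsAlg cupS.gen := delta_isDual.isAlg delta_separating isWordHopf.isCoalg

theorem cupB_isMod : IsMod cupS.gen cupB.gen :=
  delta_isActDual.isMod delta_isDual delta_separating (isWordMod.isComod isWordHopf)

theorem cupS_isCoalg : IsCoalg cupS.gen :=
  .of_surjective invMap_isOpsHom invMap_surj isWordHopf.isCoalg

theorem cupB_isComod : IsComod cupS.gen cupB.gen :=
  .of_surjective invMap_isOpsHom invMap_isActHom invMap_surj (isWordMod.isComod isWordHopf)

theorem cupS_isBi : IsBi cupS.gen := .of_surjective invMap_isOpsHom invMap_surj isWordHopf.isBi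

theorem cupS_isConn : IsConn (freeGrade SymGrp) cupS.gen :=
  .of_surjective invMap_isOpsHom invMap_graded invMap_graded_surj isInternal_freeGrade
    shuffleS_isConn

theorem cupB_isModGr : IsModGr (freeGrade HypGrp) (freeGrade SymGrp) cupB.gen :=
  .of_surjective invMap_isActHom invMap_graded invMap_graded_surj invMap_graded invMap_graded_surj
    isInternal_freeGrade shuffleB_isModGr

/-- Associativity of the shuffle product is carried back from `cupS` by inversion. -/
theorem shuffleS_isAlg : IsAlg shuffleS.gen := .of_surjective invMap_isOpsHom' invMap_surj cupS_isAlg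

theorem shuffleB_isMod : IsMod shuffleS.gen shuffleB.gen :=
  .of_surjective invMap_isOpsHom' invMap_isActHom' invMap_surj invMap_surj cupB_isMod

theorem IsOpsHom.id {R A : Type} [CommRing R] [AddCommGroup A] [Module R A] (H : Ops R A) :
    IsOpsHom H H LinearMap.id := ⟨rfl, fun _ _ => rfl, fun _ => rfl, fun _ => by simp⟩

theorem IsActHom.id {R M A : Type} [CommRing R] [AddCommGroup M] [AddCommGroup A] [Module R M]
    [Module R A] (T : Act R M A) : IsActHom T T LinearMap.id LinearMap.id :=
  ⟨fun _ _ => rfl, fun _ => by simp⟩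

/-- Inverting the left argument turns the duality of `shuffleS` with `cupS` into a duality of `cupS`
with itself. -/
theorem deltaInv_isDual : IsDual cupS.gen cupS.gen (deltaInv SymGrp) :=
  delta_isDual.transfer invMap_isOpsHom' (.id _) (.id _) (.id _) Function.surjective_id
    Function.surjective_id fun _ _ => rfl

theorem deltaInv_isActDual : IsActDual cupB.gen cupB.gen (deltaInv HypGrp) (deltaInv SymGrp) :=
  delta_isActDual.transfer invMap_isActHom' (.id _) (.id _) (.id _) Function.surjective_id
    Function.surjective_id Function.surjective_id Function.surjective_id (fun _ _ => rfl)
    fun _ _ => rfl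

/-- The coaction of a product with the identity permutation. -/
theorem cupB_coact_act_one (m : ZB) (n : ℕ) :
    cupB.gen.coact (cupB.gen.act m (bas ⟨n, 1⟩)) =
      ∑ i ∈ Finset.range (n + 1), ∑ j ∈ Finset.range (n - i + 1),
      TensorProduct.map (cupB.gen.act.flip (bas ⟨j, 1⟩))
        (cupS.gen.mul.flip (bas ⟨n - i - j, 1⟩) ∘ₗ cupS.gen.mul (bas ⟨i, 1⟩))
        (cupB.gen.coact m) := by
  obtain ⟨m, rfl⟩ := invMap_surj m
  have hinv : ∀ n, (invMap SymGrp).toLinearMap (bas ⟨n, 1⟩) = bas ⟨n, 1⟩ := fun n =>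
    (invMap_bas _).trans (congrArg bas (Sigma.ext rfl (heq_of_eq inv_one)))
  have h1 := invMap_isActHom.map_act m (bas ⟨n, 1⟩)
  rw [hinv] at h1
  rw [← h1, invMap_isActHom.map_coact, invMap_isActHom.map_coact,
    isWordMod.coact_act_inc isWordHopf, map_sum]
  refine Finset.sum_congr rfl fun i _ => ?_
  rw [map_sum]
  refine Finset.sum_congr rfl fun j _ => ?_
  generalize shuffleB.gen.coact m = t
  rw [← LinearMap.comp_apply, ← LinearMap.comp_apply, ← TensorProduct.map_comp,
    ← TensorProduct.map_comp]
  congr 2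
  · refine LinearMap.ext fun x => ?_
    have := invMap_isActHom.map_act x (bas ⟨j, 1⟩)
    rw [hinv] at this
    exact this
  · refine LinearMap.ext fun x => ?_
    have h2 := invMap_isOpsHom.map_mul (bas ⟨i, 1⟩) x
    have h3 := invMap_isOpsHom.map_mul (shuffleS.gen.mul (bas ⟨i, 1⟩) x) (bas ⟨n - i - j, 1⟩)
    rw [h2, hinv, hinv] at h3
    exact h3

end Main

/-! ## Descents -/

section DescentWords

theorem mem_desA {n : ℕ} {w : SymGrp n} {i : ℕ} : i ∈ desA n w ↔
    (1 ≤ i ∧ i < n) ∧ (wordA w).getD i 0 < (wordA w).getD (i - 1) 0 := by simp [desA]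

theorem mem_desB {n : ℕ} {w : HypGrp n} {i : ℕ} : i ∈ desB n w ↔
    i < n ∧ (wordB w).getD i 0 < (0 :: wordB w).getD i 0 := by simp [desB]

theorem getD_mem {c : List ℤ} {i : ℕ} (h : i < c.length) : c.getD i 0 ∈ c := by
  rw [List.getD_eq_getElem _ _ h]; exact List.getElem_mem h

theorem getD_map {c : List ℤ} {f : ℤ → ℤ} {i : ℕ} (h : i < c.length) :
    (c.map f).getD i 0 = f (c.getD i 0) := by
  rw [List.getD_eq_getElem _ _ (by simpa using h), List.getD_eq_getElem _ _ h, List.getElem_map]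

theorem mem_desA_stA {c : List ℤ} (hc : c.Nodup) {i : ℕ} : i ∈ desA _ (stA c).2 ↔
    (1 ≤ i ∧ i < c.length) ∧ c.getD i 0 < c.getD (i - 1) 0 := by
  rw [mem_desA, wordA_stA hc, stA_fst]
  refine and_congr_right fun h => ?_
  rw [getD_map (by omega), getD_map (by omega)]
  exact rank_lt_iff (List.mem_toFinset.2 (getD_mem (by omega)))
    (List.mem_toFinset.2 (getD_mem (by omega)))

theorem mem_desB_stB {c : List ℤ} (hc : (c.map (|·|)).Nodup) {i : ℕ} : i ∈ desB _ (stB c).2 ↔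
    i < c.length ∧ c.getD i 0 < (0 :: c).getD i 0 := by
  rw [mem_desB, wordB_stB hc, stB_fst]
  refine and_congr_right fun h => ?_
  have hmem : ∀ j, j < c.length → |c.getD j 0| ∈ (c.map (|·|)).toFinset := fun j hj =>
    List.mem_toFinset.2 (List.mem_map_of_mem (getD_mem hj))
  rw [getD_map h]
  rcases i with _ | i
  · exact oddExt_neg_iff (rank_pos (hmem 0 h))
  · rw [List.getD_cons_succ, List.getD_cons_succ, getD_map (by omega)]
    exact (oddExt_rank_strictMonoOn _).lt_iff_lt (hmem _ h) (hmem _ (by omega))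

theorem getD_take {c : List ℤ} {m i : ℕ} (h : i < m) : (c.take m).getD i 0 = c.getD i 0 := by
  rw [List.getD_eq_getElem?_getD, List.getElem?_take_of_lt h, List.getD_eq_getElem?_getD]

theorem getD_drop {c : List ℤ} {m i : ℕ} : (c.drop m).getD i 0 = c.getD (m + i) 0 := by
  rw [List.getD_eq_getElem?_getD, List.getElem?_drop, List.getD_eq_getElem?_getD]

/-- Standardization preserves the comparison of adjacent letters, so the two segments see the
descents before and after m. The comparison across the junction m is seen by neither. -/
theorem desA_take {m n : ℕ} (w : SymGrp (m + n)) :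
    desA _ (stA (segment (wordA w) 0 m)).2 = (desA _ w).filter (· < m) := by
  ext i
  rw [Finset.mem_filter, segment, List.drop_zero,
    mem_desA_stA ((nodup_wordA w).sublist (List.take_sublist _ _)), mem_desA, List.length_take,
    length_wordA]
  by_cases hi : i < m
  · rw [getD_take hi, getD_take (by omega : i - 1 < m)]
    have : i < min m (m + n) ↔ i < m + n := by omega
    rw [this, and_iff_left hi]
  · constructor
    · rintro ⟨h, _⟩; omega
    · rintro ⟨_, h⟩; omega

theorem desA_drop {m n : ℕ} (w : SymGrp (m + n)) :
    desA _ (stA (segment (wordA w) m (m + n))).2 =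
      ((desA _ w).filter (m < ·)).image (· - m) := by
  have hseg : segment (wordA w) m (m + n) = (wordA w).drop m := by
    rw [segment, List.take_of_length_le (by simp)]
  ext i
  rw [hseg, mem_desA_stA ((nodup_wordA w).sublist (List.drop_sublist _ _)), List.length_drop,
    length_wordA, getD_drop, getD_drop]
  simp only [Finset.mem_image, Finset.mem_filter, mem_desA]
  constructor
  · rintro ⟨h, h'⟩
    refine ⟨m + i, ⟨⟨⟨by omega, by omega⟩, ?_⟩, by omega⟩, by omega⟩
    rwa [Nat.add_sub_assoc h.1]
  · rintro ⟨j, ⟨⟨h, h'⟩, hj⟩, rfl⟩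
    refine ⟨by omega, ?_⟩
    have e1 : m + (j - m) = j := by omega
    have e2 : m + (j - m - 1) = j - 1 := by omega
    rwa [e1, e2]

theorem desB_take {m n : ℕ} (w : HypGrp (m + n)) :
    desB _ (stB (segment (wordB w) 0 m)).2 = (desB _ w).filter (· < m) := by
  ext i
  rw [Finset.mem_filter, segment, List.drop_zero,
    mem_desB_stB ((nodup_wordB w).sublist ((List.take_sublist _ _).map _)), mem_desB,
    List.length_take, length_wordB]
  by_cases hi : i < m
  · have : i < min m (m + n) ↔ i < m + n := by omega
    have h2 : (0 :: (wordB w).take m).getD i 0 = (0 :: wordB w).getD i 0 := by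
      rcases i with _ | i
      · rfl
      · rw [List.getD_cons_succ, List.getD_cons_succ, getD_take (by omega)]
    rw [getD_take hi, h2, this, and_iff_left hi]
  · constructor
    · rintro ⟨h, _⟩; omega
    · rintro ⟨_, h⟩; omega

theorem desB_drop {m n : ℕ} (w : HypGrp (m + n)) :
    desA _ (stA (segment (wordB w) m (m + n))).2 =
      ((desB _ w).filter (m < ·)).image (· - m) := by
  have hseg : segment (wordB w) m (m + n) = (wordB w).drop m := by
    rw [segment, List.take_of_length_le (by simp)]
  ext i
  rw [hseg, mem_desA_stA ((nodup_wordB' w).sublist (List.drop_sublist _ _)), List.length_drop,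
    length_wordB, getD_drop, getD_drop]
  simp only [Finset.mem_image, Finset.mem_filter, mem_desB]
  constructor
  · rintro ⟨h, h'⟩
    refine ⟨m + i, ⟨⟨by omega, ?_⟩, by omega⟩, by omega⟩
    obtain ⟨k, rfl⟩ : ∃ k, i = k + 1 := ⟨i - 1, by omega⟩
    rw [← add_assoc, List.getD_cons_succ]
    exact h'
  · rintro ⟨j, ⟨⟨h, h'⟩, hj⟩, rfl⟩
    refine ⟨by omega, ?_⟩
    obtain ⟨k, rfl⟩ : ∃ k, j = k + 1 := ⟨j - 1, by omega⟩
    rw [List.getD_cons_succ] at h'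
    have e1 : m + (k + 1 - m) = k + 1 := by omega
    have e2 : m + (k + 1 - m - 1) = k := by omega
    rwa [e1, e2]

theorem pairwise_lt_iff_getD {c : List ℤ} (hc : c.Nodup) : c.Pairwise (· < ·) ↔
    ∀ i, i + 1 < c.length → ¬c.getD (i + 1) 0 < c.getD i 0 := by
  rw [← List.isChain_iff_pairwise, List.isChain_iff_getElem]
  refine forall_congr' fun i => forall_congr' fun hi => ?_
  rw [List.getD_eq_getElem _ _ hi, List.getD_eq_getElem _ _ (by omega), not_lt]
  refine ⟨fun h => h.le, fun h => h.lt_of_ne fun h2 => ?_⟩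
  have := hc.getElem_inj_iff.1 h2
  omega

theorem wordA_one_pairwise (n : ℕ) : (wordA (1 : SymGrp n)).Pairwise (· < ·) := by
  rw [wordA, List.pairwise_ofFn]
  intro i j hij
  have : (i : ℕ) < j := hij
  simpa using this

theorem desA_eq_empty_iff {n : ℕ} (w : SymGrp n) : desA n w = ∅ ↔ w = 1 := by
  have hw : desA n w = ∅ ↔ (wordA w).Pairwise (· < ·) := by
    rw [pairwise_lt_iff_getD (nodup_wordA w), Finset.eq_empty_iff_forall_notMem]
    constructor
    · intro h i hi h'
      exact h (i + 1) (mem_desA.2 ⟨⟨by omega, by simpa using hi⟩, h'⟩)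
    · intro h i hi
      rw [mem_desA] at hi
      obtain ⟨k, rfl⟩ : ∃ k, i = k + 1 := ⟨i - 1, by omega⟩
      exact h k (by simpa using hi.1.2) hi.2
  rw [hw]
  constructor
  · intro h
    have h2 := stA_of_pairwise h
    rw [stA_wordA, length_wordA] at h2
    simpa using h2
  · rintro rfl
    exact wordA_one_pairwise n

theorem stB_of_pairwise {c : List ℤ} (hc : c.Pairwise (· < ·)) (hpos : ∀ z ∈ c, 0 < z) :
    stB c = ⟨c.length, 1⟩ := by
  have hp : ∀ i, 0 < c.get i := fun i => hpos _ (List.get_mem _ _)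
  have hmono : Monotone (keyB c) := by
    intro i j hij
    rcases hij.lt_or_eq with h | rfl
    · have := List.pairwise_iff_get.1 hc i j h
      rw [keyB, keyB, Prod.Lex.toLex_le_toLex]
      left
      change |c.get i| < |c.get j|
      rwa [abs_of_pos (hp i), abs_of_pos (hp j)]
    · exact le_rfl
  rw [stB, Tuple.sort_eq_refl_iff_monotone.2 hmono]
  refine Sigma.ext rfl (heq_of_eq (HypGrp.ext_of fun i => ?_))
  change ((Equiv.refl _)⁻¹ i, false ^^ decide (c.get i < 0)) = (i, false)
  rw [decide_eq_false (not_lt.2 (hp i).le)]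
  rfl

theorem wordB_one_pairwise (n : ℕ) : (wordB (1 : HypGrp n)).Pairwise (· < ·) := by
  rw [wordB, List.pairwise_ofFn]
  intro i j hij
  have : (i : ℕ) < j := hij
  simpa [PM.val] using this

theorem wordB_one_pos {n : ℕ} {z : ℤ} (hz : z ∈ wordB (1 : HypGrp n)) : 0 < z := by
  obtain ⟨i, rfl⟩ := List.mem_ofFn.1 hz
  simp [PM.val]

/-- The convention w(0) = 0 makes a window without descents positive as well as increasing. -/
theorem desB_eq_empty_iff {n : ℕ} (w : HypGrp n) : desB n w = ∅ ↔ w = 1 := by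
  have hne : ∀ z ∈ wordB w, z ≠ 0 := by
    rintro z hz rfl
    have := mem_wordB hz
    simp at this
  have hw : desB n w = ∅ ↔ (0 :: wordB w).Pairwise (· < ·) := by
    rw [pairwise_lt_iff_getD (List.nodup_cons.2 ⟨fun h => hne 0 h rfl, nodup_wordB' w⟩),
      Finset.eq_empty_iff_forall_notMem]
    constructor
    · intro h i hi h'
      exact h i (mem_desB.2 ⟨by simpa using hi, h'⟩)
    · intro h i hi
      rw [mem_desB] at hi
      exact h i (by simpa using hi.1) hi.2
  rw [hw, List.pairwise_cons]
  constructor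
  · rintro ⟨hpos, h⟩
    have h1 := stB_of_pairwise h hpos
    rw [stB_wordB, length_wordB] at h1
    simpa using h1
  · rintro rfl
    exact ⟨fun z hz => wordB_one_pos hz, wordB_one_pairwise n⟩

theorem descClass_empty {W : ℕ → Type} [∀ n, Fintype (W n)] [∀ n, Group (W n)]
    {des : ∀ n, W n → Finset ℕ} (h : ∀ n w, des n w = ∅ ↔ w = 1) (n : ℕ) :
    descClass des n ∅ = bas ⟨n, 1⟩ := by
  classical
  rw [descClass]
  have : (Finset.univ.filter fun w : W n => des n w = ∅) = {1} := by
    ext w; simp [h]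
  rw [this, Finset.sum_singleton]

end DescentWords

/-! ## Descent classes span subobjects -/

section DescentClasses

/-! ### Degrees in tensor products -/

section Tensor

variable {R : Type} [CommRing R] {M A N B : Type} [AddCommGroup M] [AddCommGroup A]
  [AddCommGroup N] [AddCommGroup B] [Module R M] [Module R A] [Module R N] [Module R B]

theorem map_mem_tensorDeg {gM : ℕ → Submodule R M} {gA : ℕ → Submodule R A}
    {gN : ℕ → Submodule R N} {gB : ℕ → Submodule R B} {φ : M →ₗ[R] N} {f : A →ₗ[R] B} {k l m : ℕ}
    (hφ : ∀ n, ∀ x ∈ gM n, φ x ∈ gN (n + k)) (hf : ∀ n, ∀ a ∈ gA n, f a ∈ gB (n + l))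
    {t : M ⊗[R] A} (ht : t ∈ tensorDeg gM gA m) :
    TensorProduct.map φ f t ∈ tensorDeg gN gB (m + k + l) := by
  have : tensorDeg gM gA m ≤ (tensorDeg gN gB (m + k + l)).comap (TensorProduct.map φ f) := by
    refine tensorDeg_le fun i j hij x hx a ha => ?_
    rw [Submodule.mem_comap, TensorProduct.map_tmul]
    exact tmul_mem_tensorDeg (by omega) (hφ i x hx) (hf j a ha)
  exact this ht

theorem map₂_mem_tensorDeg {g : ℕ → Submodule R A} {F : A →ₗ[R] A →ₗ[R] A}
    (hF : ∀ m n, ∀ x ∈ g m, ∀ y ∈ g n, F x y ∈ g (m + n)) {m n : ℕ} {s t : A ⊗[R] A}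
    (hs : s ∈ tensorDeg g g m) (ht : t ∈ tensorDeg g g n) :
    TensorProduct.map₂ F F s t ∈ tensorDeg g g (m + n) := by
  have : tensorDeg g g m ≤
      (tensorDeg g g (m + n)).comap ((TensorProduct.map₂ F F).flip t) := by
    refine tensorDeg_le fun i j hij x hx a ha => ?_
    have : tensorDeg g g n ≤
        (tensorDeg g g (m + n)).comap (TensorProduct.map₂ F F (x ⊗ₜ a)) := by
      refine tensorDeg_le fun k l hkl y hy b hb => ?_
      rw [Submodule.mem_comap, TensorProduct.map₂_apply_tmul, TensorProduct.map_tmul]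
      exact tmul_mem_tensorDeg (by omega) (hF i k x hx y hy) (hF j l a ha b hb)
    exact this ht
  exact this hs

end Tensor

/-- The regular action and coaction. -/
def HopfOps.selfAct {A : Type} [AddCommGroup A] (H : HopfOps A) : ActOps A A := ⟨H.mul, H.comul⟩

variable {W : ℕ → Type} [∀ n, Fintype (W n)] {des : ∀ n, W n → Finset ℕ}

theorem descClass_mem_descSpan (n : ℕ) (I : Finset ℕ) : descClass des n I ∈ descSpan des n :=
  Submodule.subset_span ⟨I, rfl⟩

theorem sum_mem_descSpan {N : ℕ} (Q : Finset ℕ → Prop) [DecidablePred Q] :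
    ∑ w : W N with Q (des N w), bas ⟨N, w⟩ ∈ descSpan des N := by
  classical
  rw [← Finset.sum_fiberwise_of_maps_to (g := des N) (t := (Finset.univ.filter
    fun w => Q (des N w)).image (des N)) (fun w hw => Finset.mem_image_of_mem _ hw)]
  refine sum_mem fun I hI => ?_
  obtain ⟨w, hw, rfl⟩ := Finset.mem_image.1 hI
  rw [Finset.filter_filter]
  convert descClass_mem_descSpan N (des N w) using 1
  rw [descClass]
  refine Finset.sum_congr (Finset.filter_congr fun v _ => ?_) fun _ _ => rfl
  rw [and_iff_right_iff_imp]
  intro h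
  rw [h]
  exact (Finset.mem_filter.1 hw).2

/-- Different pairs (u, v) contribute disjoint sets of w, so summing over two descent classes only
leaves the conditions on the descent sets of `f w` and `g w`. -/
theorem sum_descClass_bilin {V U : ℕ → Type} [∀ n, Fintype (V n)] [∀ n, Fintype (U n)]
    {desV : ∀ n, V n → Finset ℕ} {m n N : ℕ} {F : FreeZ W →ₗ[ℤ] FreeZ V →ₗ[ℤ] FreeZ U}
    {f : U N → Σ n, W n} {g : U N → Σ n, V n} (hf : ∀ w, (f w).1 = m) (hg : ∀ w, (g w).1 = n)
    {_ : ∀ u v, DecidablePred fun w => f w = ⟨m, u⟩ ∧ g w = ⟨n, v⟩}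
    (hF : ∀ u v, F (bas ⟨m, u⟩) (bas ⟨n, v⟩) =
      ∑ w with f w = ⟨m, u⟩ ∧ g w = ⟨n, v⟩, bas ⟨N, w⟩) (I J : Finset ℕ) :
    F (descClass des m I) (descClass desV n J) =
      ∑ w with des _ (f w).2 = I ∧ desV _ (g w).2 = J, bas ⟨N, w⟩ := by
  classical
  rw [descClass, descClass, map_sum]
  simp only [map_sum, LinearMap.sum_apply, hF]
  rw [Finset.sum_comm, ← Finset.sum_product', ← Finset.sum_biUnion]
  · refine Finset.sum_congr ?_ fun _ _ => rfl
    ext w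
    simp only [Finset.mem_biUnion, Finset.mem_product, Finset.mem_filter, Finset.mem_univ, true_and]
    constructor
    · rintro ⟨p, ⟨rfl, rfl⟩, h1, h2⟩
      rw [h1, h2]
      exact ⟨rfl, rfl⟩
    · have hf := hf w
      have hg := hg w
      generalize f w = a at *
      generalize g w = b at *
      obtain ⟨_, a⟩ := a
      obtain ⟨_, b⟩ := b
      subst hf hg
      intro h
      exact ⟨(a, b), h, rfl, rfl⟩
  · intro p _ q _ hpq
    rw [Function.onFun, Finset.disjoint_left]
    intro w hw hw'
    obtain ⟨h1, h2⟩ := (Finset.mem_filter.1 hw).2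
    obtain ⟨h3, h4⟩ := (Finset.mem_filter.1 hw').2
    apply hpq
    rw [h1] at h3
    rw [h2] at h4
    exact Prod.ext (by simpa using h3) (by simpa using h4)

theorem act_mem_descSpan {T : ActOps (FreeZ W) ZS}
    (h : ∀ m n I J, T.gen.act (descClass des m I) (descClass desA n J) = ∑ w : W (m + n) with
      (des _ w).filter (· < m) = I ∧ ((des _ w).filter (m < ·)).image (· - m) = J, bas ⟨m + n, w⟩)
    (m n : ℕ) : ∀ x ∈ descSpan des m, ∀ a ∈ descSpan desA n,
      T.gen.act x a ∈ descSpan des (m + n) := by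
  intro x hx a ha
  refine map₂_mem_of_span ?_ hx ha
  rintro _ ⟨I, rfl⟩ _ ⟨J, rfl⟩
  exact (h m n I J) ▸ sum_mem_descSpan (des := des) fun K => K.filter (· < m) = I ∧
    (K.filter (m < ·)).image (· - m) = J

/-- The descent classes multiply by concatenation of descent sets, and the coactions of those
with empty descent set are as for products. -/
structure IsDescAct (des : ∀ n, W n → Finset ℕ) (T : ActOps (FreeZ W) ZS) : Prop where
  des_lt : ∀ n w, ∀ i ∈ des n w, i < n
  act : ∀ m n I J, T.gen.act (descClass des m I) (descClass desA n J) = ∑ w : W (m + n) with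
    (des _ w).filter (· < m) = I ∧ ((des _ w).filter (m < ·)).image (· - m) = J, bas ⟨m + n, w⟩
  coact_empty : ∀ n, T.gen.coact (descClass des n ∅) ∈ tensorDeg (descSpan des) (descSpan desA) n
  coact_act : ∀ m n x, T.gen.coact x ∈ tensorDeg (descSpan des) (descSpan desA) m →
    T.gen.coact (T.gen.act x (descClass desA n ∅)) ∈
      tensorDeg (descSpan des) (descSpan desA) (m + n)

/-- The descents before m are prescribed and there are none after m. Only the junction is free, and
it is either a descent or not. -/
theorem IsDescAct.act_inc {T : ActOps (FreeZ W) ZS} (h : IsDescAct des T) {m : ℕ} (n : ℕ)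
    {I : Finset ℕ} (hI : ∀ i ∈ I, i < m) :
    T.gen.act (descClass des m I) (descClass desA n ∅) =
      descClass des (m + n) I + descClass des (m + n) (insert m I) := by
  classical
  have hm : m ∉ I := fun hm => (hI m hm).false
  rw [h.act, descClass, descClass, ← Finset.sum_union]
  · refine Finset.sum_congr ?_ fun _ _ => rfl
    ext w
    simp only [Finset.mem_union, Finset.mem_filter, Finset.mem_univ, true_and,
      Finset.image_eq_empty, Finset.filter_eq_empty_iff, not_lt]
    generalize des (m + n) w = K
    constructor
    · rintro ⟨rfl, h2⟩
      by_cases hK : m ∈ K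
      · right
        ext i
        simp only [Finset.mem_insert, Finset.mem_filter]
        constructor
        · intro hi
          have := h2 hi
          rcases this.lt_or_eq with h3 | h3
          · exact Or.inr ⟨hi, h3⟩
          · exact Or.inl h3
        · rintro (rfl | h3)
          · exact hK
          · exact h3.1
      · left
        ext i
        simp only [Finset.mem_filter]
        refine ⟨fun hi => ⟨hi, (h2 hi).lt_of_ne ?_⟩, And.left⟩
        rintro rfl
        exact hK hi
    · rintro (rfl | rfl)
      · exact ⟨Finset.filter_true_of_mem hI, fun i hi => (hI i hi).le⟩
      · refine ⟨?_, fun i hi => ?_⟩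
        · ext i
          simp only [Finset.mem_insert, Finset.mem_filter]
          constructor
          · rintro ⟨rfl | h3, h4⟩
            · exact absurd h4 (lt_irrefl _)
            · exact h3
          · exact fun h3 => ⟨Or.inr h3, hI i h3⟩
        · rcases Finset.mem_insert.1 hi with rfl | h3
          · exact le_rfl
          · exact (hI i h3).le
  · rw [Finset.disjoint_left]
    intro w hw hw'
    rw [Finset.mem_filter] at hw hw'
    apply hm
    rw [← hw.2, hw'.2]
    exact Finset.mem_insert_self _ _

/-- Solving `act_inc` for the class of I ∪ {m} expresses it by a product with an identity
permutation and by the class of I. Both have known coactions, so induction on the maximum of the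
descent set applies. -/
theorem IsDescAct.coact_descClass {T : ActOps (FreeZ W) ZS} (h : IsDescAct des T) (I : Finset ℕ) :
    ∀ n, T.gen.coact (descClass des n I) ∈ tensorDeg (descSpan des) (descSpan desA) n := by
  induction I using Finset.induction_on_max with
  | empty => exact h.coact_empty
  | insert m I hI ih =>
    intro n
    rcases lt_or_ge m n with hn | hn
    · obtain ⟨k, rfl⟩ : ∃ k, n = m + k := ⟨n - m, by omega⟩
      have e : descClass des (m + k) (insert m I) =
          T.gen.act (descClass des m I) (descClass desA k ∅) - descClass des (m + k) I := by
        rw [h.act_inc k hI]; exact (add_sub_cancel_left _ _).symm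
      have e' := congrArg T.gen.coact e
      rw [map_sub] at e'
      rw [e']
      exact sub_mem (h.coact_act _ _ _ (ih m)) (ih _)
    -- No descent of an element of `W n` can be as large as n, so the class is empty.
    · have e : descClass des n (insert m I) = 0 := by
        rw [descClass, Finset.filter_false_of_mem, Finset.sum_empty]
        intro w _ hw
        have := h.des_lt n w m (hw ▸ Finset.mem_insert_self _ _)
        omega
      rw [e, map_zero]
      exact zero_mem _

theorem IsDescAct.coact_mem {T : ActOps (FreeZ W) ZS} (h : IsDescAct des T) (n : ℕ) :
    ∀ x ∈ descSpan des n, T.gen.coact x ∈ tensorDeg (descSpan des) (descSpan desA) n := by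
  intro x hx
  refine map_mem_of_span ?_ hx
  rintro _ ⟨I, rfl⟩
  exact h.coact_descClass I n

theorem bas_one_mem_descSpan {W : ℕ → Type} [∀ n, Fintype (W n)] [∀ n, Group (W n)]
    {des : ∀ n, W n → Finset ℕ} (h : ∀ n w, des n w = ∅ ↔ w = 1) (n : ℕ) :
    bas ⟨n, 1⟩ ∈ descSpan des n := descClass_empty h n ▸ descClass_mem_descSpan n ∅

theorem cupS_mul_descClass (m n : ℕ) (I J : Finset ℕ) :
    cupS.selfAct.gen.act (descClass desA m I) (descClass desA n J) = ∑ w : SymGrp (m + n) with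
      (desA _ w).filter (· < m) = I ∧ ((desA _ w).filter (m < ·)).image (· - m) = J,
      bas ⟨m + n, w⟩ := by
  refine (sum_descClass_bilin (F := cupS.mul)
    (f := fun w : SymGrp (m + n) => stA (segment (wordA w) 0 m))
    (g := fun w : SymGrp (m + n) => stA (segment (wordA w) m (m + n)))
    (fun w => fst_stA_segment _ (length_wordA _) (Nat.le_add_right m n))
    (fun w => (fst_stA_segment _ (length_wordA _) le_rfl).trans (Nat.add_sub_cancel_left m n))
    (fun u v => cupS_mul_bas ⟨m, u⟩ ⟨n, v⟩) I J).trans ?_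
  simp only [desA_take, desA_drop]

theorem cupB_act_descClass (m n : ℕ) (I J : Finset ℕ) :
    cupB.gen.act (descClass desB m I) (descClass desA n J) = ∑ w : HypGrp (m + n) with
      (desB _ w).filter (· < m) = I ∧ ((desB _ w).filter (m < ·)).image (· - m) = J,
      bas ⟨m + n, w⟩ := by
  refine (sum_descClass_bilin (F := cupB.act)
    (f := fun w : HypGrp (m + n) => stB (segment (wordB w) 0 m))
    (g := fun w : HypGrp (m + n) => stA (segment (wordB w) m (m + n)))
    (fun w => fst_stB_segment _ (length_wordB _) (Nat.le_add_right m n))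
    (fun w => (fst_stA_segment _ (length_wordB _) le_rfl).trans (Nat.add_sub_cancel_left m n))
    (fun u v => cupB_act_bas ⟨m, u⟩ ⟨n, v⟩) I J).trans ?_
  simp only [desB_take, desB_drop]

theorem segment_sublist (c : List ℤ) (i j : ℕ) : (segment c i j).Sublist c :=
  (List.drop_sublist _ _).trans (List.take_sublist _ _)

theorem bas_of_eq {W : ℕ → Type} [∀ n, Group (W n)] {u : Σ n, W n} {k n : ℕ} (h : u = ⟨k, 1⟩)
    (hn : u.1 = n) : bas (invS u) = bas ⟨n, 1⟩ := by
  subst h hn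
  rw [invS, inv_one]

/-- The class is the identity permutation. All segments of its word are increasing, so its coproduct
consists of tensors of identities. -/
theorem cupS_comul_empty (n : ℕ) : cupS.selfAct.gen.coact (descClass desA n ∅) ∈
    tensorDeg (descSpan desA) (descSpan desA) n := by
  have hmem := bas_one_mem_descSpan (des := desA) fun _ w => desA_eq_empty_iff w
  rw [descClass_empty fun _ w => desA_eq_empty_iff w]
  have h1 : ∀ i j, stA (segment (wordA (1 : SymGrp n)⁻¹) i j) = ⟨_, 1⟩ := fun i j =>
    stA_of_pairwise ((inv_one (G := SymGrp n)).symm ▸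
      (wordA_one_pairwise n).sublist (segment_sublist _ i j))
  refine (cupS_comul_bas ⟨n, 1⟩).symm ▸ sum_mem fun i hi => ?_
  have hi : i ≤ n := by simpa [Nat.lt_succ_iff] using hi
  have h2 := stA_restrictTo (1 : SymGrp n) (Nat.zero_le i) hi
  rw [zero_add] at h2
  rw [h2, stA_restrictTo (1 : SymGrp n) hi le_rfl,
    bas_of_eq (h1 _ _) (fst_stA_segment _ (length_wordA _) hi),
    bas_of_eq (h1 _ _) (fst_stA_segment _ (length_wordA _) le_rfl)]
  exact tmul_mem_tensorDeg (by omega) (hmem _) (hmem _)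

theorem cupB_coact_empty (n : ℕ) : cupB.gen.coact (descClass desB n ∅) ∈
    tensorDeg (descSpan desB) (descSpan desA) n := by
  have hmem := bas_one_mem_descSpan (des := desA) fun _ w => desA_eq_empty_iff w
  have hmem' := bas_one_mem_descSpan (des := desB) fun _ w => desB_eq_empty_iff w
  rw [descClass_empty fun _ w => desB_eq_empty_iff w]
  have h1 : ∀ i j, stA (segment (wordB (1 : HypGrp n)⁻¹) i j) = ⟨_, 1⟩ := fun i j =>
    stA_of_pairwise ((inv_one (G := HypGrp n)).symm ▸
      (wordB_one_pairwise n).sublist (segment_sublist _ i j))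
  have h2 : ∀ i j, stB (segment (wordB (1 : HypGrp n)⁻¹) i j) = ⟨_, 1⟩ := fun i j => by
    rw [inv_one]
    exact stB_of_pairwise ((wordB_one_pairwise n).sublist (segment_sublist _ i j))
      fun z hz => wordB_one_pos ((segment_sublist _ i j).subset hz)
  refine (cupB_coact_bas ⟨n, 1⟩).symm ▸ sum_mem fun i hi => ?_
  have hi : i ≤ n := by simpa [Nat.lt_succ_iff] using hi
  rw [stB_restrictTo (1 : HypGrp n) hi, stA_restrictTo_hat (1 : HypGrp n) hi le_rfl,
    bas_of_eq (h2 _ _) (fst_stB_segment _ (length_wordB _) hi),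
    bas_of_eq (h1 _ _) (fst_stA_segment _ (length_wordB _) le_rfl)]
  exact tmul_mem_tensorDeg (by omega) (hmem' _) (hmem _)

/-- In type A the condition on coactions of products is the multiplicativity of the coproduct. -/
theorem cupS_isDescAct : IsDescAct desA cupS.selfAct where
  des_lt n w i hi := (mem_desA.1 hi).1.2
  act := cupS_mul_descClass
  coact_empty := cupS_comul_empty
  coact_act m n x hx := by
    have h := cupS_isBi.comul_mul x (descClass desA n ∅)
    exact h.symm ▸ map₂_mem_tensorDeg (act_mem_descSpan cupS_mul_descClass) hx (cupS_comul_empty n)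

/-- In type B the formula for the coaction of a product with an identity permutation takes the place
of the bialgebra axiom; its outer multiplications by identities preserve the span of the type A
descent classes. -/
theorem cupB_isDescAct : IsDescAct desB cupB where
  des_lt n w i hi := (mem_desB.1 hi).1
  act := cupB_act_descClass
  coact_empty := cupB_coact_empty
  coact_act m n x hx := by
    have hmem := bas_one_mem_descSpan (des := desA) fun _ w => desA_eq_empty_iff w
    rw [descClass_empty fun _ w => desA_eq_empty_iff w, cupB_coact_act_one]
    refine sum_mem fun i hi => sum_mem fun j hj => ?_
    rw [Finset.mem_range] at hi hj
    have e : m + n = m + j + (i + (n - i - j)) := by omega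
    rw [e]
    refine map_mem_tensorDeg (fun k y hy => ?_) (fun k a ha => ?_) hx
    · exact act_mem_descSpan cupB_act_descClass k j y hy _ (hmem j)
    · have h1 := act_mem_descSpan cupS_mul_descClass i k _ (hmem i) a ha
      have h2 := act_mem_descSpan cupS_mul_descClass _ (n - i - j) _ h1 _ (hmem (n - i - j))
      have e : i + k + (n - i - j) = k + (i + (n - i - j)) := by omega
      exact e ▸ h2

end DescentClasses

/-! ## Induced structures on submodules, quotients and images -/

section Induced

variable {R : Type} [CommRing R]
variable {M M' N A A' B : Type} [AddCommGroup M] [AddCommGroup M'] [AddCommGroup N]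
  [AddCommGroup A] [AddCommGroup A'] [AddCommGroup B] [Module R M] [Module R M'] [Module R N]
  [Module R A] [Module R A'] [Module R B]

/-- The bialgebra structure maps with given regular action and coaction, unit and counit. -/
def Act.toOps (T : Act R A A) (e : A) (ε : A →ₗ[R] R) : Ops R A := ⟨T.act, e, T.coact, ε⟩

theorem IsActHom.isOpsHom {H : Ops R A} {H' : Ops R A'} {f : A →ₗ[R] A'}
    (h : IsActHom H.self H'.self f f) (h1 : f H.one = H'.one)
    (h2 : ∀ a, H'.counit (f a) = H.counit a) : IsOpsHom H H' f :=
  ⟨h1, h.map_act, h2, h.map_coact⟩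

/-- Image factorization: if a morphism is a surjection followed by an injection, the intermediate
module carries a structure for which both maps are morphisms. This provides the structure on Λ. -/
theorem exists_sub_act_of_comp {T : Act R M A} {T' : Act R M' A'} {c : A →ₗ[R] B} {f : B →ₗ[R] A'}
    {γ : M →ₗ[R] N} {φ : N →ₗ[R] M'} (hc : Function.Surjective c) (hγ : Function.Surjective γ)
    (hφ : Function.Injective φ) (hφf : Function.Injective (TensorProduct.map φ f))
    (h : IsActHom T T' (f ∘ₗ c) (φ ∘ₗ γ)) :
    ∃ U : Act R N B, IsActHom U T' f φ ∧ IsActHom T U c γ := by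
  have hcomp : ∀ t, TensorProduct.map (φ ∘ₗ γ) (f ∘ₗ c) t =
      TensorProduct.map φ f (TensorProduct.map γ c t) := fun t => by
    rw [TensorProduct.map_comp, LinearMap.comp_apply]
  obtain ⟨U, hU⟩ := exists_sub_act (T' := T') hφ hφf
    (fun x a => by
      obtain ⟨x, rfl⟩ := hγ x
      obtain ⟨a, rfl⟩ := hc a
      exact ⟨γ (T.act x a), h.map_act x a⟩)
    (fun x => by
      obtain ⟨x, rfl⟩ := hγ x
      exact ⟨TensorProduct.map γ c (T.coact x), ((h.map_coact x).trans (hcomp _)).symm⟩)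
  refine ⟨U, hU, fun x a => hφ ?_, fun x => hφf ?_⟩
  · rw [hU.map_act]; exact h.map_act x a
  · rw [← hU.map_coact, ← hcomp]; exact h.map_coact x

theorem exists_sub_ops_of_comp {H : Ops R A} {H' : Ops R A'} {c : A →ₗ[R] B} {f : B →ₗ[R] A'}
    (hc : Function.Surjective c) (hf : Function.Injective f)
    (hff : Function.Injective (TensorProduct.map f f)) (h : IsOpsHom H H' (f ∘ₗ c)) :
    ∃ U : Ops R B, IsOpsHom U H' f ∧ IsOpsHom H U c := by
  obtain ⟨U, h1, h2⟩ := exists_sub_act_of_comp hc hc hf hff h.self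
  exact ⟨U.toOps (c H.one) (H'.counit ∘ₗ f), ⟨h.map_one, h1.map_act, fun _ => rfl, h1.map_coact⟩,
    ⟨rfl, h2.map_act, h.map_counit, h2.map_coact⟩⟩

theorem IsActHom.comp {T : Act R M A} {T' : Act R M' A'} {U : Act R N B} {f : A →ₗ[R] A'}
    {φ : M →ₗ[R] M'} {g : A' →ₗ[R] B} {ψ : M' →ₗ[R] N} (h : IsActHom T T' f φ)
    (h' : IsActHom T' U g ψ) : IsActHom T U (g ∘ₗ f) (ψ ∘ₗ φ) where
  map_act x a := by
    rw [LinearMap.comp_apply, h.map_act, h'.map_act]; rfl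
  map_coact x := by
    rw [LinearMap.comp_apply, h'.map_coact, h.map_coact, TensorProduct.map_comp,
      LinearMap.comp_apply]

theorem IsOpsHom.comp {H : Ops R A} {H' : Ops R A'} {U : Ops R B} {f : A →ₗ[R] A'}
    {g : A' →ₗ[R] B} (h : IsOpsHom H H' f) (h' : IsOpsHom H' U g) : IsOpsHom H U (g ∘ₗ f) :=
  (h.self.comp h'.self).isOpsHom (by rw [LinearMap.comp_apply, h.map_one, h'.map_one])
    (fun a => by rw [LinearMap.comp_apply, h'.map_counit, h.map_counit])

theorem IsActHom.unique_of_injective {T U : Act R M A} {T' : Act R M' A'} {f : A →ₗ[R] A'}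
    {φ : M →ₗ[R] M'} (hφ : Function.Injective φ)
    (hφf : Function.Injective (TensorProduct.map φ f)) (h : IsActHom T T' f φ)
    (h' : IsActHom U T' f φ) : T = U := by
  obtain ⟨t, t'⟩ := T
  obtain ⟨u, u'⟩ := U
  congr
  · exact LinearMap.ext₂ fun x a => hφ ((h.map_act x a).trans (h'.map_act x a).symm)
  · exact LinearMap.ext fun x => hφf ((h.map_coact x).symm.trans (h'.map_coact x))

theorem IsActHom.unique_of_surjective {T : Act R M A} {T' U' : Act R M' A'} {f : A →ₗ[R] A'}
    {φ : M →ₗ[R] M'} (sφ : Function.Surjective φ) (sf : Function.Surjective f)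
    (h : IsActHom T T' f φ) (h' : IsActHom T U' f φ) : T' = U' := by
  obtain ⟨t, t'⟩ := T'
  obtain ⟨u, u'⟩ := U'
  congr
  · refine LinearMap.ext₂ fun x a => ?_
    obtain ⟨x, rfl⟩ := sφ x
    obtain ⟨a, rfl⟩ := sf a
    exact (h.map_act x a).symm.trans (h'.map_act x a)
  · refine LinearMap.ext fun x => ?_
    obtain ⟨x, rfl⟩ := sφ x
    exact (h.map_coact x).trans (h'.map_coact x).symm

theorem Ops.ext_self {H H' : Ops R A} (h : H.self = H'.self) (h1 : H.one = H'.one)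
    (h2 : H.counit = H'.counit) : H = H' := by
  obtain ⟨a, b, c, d⟩ := H
  obtain ⟨a', b', c', d'⟩ := H'
  have e1 : a = a' := congrArg Act.act h
  have e2 : c = c' := congrArg Act.coact h
  have e3 : b = b' := h1
  have e4 : d = d' := h2
  rw [e1, e2, e3, e4]

theorem IsOpsHom.unique_of_injective {H U : Ops R A} {H' : Ops R A'} {f : A →ₗ[R] A'}
    (hf : Function.Injective f) (hff : Function.Injective (TensorProduct.map f f))
    (h : IsOpsHom H H' f) (h' : IsOpsHom U H' f) : H = U :=
  Ops.ext_self (h.self.unique_of_injective hf hff h'.self) (hf (h.map_one.trans h'.map_one.symm))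
    (LinearMap.ext fun a => (h.map_counit a).symm.trans (h'.map_counit a))

theorem IsOpsHom.unique_of_surjective {H : Ops R A} {H' U' : Ops R A'} {f : A →ₗ[R] A'}
    (sf : Function.Surjective f) (h : IsOpsHom H H' f) (h' : IsOpsHom H U' f) : H' = U' :=
  Ops.ext_self (h.self.unique_of_surjective sf sf h'.self) (h.map_one.symm.trans h'.map_one)
    (LinearMap.ext fun a => by
      obtain ⟨a, rfl⟩ := sf a
      exact (h.map_counit a).trans (h'.map_counit a).symm)

/-- The homogeneity of a coaction can be checked after an embedding. -/
theorem IsActHom.coact_mem_of_injective {T : Act R M A} {T' : Act R M' A'} {f : A →ₗ[R] A'}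
    {φ : M →ₗ[R] M'} (h : IsActHom T T' f φ) (hφf : Function.Injective (TensorProduct.map φ f))
    {gM : ℕ → Submodule R M} {gA : ℕ → Submodule R A} {gM' : ℕ → Submodule R M'}
    {gA' : ℕ → Submodule R A'} (hM : ∀ n, gM' n ≤ (gM n).map φ) (hA : ∀ n, gA' n ≤ (gA n).map f)
    {n : ℕ} {x : M} (hx : T'.coact (φ x) ∈ tensorDeg gM' gA' n) :
    T.coact x ∈ tensorDeg gM gA n := by
  have : tensorDeg gM' gA' n ≤ (tensorDeg gM gA n).map (TensorProduct.map φ f) := by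
    refine tensorDeg_le fun i j hij y hy a ha => ?_
    obtain ⟨y, hy', rfl⟩ := hM i hy
    obtain ⟨a, ha', rfl⟩ := hA j ha
    exact ⟨y ⊗ₜ a, tmul_mem_tensorDeg hij hy' ha', TensorProduct.map_tmul _ _ _ _⟩
  obtain ⟨t, ht, htx⟩ := this hx
  rw [h.map_coact] at htx
  exact hφf htx ▸ ht

end Induced

/-! ### Embeddings and dual quotients over a principal ideal domain -/

section Domain

variable {R : Type} [CommRing R] [IsDomain R] [IsPrincipalIdealRing R]
variable {M M' A A' P C : Type} [AddCommGroup M] [AddCommGroup M'] [AddCommGroup A]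
  [AddCommGroup A'] [AddCommGroup P] [AddCommGroup C] [Module R M] [Module R M'] [Module R A]
  [Module R A'] [Module R P] [Module R C]

theorem map_injective [Module.IsTorsionFree R M'] [Module.IsTorsionFree R A]
    {φ : M →ₗ[R] M'} {f : A →ₗ[R] A'} (hφ : Function.Injective φ) (hf : Function.Injective f) :
    Function.Injective (TensorProduct.map φ f) := by
  have : Module.Flat R M' := flat_of_isTorsionFree
  have : Module.Flat R A := flat_of_isTorsionFree
  exact TensorProduct.map_injective_of_flat_flat φ f hφ hf

/-- The quotient of a self-dual structure by the annihilator of a substructure. -/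
theorem exists_quot_act_of_dual [Module.IsTorsionFree R M'] [Module.IsTorsionFree R A']
    {S : Act R P C} {T : Act R M A} {ι : P →ₗ[R] M} {j : C →ₗ[R] A} (h : IsActHom S T j ι)
    {φ : M →ₗ[R] M'} {f : A →ₗ[R] A'} (sφ : Function.Surjective φ) (sf : Function.Surjective f)
    {p : M →ₗ[R] M →ₗ[R] R} {q : A →ₗ[R] A →ₗ[R] R} (hT : IsActDual T T p q)
    (hp : ∀ x y, p x y = p y x) (hq : ∀ x y, q x y = q y x)
    {e : P →ₗ[R] M' →ₗ[R] R} {d : C →ₗ[R] A' →ₗ[R] R} (he : ∀ s x, e s (φ x) = p (ι s) x)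
    (hd : ∀ s x, d s (f x) = q (j s) x) (se : ∀ y, (∀ s, e s y = 0) → y = 0)
    (sd : ∀ y, (∀ s, d s y = 0) → y = 0) : ∃ T' : Act R M' A', IsActHom T T' f φ := by
  -- Paired with the substructure, the class of x · a depends only on the classes of x and a,
  -- because the coaction of s stays inside the substructure.
  have key : ∀ s x a, e s (φ (T.act x a)) = pairT e d (S.coact s) (φ x ⊗ₜ f a) := by
    intro s x a
    have h1 := pairT_map p q e d ι LinearMap.id LinearMap.id φ j LinearMap.id LinearMap.id f
      (fun x y => (he x y).symm) (fun x y => (hd x y).symm) (S.coact s) (x ⊗ₜ[R] a)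
    simp only [TensorProduct.map_id, LinearMap.id_apply, TensorProduct.map_tmul] at h1
    rw [he, hT.coact_act, h.map_coact, h1]
  refine exists_quot_act sφ sf (fun x a hx => se _ fun s => ?_) (fun x a ha => se _ fun s => ?_)
    fun x hx => ?_
  · rw [key, hx, TensorProduct.zero_tmul, pairT, map_zero, map_zero]
  · rw [key, ha, TensorProduct.tmul_zero, pairT, map_zero, map_zero]
  -- The image of the coaction of x is tested against pure tensors s ⊗ b from the substructure.
  -- There it equals the pairing of x with s · b, which is again in the substructure and so
  -- annihilates x.
  · refine pairT_separating e.flip d.flip se sd _ fun s b => ?_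
    have h1 := pairT_map e.flip d.flip p q φ LinearMap.id LinearMap.id ι f LinearMap.id
      LinearMap.id j (fun x y => (he y x).trans (hp _ _)) (fun x y => (hd y x).trans (hq _ _))
      (T.coact x) (s ⊗ₜ[R] b)
    simp only [TensorProduct.map_id, LinearMap.id_apply, TensorProduct.map_tmul] at h1
    rw [h1, ← hT.coact_act, hp, ← h.map_act, ← he, hx, map_zero]

theorem exists_quot_ops_of_dual [Module.IsTorsionFree R A']
    {S : Ops R C} {H : Ops R A} {j : C →ₗ[R] A} (h : IsOpsHom S H j) {f : A →ₗ[R] A'}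
    (sf : Function.Surjective f) {q : A →ₗ[R] A →ₗ[R] R} (hH : IsDual H H q)
    (hq : ∀ x y, q x y = q y x) {d : C →ₗ[R] A' →ₗ[R] R} (hd : ∀ s x, d s (f x) = q (j s) x)
    (sd : ∀ y, (∀ s, d s y = 0) → y = 0) : ∃ H' : Ops R A', IsOpsHom H H' f := by
  obtain ⟨T', hT'⟩ := exists_quot_act_of_dual h.self sf sf hH.self hq hq hd hd sd sd
  obtain ⟨ε, hε⟩ := exists_factor_of_surjective sf H.counit (fun x hx => by
    rw [← hH.one_counit, ← h.map_one, ← hd, hx, map_zero])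
  exact ⟨T'.toOps (f H.one) ε, rfl, hT'.map_act, hε, hT'.map_coact⟩

end Domain

/-! ## The maps of the diamond -/

section Diamond

variable {W : ℕ → Type} [∀ n, Fintype (W n)] {des : ∀ n, W n → Finset ℕ}

theorem descSpan_le_freeGrade (n : ℕ) : descSpan des n ≤ freeGrade W n := by
  refine Submodule.span_le.2 ?_
  rintro _ ⟨I, rfl⟩
  exact sum_bas_mem_freeGrade _

theorem descSpan_le_Sig (n : ℕ) : descSpan des n ≤ Sig des := le_iSup (descSpan des) n

theorem isInternal_sigGrade : DirectSum.IsInternal (sigGrade des) :=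
  isInternal_comap_iSup isInternal_freeGrade descSpan_le_freeGrade rfl

theorem descSpan_le_map (n : ℕ) : descSpan des n ≤ (sigGrade des n).map (Sig des).subtype :=
  fun x hx => ⟨⟨x, descSpan_le_Sig n hx⟩, hx, rfl⟩

theorem finite_sigGrade (n : ℕ) : Module.Finite ℤ (sigGrade des n) := by
  have : Module.Finite ℤ (freeGrade W n) := Module.Finite.span_of_finite ℤ (Set.finite_range _)
  let e : sigGrade des n →ₗ[ℤ] descSpan des n :=
    (Submodule.comapSubtypeEquivOfLe (descSpan_le_Sig n)).toLinearMap
  have he : Function.Injective e :=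
    (Submodule.comapSubtypeEquivOfLe (descSpan_le_Sig (des := des) n)).injective
  let i : descSpan des n →ₗ[ℤ] freeGrade W n := Submodule.inclusion (descSpan_le_freeGrade n)
  have hi : Function.Injective i := Submodule.inclusion_injective _
  exact Module.Finite.of_injective (i ∘ₗ e) (hi.comp he)

theorem free_sigGrade (n : ℕ) : Module.Free ℤ (sigGrade des n) := by
  have := finite_sigGrade (des := des) n
  exact Module.free_of_finite_type_torsion_free'

theorem isGradedPerfect_evalPair :
    IsGradedPerfect (sigGrade des) (gradedDualGrade (sigGrade des)) (evalPair des) :=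
  isGradedPerfect_gradedDual isInternal_sigGrade free_sigGrade finite_sigGrade

theorem evalPair_separating (y : SigDual des) (h : ∀ s, evalPair des s y = 0) : y = 0 :=
  Subtype.ext (LinearMap.ext h)

theorem sig_ext {N : Type} [AddCommGroup N] {F G : Sig des →ₗ[ℤ] N} {n : ℕ}
    (h : ∀ I, F (descElt des n I) = G (descElt des n I)) {x : Sig des} (hx : x ∈ sigGrade des n) :
    F x = G x := by
  have h1 : (Submodule.span ℤ (Set.range (descElt des n))).map (Sig des).subtype =
      descSpan des n := by
    rw [Submodule.map_span, ← Set.range_comp]; rfl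
  have h2 : x ∈ Submodule.span ℤ (Set.range (descElt des n)) := by
    have h3 : (Sig des).subtype x ∈ (Submodule.span ℤ (Set.range (descElt des n))).map
      (Sig des).subtype := h1 ▸ hx
    obtain ⟨y, hy, hyx⟩ := h3
    rwa [(Sig des).subtype_injective hyx] at hy
  refine LinearMap.eqOn_span' (f := F) (g := G) ?_ h2
  rintro _ ⟨I, rfl⟩
  exact h I

variable [∀ n, Group (W n)]

/-- This is the statement that ι and χ' are transposes of each other. The symmetry of `deltaInv`
moves the inversion from one argument to the other. -/
theorem evalPair_chi' (s : Sig des) (x : FreeZ W) :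
    evalPair des s (chi' des x) = deltaInv W ((Sig des).subtype s) x := by
  have h1 : ∀ y, evalPair des s (chi des y) = delta W y ((Sig des).subtype s) := by
    intro y
    refine freeZ_induction y ?_ (fun u => ?_) (fun x y hx hy => ?_) (fun x hx => ?_)
    · simp only [map_zero, LinearMap.zero_apply]
    · rw [chi, linearCombination_bas]; rfl
    · simp only [map_add, LinearMap.add_apply, hx, hy]
    · simp only [map_neg, LinearMap.neg_apply, hx]
  rw [deltaInv_symm]
  exact h1 (invMap W x)

theorem chi'_mem (n : ℕ) : ∀ x ∈ freeGrade W n, chi' des x ∈ gradedDualGrade (sigGrade des) n := by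
  intro x hx m hm s hs
  have h1 := evalPair_chi' s x
  exact h1.trans (isGradedPerfect_deltaInv.orthogonal m n hm _ (descSpan_le_freeGrade m hs) _ hx)

theorem deltaInv_bas_descClass (u : Σ n, W n) (n : ℕ) (I : Finset ℕ)
    [Decidable (u.1 = n ∧ des u.1 u.2⁻¹ = I)] :
    deltaInv W (bas u) (descClass des n I) = if u.1 = n ∧ des u.1 u.2⁻¹ = I then 1 else 0 := by
  classical
  change delta W (invMap W (bas u)) _ = _
  rw [invMap_bas, delta_bas_left, descClass, sum_bas_apply n (fun z => des z.1 z.2 = I)]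
  exact if_congr Iff.rfl rfl rfl

/-- Choose an element with each occurring descent set. The images of their inverses under χ' form
the dual basis of the nonzero descent classes. -/
theorem chi'_graded_surjective (n : ℕ) :
    ∀ f ∈ gradedDualGrade (sigGrade des) n, ∃ x ∈ freeGrade W n, chi' des x = f := by
  classical
  intro f hf
  let Is : Finset (Finset ℕ) := Finset.univ.image (des n)
  have hex : ∀ I, ∃ w : W n, I ∈ Is → des n w = I := by
    intro I
    by_cases hI : I ∈ Is
    · obtain ⟨w, _, hw⟩ := Finset.mem_image.1 hI
      exact ⟨w, fun _ => hw⟩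
    · exact ⟨1, fun h => absurd h hI⟩
  choose w hw using hex
  -- The inverse of `w I` appears because χ' inverts before pairing.
  let x : FreeZ W := ∑ I ∈ Is, f.1 (descElt des n I) • bas ⟨n, (w I)⁻¹⟩
  have hx : x ∈ freeGrade W n :=
    sum_mem fun I _ => Submodule.smul_mem _ _ (bas_mem_freeGrade ⟨n, (w I)⁻¹⟩)
  refine ⟨x, hx, ?_⟩
  apply Subtype.ext
  refine internal_ext (internal_iSup isInternal_sigGrade) fun m s hs => ?_
  by_cases hm : m = n
  · subst hm
    refine sig_ext (fun J => ?_) hs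
    have h1 : (chi' des x).1 (descElt des m J) = deltaInv W x (descClass des m J) :=
      (evalPair_chi' _ _).trans (deltaInv_symm _ _)
    rw [h1, map_sum, LinearMap.sum_apply]
    have h2 : ∀ I ∈ Is, deltaInv W (f.1 (descElt des m I) • bas ⟨m, (w I)⁻¹⟩) (descClass des m J) =
        if I = J then f.1 (descElt des m I) else 0 := by
      intro I hI
      rw [map_zsmul, LinearMap.smul_apply, deltaInv_bas_descClass, inv_inv, hw I hI]
      simp
    rw [Finset.sum_congr rfl h2, Finset.sum_ite_eq' Is J]
    split_ifs with hJ
    · rfl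
    · have : descElt des m J = 0 := by
        apply Subtype.ext
        change descClass des m J = 0
        rw [descClass, Finset.filter_false_of_mem, Finset.sum_empty]
        intro v _ hv
        exact hJ (Finset.mem_image.2 ⟨v, Finset.mem_univ _, hv⟩)
      rw [this, map_zero]
  · rw [hf m hm s hs]
    exact chi'_mem n x hx m hm s hs

theorem chi'_surjective : Function.Surjective (chi' des) := by
  rw [← LinearMap.range_eq_top, eq_top_iff,
    ← internal_iSup (isInternal_gradedDualGrade (isInternal_sigGrade (des := des)))]
  refine iSup_le fun n f hf => ?_
  obtain ⟨x, _, hx⟩ := chi'_graded_surjective n f hf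
  exact ⟨x, hx⟩

theorem chiSig_surjective : Function.Surjective (chiSig des) :=
  LinearMap.submoduleMap_surjective _ _

theorem isInternal_lamGrade : DirectSum.IsInternal (lamGrade des) := by
  refine isInternal_comap_iSup (h := fun n => (descSpan des n).map (chi' des))
    (isInternal_gradedDualGrade isInternal_sigGrade) (fun n => ?_) (Submodule.map_iSup _ _)
  rw [Submodule.map_le_iff_le_comap]
  exact fun x hx => chi'_mem n x (descSpan_le_freeGrade n hx)

theorem chiSig_mem (n : ℕ) : ∀ s ∈ sigGrade des n, chiSig des s ∈ lamGrade des n :=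
  fun s hs => ⟨s.1, hs, rfl⟩

theorem chiSig_graded_surjective (n : ℕ) :
    ∀ l ∈ lamGrade des n, ∃ s ∈ sigGrade des n, chiSig des s = l := by
  rintro l ⟨x, hx, hxl⟩
  exact ⟨⟨x, descSpan_le_Sig n hx⟩, hx, Subtype.ext hxl⟩

theorem subtype_lam_mem (n : ℕ) :
    ∀ l ∈ lamGrade des n, (Lam des).subtype l ∈ gradedDualGrade (sigGrade des) n := by
  rintro l ⟨x, hx, hxl⟩
  exact hxl ▸ chi'_mem n x (descSpan_le_freeGrade n hx)

/-- The bilinear form on `Λ` that is induced by the pairing of `Σ` and `Σ^*`. -/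
theorem exists_lamForm : ∃ b : Lam des →ₗ[ℤ] Lam des →ₗ[ℤ] ℤ,
    ∀ s l, b (chiSig des s) l = evalPair des s ((Lam des).subtype l) := by
  obtain ⟨b, hb⟩ := exists_factor_of_surjective chiSig_surjective
    ((evalPair des).compl₁₂ LinearMap.id (Lam des).subtype) (fun s hs => by
      refine LinearMap.ext fun l => ?_
      obtain ⟨t, rfl⟩ := chiSig_surjective l
      -- Well-definedness in the first argument: by symmetry of the pairing, s and t can be
      -- exchanged, and the right side is zero when χ' kills s.
      have h1 : evalPair des s (chi' des ((Sig des).subtype t)) =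
          evalPair des t ((Lam des).subtype (chiSig des s)) := by
        rw [evalPair_chi', deltaInv_symm, ← evalPair_chi']; rfl
      rw [hs] at h1
      exact h1.trans (map_zero _))
  exact ⟨b, fun s l => LinearMap.congr_fun (hb s) l⟩

variable {b : Lam des →ₗ[ℤ] Lam des →ₗ[ℤ] ℤ}

theorem lamForm_chiSig (hb : ∀ s l, b (chiSig des s) l = evalPair des s ((Lam des).subtype l))
    (s t : Sig des) : b (chiSig des s) (chiSig des t) =
      deltaInv W ((Sig des).subtype s) ((Sig des).subtype t) :=
  (hb _ _).trans (evalPair_chi' _ _)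

theorem lamForm_symm (hb : ∀ s l, b (chiSig des s) l = evalPair des s ((Lam des).subtype l))
    (x y : Lam des) : b x y = b y x := by
  obtain ⟨s, rfl⟩ := chiSig_surjective x
  obtain ⟨t, rfl⟩ := chiSig_surjective y
  rw [lamForm_chiSig hb, lamForm_chiSig hb, deltaInv_symm]

/-- Λ is contained in Σ^*, whose elements are separated by Σ; symmetry takes care of the other side.
-/
theorem lamForm_nondegenerate
    (hb : ∀ s l, b (chiSig des s) l = evalPair des s ((Lam des).subtype l)) : b.Nondegenerate := by
  have h : ∀ y, (∀ x, b x y = 0) → y = 0 := fun y hy =>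
    Subtype.ext (evalPair_separating _ fun s => (hb s y).symm.trans (hy _))
  exact ⟨fun x hx => h x fun y => (lamForm_symm hb _ _).trans (hx y), h⟩

theorem lamForm_isLamForm
    (hb : ∀ s l, b (chiSig des s) l = evalPair des s ((Lam des).subtype l)) : IsLamForm des b := by
  classical
  intro m n I J
  rw [lamElt, lamElt, lamForm_chiSig hb]
  change deltaInv W (descClass des m I) (descClass des n J) = _
  rw [descClass, map_sum, LinearMap.sum_apply]
  simp only [deltaInv_bas_descClass]
  split_ifs with h
  · subst h
    simp only [true_and]
    rw [Finset.sum_boole, Finset.filter_filter]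
    congr 1
    -- The pairing counts the w with D(w) = I and D(w⁻¹) = J; inversion turns this into the required
    -- count.
    refine Finset.card_equiv (Equiv.inv (W m)) fun w => ?_
    simp
  · exact Finset.sum_eq_zero fun w _ => if_neg fun h' => h h'.1

end Diamond

/-! ## The structures on the diamond -/

section Sub

variable {R : Type} [CommRing R] [IsDomain R] [IsPrincipalIdealRing R]
variable {M M' A A' : Type} [AddCommGroup M] [AddCommGroup M'] [AddCommGroup A]
  [AddCommGroup A'] [Module R M] [Module R M'] [Module R A] [Module R A']

theorem map_map_injective [Module.IsTorsionFree R M'] [Module.IsTorsionFree R A]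
    [Module.IsTorsionFree R A'] {φ : M →ₗ[R] M'} {f : A →ₗ[R] A'} (hφ : Function.Injective φ)
    (hf : Function.Injective f) :
    Function.Injective (TensorProduct.map φ (TensorProduct.map f f)) := by
  have : Module.Flat R M' := flat_of_isTorsionFree
  have : Module.Flat R A := flat_of_isTorsionFree
  exact TensorProduct.map_injective_of_flat_flat _ _ hφ (map_injective hf hf)

end Sub

/-! ### The structures on the spans of the descent classes -/

section Torsion

variable {W : ℕ → Type} [∀ n, Fintype (W n)] {des : ∀ n, W n → Finset ℕ}


theorem Sig_le {P : Submodule ℤ (FreeZ W)} (h : ∀ n, descSpan des n ≤ P) {x : FreeZ W}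
    (hx : x ∈ Sig des) : x ∈ P := iSup_le h hx

theorem IsDescAct.exists_sub {T : ActOps (FreeZ W) ZS} (h : IsDescAct des T) :
    ∃ U : Act ℤ (Sig des) (Sig desA),
      IsActHom U T.gen (Sig desA).subtype (Sig des).subtype := by
  refine exists_sub_act (Sig des).subtype_injective
    (map_injective (Sig des).subtype_injective (Sig desA).subtype_injective) ?_ ?_
  · intro x a
    rw [Submodule.range_subtype]
    refine Sig_le (P := (Sig des).comap (T.gen.act.flip a)) (fun m y hy => ?_) x.2
    refine Sig_le (P := (Sig des).comap (T.gen.act y)) (fun n b hb => ?_) a.2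
    exact descSpan_le_Sig _ (act_mem_descSpan h.act m n y hy b hb)
  · intro x
    refine Sig_le (P := (LinearMap.range (TensorProduct.map (Sig des).subtype
      (Sig desA).subtype)).comap T.gen.coact) (fun n y hy => ?_) x.2
    have : tensorDeg (descSpan des) (descSpan desA) n ≤
        LinearMap.range (TensorProduct.map (Sig des).subtype (Sig desA).subtype) :=
      tensorDeg_le fun i j _ y hy a ha =>
        ⟨⟨y, descSpan_le_Sig i hy⟩ ⊗ₜ ⟨a, descSpan_le_Sig j ha⟩, TensorProduct.map_tmul _ _ _ _⟩
    exact this (h.coact_mem n y hy)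

theorem IsDescAct.isModGr {T : ActOps (FreeZ W) ZS} (h : IsDescAct des T)
    {U : Act ℤ (Sig des) (Sig desA)}
    (hU : IsActHom U T.gen (Sig desA).subtype (Sig des).subtype) :
    IsModGr (sigGrade des) (sigGrade desA) U where
  decomp := isInternal_sigGrade
  act_mem m n x hx a ha := by
    have h1 : (Sig des).subtype (U.act x a) ∈ descSpan des (m + n) := by
      rw [hU.map_act]; exact act_mem_descSpan h.act m n _ hx _ ha
    exact h1
  coact_mem n x hx := hU.coact_mem_of_injective
    (map_injective (Sig des).subtype_injective (Sig desA).subtype_injective)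
    descSpan_le_map descSpan_le_map (h.coact_mem n _ hx)

end Torsion

theorem exists_sigS : ∃ H : Ops ℤ (Sig desA), IsOpsHom H cupS.gen (Sig desA).subtype := by
  obtain ⟨U, hU⟩ := cupS_isDescAct.exists_sub
  have h1 := bas_one_mem_descSpan (des := desA) (fun _ w => desA_eq_empty_iff w) 0
  exact ⟨U.toOps ⟨oneS, descSpan_le_Sig 0 h1⟩ (cupS.gen.counit ∘ₗ (Sig desA).subtype),
    rfl, hU.map_act, fun _ => rfl, hU.map_coact⟩

/-- A graded connected Hopf algebra with a graded right module and comodule over it. -/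
structure IsHopfPair {R M A : Type} [CommRing R] [AddCommGroup M] [AddCommGroup A] [Module R M]
    [Module R A] (gM : ℕ → Submodule R M) (gA : ℕ → Submodule R A) (H : Ops R A) (T : Act R M A) :
    Prop where
  isConn : IsConn gA H
  isAlg : IsAlg H
  isCoalg : IsCoalg H
  isBi : IsBi H
  isModGr : IsModGr gM gA T
  isMod : IsMod H T
  isComod : IsComod H T

theorem IsHopfPair.isGraded {M A : Type} [AddCommGroup M] [AddCommGroup A]
    {gM : ℕ → Submodule ℤ M} {gA : ℕ → Submodule ℤ A} {H : HopfOps A} {T : ActOps M A}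
    (h : IsHopfPair gM gA H.gen T.gen) : IsGradedHopf gA H ∧ IsGradedModComod gM gA H T :=
  ⟨isGradedHopf_of h.isConn h.isAlg h.isCoalg h.isBi,
    isGradedModComod_of h.isModGr h.isMod h.isComod⟩

theorem IsHopfPair.of_surjective {R M A M' A' : Type} [CommRing R] [AddCommGroup M]
    [AddCommGroup A] [AddCommGroup M'] [AddCommGroup A'] [Module R M] [Module R A] [Module R M']
    [Module R A'] {gM : ℕ → Submodule R M} {gA : ℕ → Submodule R A} {gM' : ℕ → Submodule R M'}
    {gA' : ℕ → Submodule R A'} {H : Ops R A} {T : Act R M A} {H' : Ops R A'} {T' : Act R M' A'}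
    {f : A →ₗ[R] A'} {φ : M →ₗ[R] M'} (hf : IsOpsHom H H' f) (h : IsActHom T T' f φ)
    (sf : Function.Surjective f) (sφ : Function.Surjective φ)
    (gf : ∀ n, ∀ a ∈ gA n, f a ∈ gA' n) (sgf : ∀ n, ∀ b ∈ gA' n, ∃ a ∈ gA n, f a = b)
    (gφ : ∀ n, ∀ x ∈ gM n, φ x ∈ gM' n) (sgφ : ∀ n, ∀ y ∈ gM' n, ∃ x ∈ gM n, φ x = y)
    (dA : DirectSum.IsInternal gA') (dM : DirectSum.IsInternal gM')
    (hT : IsHopfPair gM gA H T) : IsHopfPair gM' gA' H' T' where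
  isConn := .of_surjective hf gf sgf dA hT.isConn
  isAlg := .of_surjective hf sf hT.isAlg
  isCoalg := .of_surjective hf sf hT.isCoalg
  isBi := .of_surjective hf sf hT.isBi
  isModGr := .of_surjective h gf sgf gφ sgφ dM hT.isModGr
  isMod := .of_surjective hf h sf sφ hT.isMod
  isComod := .of_surjective hf h sφ hT.isComod

theorem shuffle_isHopfPair :
    IsHopfPair (freeGrade HypGrp) (freeGrade SymGrp) shuffleS.gen shuffleB.gen where
  isConn := shuffleS_isConn
  isAlg := shuffleS_isAlg
  isCoalg := isWordHopf.isCoalg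
  isBi := isWordHopf.isBi
  isModGr := shuffleB_isModGr
  isMod := shuffleB_isMod
  isComod := isWordMod.isComod isWordHopf

theorem cup_isHopfPair :
    IsHopfPair (freeGrade HypGrp) (freeGrade SymGrp) cupS.gen cupB.gen where
  isConn := cupS_isConn
  isAlg := cupS_isAlg
  isCoalg := cupS_isCoalg
  isBi := cupS_isBi
  isModGr := cupB_isModGr
  isMod := cupB_isMod
  isComod := cupB_isComod

theorem sig_isHopfPair {H : Ops ℤ (Sig desA)} (hH : IsOpsHom H cupS.gen (Sig desA).subtype)
    {T : Act ℤ (Sig desB) (Sig desA)}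
    (hT : IsActHom T cupB.gen (Sig desA).subtype (Sig desB).subtype) :
    IsHopfPair (sigGrade desB) (sigGrade desA) H T where
  isConn :=
    have h1 := cupS_isDescAct.isModGr (U := H.self) ⟨hH.map_mul, hH.map_comul⟩
    { decomp := isInternal_sigGrade
      one_mem := by
        have h2 : (Sig desA).subtype H.one ∈ descSpan desA 0 := by
          rw [hH.map_one]; exact bas_one_mem_descSpan (fun _ w => desA_eq_empty_iff w) 0
        exact h2
      mul_mem := h1.act_mem
      comul_mem := h1.coact_mem
      counit_eq_zero := fun n hn a ha => by
        rw [← hH.map_counit]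
        exact cupS_isConn.counit_eq_zero n hn _ (descSpan_le_freeGrade n ha)
      conn := fun a ha => (Sig desA).subtype_injective (by
        rw [map_smul, hH.map_one, ← hH.map_counit]
        exact cupS_isConn.conn _ (descSpan_le_freeGrade 0 ha)) }
  isAlg := .of_injective hH (Sig desA).subtype_injective cupS_isAlg
  isCoalg := .of_injective hH (Sig desA).subtype_injective
    (map_map_injective (Sig desA).subtype_injective (Sig desA).subtype_injective) cupS_isCoalg
  isBi := .of_injective hH
    (map_injective (Sig desA).subtype_injective (Sig desA).subtype_injective) cupS_isBi
  isModGr := cupB_isDescAct.isModGr hT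
  isMod := .of_injective hH hT (Sig desB).subtype_injective cupB_isMod
  isComod := .of_injective hH hT (Sig desB).subtype_injective
    (map_map_injective (Sig desB).subtype_injective (Sig desA).subtype_injective) cupB_isComod

theorem dual_isHopfPair {H : Ops ℤ (SigDual desA)} (hH : IsOpsHom cupS.gen H (chi' desA))
    {T : Act ℤ (SigDual desB) (SigDual desA)}
    (hT : IsActHom cupB.gen T (chi' desA) (chi' desB)) :
    IsHopfPair (gradedDualGrade (sigGrade desB)) (gradedDualGrade (sigGrade desA)) H T :=
  .of_surjective hH hT chi'_surjective chi'_surjective chi'_mem chi'_graded_surjective chi'_mem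
    chi'_graded_surjective (isInternal_gradedDualGrade isInternal_sigGrade)
    (isInternal_gradedDualGrade isInternal_sigGrade) cup_isHopfPair

theorem lam_isHopfPair {H' : Ops ℤ (Sig desA)} {T' : Act ℤ (Sig desB) (Sig desA)}
    (h : IsHopfPair (sigGrade desB) (sigGrade desA) H' T')
    {H : Ops ℤ (Lam desA)} (hH : IsOpsHom H' H (chiSig desA))
    {T : Act ℤ (Lam desB) (Lam desA)} (hT : IsActHom T' T (chiSig desA) (chiSig desB)) :
    IsHopfPair (lamGrade desB) (lamGrade desA) H T :=
  .of_surjective hH hT chiSig_surjective chiSig_surjective chiSig_mem chiSig_graded_surjective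
    chiSig_mem chiSig_graded_surjective isInternal_lamGrade isInternal_lamGrade h

theorem exists_dualS {H : Ops ℤ (Sig desA)} (hH : IsOpsHom H cupS.gen (Sig desA).subtype) :
    ∃ H' : Ops ℤ (SigDual desA), IsOpsHom cupS.gen H' (chi' desA) :=
  exists_quot_ops_of_dual hH chi'_surjective deltaInv_isDual deltaInv_symm evalPair_chi'
    evalPair_separating

theorem exists_dualB {T : Act ℤ (Sig desB) (Sig desA)}
    (hT : IsActHom T cupB.gen (Sig desA).subtype (Sig desB).subtype) :
    ∃ T' : Act ℤ (SigDual desB) (SigDual desA), IsActHom cupB.gen T' (chi' desA) (chi' desB) :=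
  exists_quot_act_of_dual hT chi'_surjective chi'_surjective deltaInv_isActDual deltaInv_symm
    deltaInv_symm evalPair_chi' evalPair_chi' evalPair_separating evalPair_separating

/-- The structures on the entries of the diamond for which its maps are morphisms. -/
structure IsDiamond (HS : Ops ℤ (Sig desA)) (HD : Ops ℤ (SigDual desA)) (HL : Ops ℤ (Lam desA))
    (TS : Act ℤ (Sig desB) (Sig desA)) (TD : Act ℤ (SigDual desB) (SigDual desA))
    (TL : Act ℤ (Lam desB) (Lam desA)) : Prop where
  sigS : IsOpsHom HS cupS.gen (Sig desA).subtype
  sigB : IsActHom TS cupB.gen (Sig desA).subtype (Sig desB).subtype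
  dualS : IsOpsHom cupS.gen HD (chi' desA)
  dualB : IsActHom cupB.gen TD (chi' desA) (chi' desB)
  sigS_lamS : IsOpsHom HS HL (chiSig desA)
  sigB_lamB : IsActHom TS TL (chiSig desA) (chiSig desB)
  lamS_dualS : IsOpsHom HL HD (Lam desA).subtype
  lamB_dualB : IsActHom TL TD (Lam desA).subtype (Lam desB).subtype

/-- The structure on Σ comes first, as a substructure; the one on Σ^* rests on it by duality; and Λ
is the image of the composite of the two morphisms through the middle of the diamond. -/
theorem exists_isDiamond : ∃ HS HD HL TS TD TL, IsDiamond HS HD HL TS TD TL := by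
  obtain ⟨HS, h1⟩ := exists_sigS
  obtain ⟨TS, h2⟩ := cupB_isDescAct.exists_sub
  obtain ⟨HD, h3⟩ := exists_dualS h1
  obtain ⟨TD, h4⟩ := exists_dualB h2
  obtain ⟨HL, h5, h6⟩ := exists_sub_ops_of_comp (c := chiSig desA) (f := (Lam desA).subtype)
    chiSig_surjective (Lam desA).subtype_injective
    (map_injective (Lam desA).subtype_injective (Lam desA).subtype_injective) (h1.comp h3)
  obtain ⟨TL, h7, h8⟩ := exists_sub_act_of_comp (c := chiSig desA) (f := (Lam desA).subtype)
    (γ := chiSig desB) (φ := (Lam desB).subtype)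
    chiSig_surjective chiSig_surjective (Lam desB).subtype_injective
    (map_injective (Lam desB).subtype_injective (Lam desA).subtype_injective) (h2.comp h4)
  exact ⟨HS, HD, HL, TS, TD, TL, h1, h2, h3, h4, h6, h8, h5, h7⟩

/-! ### Dualities within the diamond -/

section

variable {HS : Ops ℤ (Sig desA)} {HD : Ops ℤ (SigDual desA)} {HL : Ops ℤ (Lam desA)}
  {TS : Act ℤ (Sig desB) (Sig desA)} {TD : Act ℤ (SigDual desB) (SigDual desA)}
  {TL : Act ℤ (Lam desB) (Lam desA)}

theorem IsDiamond.sig_isDual (h : IsDiamond HS HD HL TS TD TL) : IsDual HS HD (evalPair desA) :=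
  deltaInv_isDual.transfer h.sigS (.id _) (.id _) h.dualS Function.surjective_id chi'_surjective
    evalPair_chi'

theorem IsDiamond.sig_isActDual (h : IsDiamond HS HD HL TS TD TL) :
    IsActDual TS TD (evalPair desB) (evalPair desA) :=
  deltaInv_isActDual.transfer h.sigB (.id _) (.id _) h.dualB Function.surjective_id
    Function.surjective_id chi'_surjective chi'_surjective evalPair_chi' evalPair_chi'

theorem IsDiamond.lam_isDual (h : IsDiamond HS HD HL TS TD TL)
    {b : Lam desA →ₗ[ℤ] Lam desA →ₗ[ℤ] ℤ}
    (hb : ∀ s l, b (chiSig desA s) l = evalPair desA s ((Lam desA).subtype l)) :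
    IsDual HL HL b :=
  deltaInv_isDual.transfer h.sigS h.sigS h.sigS_lamS h.sigS_lamS chiSig_surjective
    chiSig_surjective (lamForm_chiSig hb)

theorem IsDiamond.lam_isActDual (h : IsDiamond HS HD HL TS TD TL)
    {b : Lam desA →ₗ[ℤ] Lam desA →ₗ[ℤ] ℤ} {b' : Lam desB →ₗ[ℤ] Lam desB →ₗ[ℤ] ℤ}
    (hb : ∀ s l, b (chiSig desA s) l = evalPair desA s ((Lam desA).subtype l))
    (hb' : ∀ s l, b' (chiSig desB s) l = evalPair desB s ((Lam desB).subtype l)) :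
    IsActDual TL TL b' b :=
  deltaInv_isActDual.transfer h.sigB h.sigB h.sigB_lamB h.sigB_lamB chiSig_surjective
    chiSig_surjective chiSig_surjective chiSig_surjective (lamForm_chiSig hb') (lamForm_chiSig hb)

end

theorem IsDiamond.exists_lamForms {HS : HopfOps (Sig desA)} {HD : HopfOps (SigDual desA)}
    {HL : HopfOps (Lam desA)} {TS : ActOps (Sig desB) (Sig desA)}
    {TD : ActOps (SigDual desB) (SigDual desA)} {TL : ActOps (Lam desB) (Lam desA)}
    (h : IsDiamond HS.gen HD.gen HL.gen TS.gen TD.gen TL.gen) :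
    ∃ (bA : Lam desA →ₗ[ℤ] Lam desA →ₗ[ℤ] ℤ) (bB : Lam desB →ₗ[ℤ] Lam desB →ₗ[ℤ] ℤ),
      (IsLamForm desA bA ∧ (∀ x y, bA x y = bA y x) ∧ bA.Nondegenerate) ∧
      (IsLamForm desB bB ∧ (∀ x y, bB x y = bB y x) ∧ bB.Nondegenerate) ∧
      IsHopfDual HL HL bA ∧ IsModComodDual TL TL bB bA ∧
      ∀ x y, bB (chiSig desB x) y = evalPair desB x ((Lam desB).subtype y) := by
  obtain ⟨bA, hA⟩ := exists_lamForm (des := desA)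
  obtain ⟨bB, hB⟩ := exists_lamForm (des := desB)
  exact ⟨bA, bB, ⟨lamForm_isLamForm hA, lamForm_symm hA, lamForm_nondegenerate hA⟩,
    ⟨lamForm_isLamForm hB, lamForm_symm hB, lamForm_nondegenerate hB⟩,
    isHopfDual_iff.2 (h.lam_isDual hA), isModComodDual_iff.2 (h.lam_isActDual hA hB), hB⟩

/-- Σ embeds into ℤW, Σ^* is a quotient of ℤW, and Λ is a quotient of Σ. An injection determines the
structure of its source, provided it stays injective after tensoring, and a surjection that of its
target. -/
theorem IsDiamond.unique {D E : DiamondOps}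
    (h : IsDiamond D.sigS.gen D.dualS.gen D.lamS.gen D.sigB.gen D.dualB.gen D.lamB.gen)
    (h' : IsDiamond E.sigS.gen E.dualS.gen E.lamS.gen E.sigB.gen E.dualB.gen E.lamB.gen) :
    D = E := by
  have i2 : Function.Injective (TensorProduct.map (Sig desA).subtype (Sig desA).subtype) :=
    map_injective (Sig desA).subtype_injective (Sig desA).subtype_injective
  have i2' : Function.Injective (TensorProduct.map (Sig desB).subtype (Sig desA).subtype) :=
    map_injective (Sig desB).subtype_injective (Sig desA).subtype_injective
  have e1 := h.sigS.unique_of_injective (Sig desA).subtype_injective i2 h'.sigS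
  have e2 := h.sigB.unique_of_injective (Sig desB).subtype_injective i2' h'.sigB
  have e3 := h.dualS.unique_of_surjective chi'_surjective h'.dualS
  have e4 := h.dualB.unique_of_surjective chi'_surjective chi'_surjective h'.dualB
  have e5 := h.sigS_lamS.unique_of_surjective chiSig_surjective (e1 ▸ h'.sigS_lamS)
  have e6 := h.sigB_lamB.unique_of_surjective chiSig_surjective chiSig_surjective
    (e2 ▸ h'.sigB_lamB)
  have f1 : D.sigS = E.sigS := congrArg Ops.toHopf e1
  have f2 : D.sigB = E.sigB := congrArg Act.toActOps e2
  have f3 : D.dualS = E.dualS := congrArg Ops.toHopf e3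
  have f4 : D.dualB = E.dualB := congrArg Act.toActOps e4
  have f5 : D.lamS = E.lamS := congrArg Ops.toHopf e5
  have f6 : D.lamB = E.lamB := congrArg Act.toActOps e6
  obtain ⟨a, b, c, d, e, f⟩ := D
  obtain ⟨a', b', c', d', e', f'⟩ := E
  congr

end MRTypeB

/-! ### Assembly of the theorem -/

theorem mainTheorem7 :
    -- the two type A Hopf algebras, and `ℤ𝔅` as a module and comodule over each
    (IsGradedHopf (freeGrade SymGrp) shuffleS ∧
      IsGradedModComod (freeGrade HypGrp) (freeGrade SymGrp) shuffleS shuffleB) ∧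
    (IsGradedHopf (freeGrade SymGrp) cupS ∧
      IsGradedModComod (freeGrade HypGrp) (freeGrade SymGrp) cupS cupB) ∧
    -- duality of the two structures via `⟨u, v⟩ = δ_{u,v}`
    (IsGradedPerfect (freeGrade SymGrp) (freeGrade SymGrp) (delta SymGrp) ∧
      IsGradedPerfect (freeGrade HypGrp) (freeGrade HypGrp) (delta HypGrp) ∧
      IsHopfDual shuffleS cupS (delta SymGrp) ∧
      IsModComodDual shuffleB cupB (delta HypGrp) (delta SymGrp)) ∧
    -- `w ↦ w⁻¹` is an isomorphism of the two structures
    (IsHopfHom (freeGrade SymGrp) (freeGrade SymGrp) shuffleS cupS (invMap SymGrp).toLinearMap ∧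
      IsHopfHom (freeGrade SymGrp) (freeGrade SymGrp) cupS shuffleS
        (invMap SymGrp).symm.toLinearMap ∧
      IsModComodHom (freeGrade HypGrp) (freeGrade HypGrp) shuffleB cupB
        (invMap SymGrp).toLinearMap (invMap HypGrp).toLinearMap ∧
      IsModComodHom (freeGrade HypGrp) (freeGrade HypGrp) cupB shuffleB
        (invMap SymGrp).symm.toLinearMap (invMap HypGrp).symm.toLinearMap) ∧
    -- the diamond: commutativity, injectivity and surjectivity of its maps
    ((chi' desB).comp (Sig desB).subtype = (Lam desB).subtype.comp (chiSig desB) ∧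
      Function.Injective (Sig desB).subtype ∧ Function.Surjective (chi' desB) ∧
      Function.Surjective (chiSig desB) ∧ Function.Injective (Lam desB).subtype) ∧
    -- the structures that `ℤ𝔖` and `ℤ𝔅` induce on the other entries, uniquely
    ∃! D : DiamondOps,
      -- each entry is a graded right module and comodule over the type A Hopf algebra
      (IsGradedHopf (sigGrade desA) D.sigS ∧
        IsGradedModComod (sigGrade desB) (sigGrade desA) D.sigS D.sigB) ∧
      (IsGradedHopf (gradedDualGrade (sigGrade desA)) D.dualS ∧
        IsGradedModComod (gradedDualGrade (sigGrade desB)) (gradedDualGrade (sigGrade desA))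
          D.dualS D.dualB) ∧
      (IsGradedHopf (lamGrade desA) D.lamS ∧
        IsGradedModComod (lamGrade desB) (lamGrade desA) D.lamS D.lamB) ∧
      -- the four maps of the diamond are morphisms, along those of the type A diamond
      (IsHopfHom (sigGrade desA) (freeGrade SymGrp) D.sigS cupS (Sig desA).subtype ∧
        IsModComodHom (sigGrade desB) (freeGrade HypGrp) D.sigB cupB
          (Sig desA).subtype (Sig desB).subtype) ∧
      (IsHopfHom (freeGrade SymGrp) (gradedDualGrade (sigGrade desA)) cupS D.dualS (chi' desA) ∧
        IsModComodHom (freeGrade HypGrp) (gradedDualGrade (sigGrade desB)) cupB D.dualB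
          (chi' desA) (chi' desB)) ∧
      (IsHopfHom (sigGrade desA) (lamGrade desA) D.sigS D.lamS (chiSig desA) ∧
        IsModComodHom (sigGrade desB) (lamGrade desB) D.sigB D.lamB
          (chiSig desA) (chiSig desB)) ∧
      (IsHopfHom (lamGrade desA) (gradedDualGrade (sigGrade desA)) D.lamS D.dualS
          (Lam desA).subtype ∧
        IsModComodHom (lamGrade desB) (gradedDualGrade (sigGrade desB)) D.lamB D.dualB
          (Lam desA).subtype (Lam desB).subtype) ∧
      -- the reflected diamond is dual: `Σ` and `Σ^*` by evaluation
      (IsGradedPerfect (sigGrade desA) (gradedDualGrade (sigGrade desA)) (evalPair desA) ∧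
        IsGradedPerfect (sigGrade desB) (gradedDualGrade (sigGrade desB)) (evalPair desB) ∧
        IsHopfDual D.sigS D.dualS (evalPair desA) ∧
        IsModComodDual D.sigB D.dualB (evalPair desB) (evalPair desA)) ∧
      -- `ℤ𝔅` with itself by `⟨u, v⟩ = δ_{u⁻¹,v}`, and then `ι` is dual to `χ'`
      (IsGradedPerfect (freeGrade SymGrp) (freeGrade SymGrp) (deltaInv SymGrp) ∧
        IsGradedPerfect (freeGrade HypGrp) (freeGrade HypGrp) (deltaInv HypGrp) ∧
        IsHopfDual cupS cupS (deltaInv SymGrp) ∧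
        IsModComodDual cupB cupB (deltaInv HypGrp) (deltaInv SymGrp) ∧
        ∀ x y, deltaInv HypGrp ((Sig desB).subtype x) y = evalPair desB x (chi' desB y)) ∧
      -- `Λ` with itself by its bilinear form, and then `χ'` is dual to `ι`
      (∃ (bA : Lam desA →ₗ[ℤ] Lam desA →ₗ[ℤ] ℤ) (bB : Lam desB →ₗ[ℤ] Lam desB →ₗ[ℤ] ℤ),
        (IsLamForm desA bA ∧ (∀ x y, bA x y = bA y x) ∧ bA.Nondegenerate) ∧
        (IsLamForm desB bB ∧ (∀ x y, bB x y = bB y x) ∧ bB.Nondegenerate) ∧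
        IsHopfDual D.lamS D.lamS bA ∧ IsModComodDual D.lamB D.lamB bB bA ∧
        ∀ x y, bB (chiSig desB x) y = evalPair desB x ((Lam desB).subtype y)) := by
  refine ⟨shuffle_isHopfPair.isGraded, cup_isHopfPair.isGraded,
    ⟨isGradedPerfect_delta, isGradedPerfect_delta, isHopfDual_iff.2 delta_isDual,
      isModComodDual_iff.2 delta_isActDual⟩,
    ⟨isHopfHom_iff.2 ⟨invMap_graded, invMap_isOpsHom⟩, ?_,
      isModComodHom_iff.2 ⟨invMap_graded, invMap_isActHom⟩, ?_⟩,
    ⟨rfl, (Sig desB).subtype_injective, chi'_surjective, chiSig_surjective,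
      (Lam desB).subtype_injective⟩, ?_⟩
  · rw [invMap_symm]
    exact isHopfHom_iff.2 ⟨invMap_graded, invMap_isOpsHom'⟩
  · rw [invMap_symm, invMap_symm]
    exact isModComodHom_iff.2 ⟨invMap_graded, invMap_isActHom'⟩
  obtain ⟨HS, HD, HL, TS, TD, TL, h⟩ := exists_isDiamond
  have hS := sig_isHopfPair h.sigS h.sigB
  refine ⟨⟨HS.toHopf, HD.toHopf, HL.toHopf, TS.toActOps, TD.toActOps, TL.toActOps⟩,
    ⟨?_, ?_, ?_, ⟨?_, ?_⟩, ⟨?_, ?_⟩, ⟨?_, ?_⟩,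
      ⟨?_, ?_⟩, ⟨?_, ?_, ?_, ?_⟩, ⟨?_, ?_, ?_, ?_, ?_⟩, ?_⟩, ?_⟩
  · exact IsHopfPair.isGraded hS
  · exact IsHopfPair.isGraded (dual_isHopfPair h.dualS h.dualB)
  · exact IsHopfPair.isGraded (lam_isHopfPair hS h.sigS_lamS h.sigB_lamB)
  · exact isHopfHom_iff.2 ⟨fun n _ hx => descSpan_le_freeGrade n hx, h.sigS⟩
  · exact isModComodHom_iff.2 ⟨fun n _ hx => descSpan_le_freeGrade n hx, h.sigB⟩
  · exact isHopfHom_iff.2 ⟨chi'_mem, h.dualS⟩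
  · exact isModComodHom_iff.2 ⟨chi'_mem, h.dualB⟩
  · exact isHopfHom_iff.2 ⟨chiSig_mem, h.sigS_lamS⟩
  · exact isModComodHom_iff.2 ⟨chiSig_mem, h.sigB_lamB⟩
  · exact isHopfHom_iff.2 ⟨subtype_lam_mem, h.lamS_dualS⟩
  · exact isModComodHom_iff.2 ⟨subtype_lam_mem, h.lamB_dualB⟩
  · exact isGradedPerfect_evalPair
  · exact isGradedPerfect_evalPair
  · exact isHopfDual_iff.2 h.sig_isDual
  · exact isModComodDual_iff.2 h.sig_isActDual
  · exact isGradedPerfect_deltaInv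
  · exact isGradedPerfect_deltaInv
  · exact isHopfDual_iff.2 deltaInv_isDual
  · exact isModComodDual_iff.2 deltaInv_isActDual
  · exact fun x y => (evalPair_chi' x y).symm
  · exact IsDiamond.exists_lamForms (HS := HS.toHopf) (HD := HD.toHopf) (HL := HL.toHopf)
      (TS := TS.toActOps) (TD := TD.toActOps) (TL := TL.toActOps) h
  -- Only the clauses about morphisms matter for uniqueness; the axioms and the dualities are not
  -- needed.
  rintro E ⟨-, -, -, ⟨e1, e2⟩, ⟨e3, e4⟩, ⟨e5, e6⟩, ⟨e7, e8⟩, -⟩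
  have hE : IsDiamond E.sigS.gen E.dualS.gen E.lamS.gen E.sigB.gen E.dualB.gen E.lamB.gen :=
    ⟨(isHopfHom_iff.1 e1).2, (isModComodHom_iff.1 e2).2, (isHopfHom_iff.1 e3).2,
      (isModComodHom_iff.1 e4).2, (isHopfHom_iff.1 e5).2, (isModComodHom_iff.1 e6).2,
      (isHopfHom_iff.1 e7).2, (isModComodHom_iff.1 e8).2⟩
  exact hE.unique h
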